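/- **Setting.** Let $h\in\mathbb R^3$ and $\Lambda\in\mathbb R$. A *Bianchi I solution on $(0,T]$ of the massless Einstein–Vlasov system with magnetic field $h$, cosmological constant $\Lambda$ and initial distribution function $f_0$* consists of a space-time metric $\tilde g=-dt^2+\tilde a_{ij}(t)\,dx^i dx^j$ with $\tilde a$ symmetric and positive definite on $(0,T]$, of $\tilde k_{ij}=\frac{d}{dt}\tilde a_{ij}$, which is continuous (and differentiable) on $(0,T]$, and of a distribution function $0\le f\in C^1((0,T];L^1(\mathbb R^3))$ of the covariant momenta $p=(p_1,p_2,p_3)$, of finite energy and with $f(t)\to f_0$ in $L^1$ as $t\to0^+$, such that on $(0,T]$ the Vlasov equation $p^0\partial_t f=0$, the source-free Maxwell equations for the field $F_{ij}=\epsilon_{ijk}h^k$, $F_{0i}=0$, and all the Einstein equations, constraints included, $$\tilde R_{\alpha\beta}=8\pi(\tilde T^{\rm max}_{\alpha\beta}+\tilde T^{\rm kt}_{\alpha\beta})+\Lambda\tilde g_{\alpha\beta}$$ hold. Here $p^0=-p_0=(\tilde a^{mn}p_mp_n)^{1/2}$ with $(\tilde a^{mn})$ the inverse matrix of $(\tilde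 a_{mn})$, and $$\tilde T^{\rm max}_{\alpha\beta}=\tfrac1{2\pi}\big(\tilde g^{\gamma\delta}F_{\alpha\delta}F_{\beta\gamma}-\tfrac14\tilde g_{\alpha\beta}\tilde g^{\gamma\delta}\tilde g^{\lambda\mu}F_{\gamma\lambda}F_{\delta\mu}\big),\qquad \tilde T^{\rm kt}_{\alpha\beta}=\int_{\mathbb R^3} f\,p_\alpha p_\beta\,\frac{d^3p}{p^0\sqrt{\det\tilde a}} .$$ The solution *has an initial conformal gauge singularity* if, in the time $\tau=\sqrt{2t}$, the rescaled metric $a_{ij}=\tau^{-2}\tilde a_{ij}$ and its derivative $k_{ij}=\frac{d}{d\tau}a_{ij}$ extend continuously to $\tau=0$, with $a_{ij}(0)$ positive definite. **Theorem.** Let $f_0\ge0$ be a smooth function with compact support in $\mathbb R^3\setminus\{0\}$, not identically zero, with $\int f_0\,p_i\,d^3p=0$ for $i=1,2,3$, and let $h\in\mathbb R^3$. Then there is a positive definite symmetric matrix $a_0$, depending only on $f_0$ and $h$, such that for every $\Lambda\in\mathbb R$ there are a $T>0$ and a Bianchi I solution $(\tilde a,\tilde k,f)$ on $(0,T]$ as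 above, with an initial conformal gauge singularity. It is unique: any other such solution, on any interval $(0,T']$, agrees with it on $(0,\min(T,T')]$. As $t\to0^+$, $$\tilde a_{ij}=2t\,a_{0ij}+o(t^{3/2}),\qquad \tilde k_{ij}=2a_{0ij}+o(t^{1/2}).$$ If in addition $a_{0ij}h^ih^j<\frac16$, or $a_{0ij}h^ih^j<\frac16\det a_0$, then $\tilde a_{ij}$ and $\tilde k_{ij}$ are $C^1$ on $(0,T]$, the rescaled $a_{ij}$ and $k_{ij}$ extend to $C^1$ functions of $\tau\in[0,\sqrt{2T}]$, and $$\tilde a_{ij}=2t\,a_{0ij}+o(t^2),\qquad \tilde k_{ij}=2a_{0ij}+o(t).$$ -/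

import Mathlib

open Set Filter Topology MeasureTheory Asymptotics
open scoped Matrix ContDiff

/-! Bianchi I space-times.  A tensor component is a function of the time `t` only.  Space-time indices
are `Fin 1 ⊕ Fin 3`: `Sum.inl 0` is the time index, `Sum.inr i` are the spatial ones.  Time derivatives
are taken within the time interval `I`, so that they are one-sided at an end point that belongs to it. -/

namespace BianchiI

/-- Space-time indices. -/
abbrev Idx : Type := Fin 1 ⊕ Fin 3

/-- Covariant spatial momenta `(p₁, p₂, p₃)`; the volume on this type is `dp₁ dp₂ dp₃`. -/
abbrev Mom : Type := Fin 3 → ℝ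

noncomputable section

/-- The space-time metric `-dt² + a_ij dx^i dx^j`. -/
def metric (a : ℝ → Matrix (Fin 3) (Fin 3) ℝ) (t : ℝ) : Matrix Idx Idx ℝ :=
  Matrix.fromBlocks (-1) 0 0 (a t)

/-- The partial derivative `∂_μ` of a function of `t` only. -/
def pd (I : Set ℝ) (μ : Idx) (u : ℝ → ℝ) (t : ℝ) : ℝ :=
  match μ with
  | Sum.inl _ => derivWithin u I t
  | Sum.inr _ => 0

/-- The Christoffel symbols
`Γ^α_βγ = (1/2) g^αδ (∂_γ g_δβ + ∂_β g_δγ - ∂_δ g_βγ)`. -/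
def christoffel (I : Set ℝ) (g : ℝ → Matrix Idx Idx ℝ) (α β γ : Idx) (t : ℝ) : ℝ :=
  (1 / 2) * ∑ δ, (g t)⁻¹ α δ *
    (pd I γ (fun s => g s δ β) t + pd I β (fun s => g s δ γ) t - pd I δ (fun s => g s β γ) t)

/-- The Ricci tensor
`R_μρ = ∂_ν Γ^ν_μρ - ∂_μ Γ^ν_νρ + Γ^α_μρ Γ^ν_αν - Γ^α_νρ Γ^ν_αμ`. -/
def ricci (I : Set ℝ) (g : ℝ → Matrix Idx Idx ℝ) (μ ρ : Idx) (t : ℝ) : ℝ :=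
  (∑ ν, pd I ν (christoffel I g ν μ ρ) t) - (∑ ν, pd I μ (christoffel I g ν ν ρ) t)
    + (∑ α, ∑ ν, christoffel I g α μ ρ t * christoffel I g ν α ν t)
    - (∑ α, ∑ ν, christoffel I g α ν ρ t * christoffel I g ν α μ t)

/-- The electromagnetic field tensor of the magnetic field `h`: `F_ij = ε_ijk h^k`, `F_0i = 0`.
Its components are constant, so that the two-form `F` is closed. -/
def faraday (h : Fin 3 → ℝ) : Matrix Idx Idx ℝ :=
  Matrix.fromBlocks 0 0 0 !![0, h 2, -h 1; -h 2, 0, h 0; h 1, -h 0, 0]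

/-- The covariant derivative `∇_γ F_αβ` of a tensor with constant components. -/
def covDeriv (I : Set ℝ) (g : ℝ → Matrix Idx Idx ℝ) (F : Matrix Idx Idx ℝ) (γ α β : Idx) (t : ℝ) :
    ℝ :=
  - (∑ δ, christoffel I g δ γ α t * F δ β) - ∑ δ, christoffel I g δ γ β t * F α δ

/-- The stress tensor of the electromagnetic field,
`(1/2π) (g^γδ F_αδ F_βγ - (1/4) g_αβ g^γδ g^λμ F_γλ F_δμ)`. -/
def stressMax (g F : Matrix Idx Idx ℝ) (α β : Idx) : ℝ :=
  1 / (2 * Real.pi) * ((∑ γ, ∑ δ, g⁻¹ γ δ * F α δ * F β γ)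
    - 1 / 4 * g α β * ∑ γ, ∑ δ, ∑ l, ∑ m, g⁻¹ γ δ * g⁻¹ l m * F γ l * F δ m)

/-- The energy `p⁰ = (b^mn p_m p_n)^{1/2}` of a massless particle, `b` being the inverse of the spatial
metric `a`. -/
def energy (a : Matrix (Fin 3) (Fin 3) ℝ) (p : Mom) : ℝ :=
  Real.sqrt (p ⬝ᵥ (a⁻¹ *ᵥ p))

/-- The covariant null momentum `p_α` with spatial part `p`, so that `p_0 = -p⁰`. -/
def nullCovector (a : Matrix (Fin 3) (Fin 3) ℝ) (p : Mom) : Idx → ℝ :=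
  Sum.elim (fun _ => -energy a p) p

/-- The stress tensor of massless kinetic theory: `∫ f p_α p_β ω`, where
`ω = (p⁰ √(det a))⁻¹ dp₁ dp₂ dp₃` is the invariant volume of the null cone. -/
def stressKin (a : Matrix (Fin 3) (Fin 3) ℝ) (f : Mom → ℝ) (α β : Idx) : ℝ :=
  ∫ p : Mom, f p * nullCovector a p α * nullCovector a p β / (energy a p * Real.sqrt a.det)

/-- Bianchi I solutions on `(0, T]` of the massless Einstein–Vlasov system with the cosmological
constant `Λ` and the magnetic field `h`: `a` is the spatial metric, `k` its time derivative, and `f` the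
distribution function, which starts from `f₀` at `t = 0`. -/
structure IsSolution (Λ : ℝ) (h : Fin 3 → ℝ) (f₀ : Mom → ℝ) (T : ℝ)
    (a k : ℝ → Matrix (Fin 3) (Fin 3) ℝ) (f : ℝ → Lp ℝ 1 (volume : Measure Mom)) : Prop where
  /-- The spatial metric is symmetric and positive definite. -/
  posDef : ∀ t ∈ Ioc 0 T, (a t).PosDef
  /-- `k_ij = d a_ij / dt`. -/
  hasDeriv : ∀ t ∈ Ioc 0 T, ∀ i j, HasDerivWithinAt (fun s => a s i j) (k t i j) (Ioc 0 T) t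
  contK : ∀ i j, ContinuousOn (fun s => k s i j) (Ioc 0 T)
  /-- The second time derivatives in the Ricci tensor exist. -/
  diffK : ∀ i j, DifferentiableOn ℝ (fun s => k s i j) (Ioc 0 T)
  /-- The distribution function is continuously differentiable with values in `L¹`. -/
  contDiffF : ContDiffOn ℝ 1 f (Ioc 0 T)
  nonnegF : ∀ t ∈ Ioc 0 T, ∀ᵐ p : Mom, 0 ≤ f t p
  /-- Finite energy: the integrals in the stress tensor converge. -/
  integrableF : ∀ t ∈ Ioc 0 T, Integrable (fun p : Mom => ‖p‖ * f t p)
  initialF : Tendsto (fun t => eLpNorm (fun p : Mom => f t p - f₀ p) 1 volume) (𝓝[>] 0) (𝓝 0)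
  /-- The Vlasov equation `p⁰ ∂_t f = 0`. -/
  vlasov : ∀ t ∈ Ioc 0 T, ∀ᵐ p : Mom, energy (a t) p * (derivWithin f (Ioc 0 T) t) p = 0
  /-- The source-free Maxwell equations `∇^α F_αβ = 0`. -/
  maxwell : ∀ t ∈ Ioc 0 T, ∀ β : Idx,
    ∑ γ, ∑ α, (metric a t)⁻¹ γ α * covDeriv (Ioc 0 T) (metric a) (faraday h) γ α β t = 0
  /-- The Einstein equations `R_αβ = 8π T_αβ + Λ g_αβ`, constraints included. -/
  einstein : ∀ t ∈ Ioc 0 T, ∀ α β : Idx,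
    ricci (Ioc 0 T) (metric a) α β t
      = 8 * Real.pi * (stressMax (metric a t) (faraday h) α β + stressKin (a t) (f t) α β)
        + Λ * metric a t α β

/-- The spatial metric `a` has an initial conformal gauge singularity, and the rescaled quantities are
`C^n` up to it: in the time `τ = (2t)^{1/2}`, the rescaled metric `τ⁻² a_ij` and its rate of change
`d(τ⁻² a_ij)/dτ` extend to `C^n` functions on the closed interval `0 ≤ τ ≤ (2T)^{1/2}`, and the extended
metric is nondegenerate at `τ = 0`. -/
def HasConformalGaugeSingularity (n : ℕ) (T : ℝ) (a : ℝ → Matrix (Fin 3) (Fin 3) ℝ) : Prop :=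
  ∃ A K : ℝ → Matrix (Fin 3) (Fin 3) ℝ,
    (∀ τ ∈ Ioc 0 (Real.sqrt (2 * T)), A τ = (τ ^ 2)⁻¹ • a (τ ^ 2 / 2)) ∧
    (A 0).PosDef ∧
    (∀ τ ∈ Icc 0 (Real.sqrt (2 * T)), ∀ i j,
      HasDerivWithinAt (fun s => A s i j) (K τ i j) (Icc 0 (Real.sqrt (2 * T))) τ) ∧
    (∀ i j, ContDiffOn ℝ n (fun s => A s i j) (Icc 0 (Real.sqrt (2 * T)))) ∧
    (∀ i j, ContDiffOn ℝ n (fun s => K s i j) (Icc 0 (Real.sqrt (2 * T))))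

end

end BianchiI

namespace DissipativeODE

variable {V : Type*} [NormedAddCommGroup V] [NormedSpace ℝ V] [FiniteDimensional ℝ V]

/-- The flow of the linear equation `y' = L y`. -/
noncomputable def flow (L : V →L[ℝ] V) (u : ℝ) : V →L[ℝ] V := NormedSpace.exp (u • L)

lemma hasDerivAt_flow (L : V →L[ℝ] V) (u : ℝ) : HasDerivAt (flow L) (L * flow L u) u := by
  have : CompleteSpace V := FiniteDimensional.complete ℝ V
  exact hasDerivAt_exp_smul_const' L u

lemma flow_zero {V : Type*} [NormedAddCommGroup V] [NormedSpace ℝ V] (L : V →L[ℝ] V) :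
    flow L 0 = 1 := by
  simp [flow, NormedSpace.exp_zero]

lemma flow_add (L : V →L[ℝ] V) (u v : ℝ) : flow L (u + v) = flow L u * flow L v := by
  have : CompleteSpace V := FiniteDimensional.complete ℝ V
  let _ : NormedAlgebra ℚ (V →L[ℝ] V) := NormedAlgebra.restrictScalars ℚ ℝ _
  rw [flow, add_smul]
  exact NormedSpace.exp_add_of_commute (((Commute.refl L).smul_left u).smul_right v)

lemma continuous_flow (L : V →L[ℝ] V) : Continuous (flow L) :=
  continuous_iff_continuousAt.2 fun u => (hasDerivAt_flow L u).continuousAt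

lemma exists_norm_flow_le (L : V →L[ℝ] V) (B : V →L[ℝ] V →L[ℝ] ℝ) (hs : ∀ x y, B x y = B y x)
    {β : ℝ} (hβ : 0 < β) (hB : ∀ x, β * ‖x‖ ^ 2 ≤ B x x) (hL : ∀ x, B x (L x) ≤ 0) :
    ∃ C : ℝ, 0 < C ∧ ∀ u, 0 ≤ u → ‖flow L u‖ ≤ C := by
  refine ⟨Real.sqrt (‖B‖ / β) + 1, by positivity, fun u hu => ?_⟩
  refine ContinuousLinearMap.opNorm_le_bound _ (by positivity) fun v => ?_
  have hder : ∀ r, HasDerivAt (fun r => B (flow L r v) (flow L r v))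
      (B (flow L r v) (L (flow L r v)) + B (L (flow L r v)) (flow L r v)) r := by
    intro r
    have h1 : HasDerivAt (fun r => flow L r v) (L (flow L r v)) r := by
      simpa using (hasDerivAt_flow L r).clm_apply (hasDerivAt_const r v)
    have h2 := (B.hasFDerivAt.comp_hasDerivAt r h1).clm_apply h1
    simpa [add_comm] using h2
  have hanti : Antitone fun r => B (flow L r v) (flow L r v) := by
    refine antitone_of_deriv_nonpos (fun r => (hder r).differentiableAt) fun r => ?_
    rw [(hder r).deriv, hs (L _)]
    linarith [hL (flow L r v)]
  have h0 : B (flow L u v) (flow L u v) ≤ B v v := by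
    simpa [flow_zero] using hanti hu
  have h1 : B v v ≤ ‖B‖ * ‖v‖ ^ 2 := by
    have := (le_abs_self _).trans (B.le_opNorm₂ v v)
    calc _ ≤ _ := this
      _ = _ := by ring
  have h2 : ‖flow L u v‖ ^ 2 ≤ ‖B‖ / β * ‖v‖ ^ 2 := by
    rw [div_mul_eq_mul_div, le_div_iff₀ hβ]
    linarith [hB (flow L u v)]
  have h3 : ‖flow L u v‖ ≤ Real.sqrt (‖B‖ / β) * ‖v‖ := by
    refine abs_le_of_sq_le_sq' ?_ (by positivity) |>.2
    rw [mul_pow, Real.sq_sqrt (by positivity)]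
    exact h2
  nlinarith [norm_nonneg v]

/-- Solution of `y' = L y + g` that vanishes at `-∞`. -/
noncomputable def duhamel (L : V →L[ℝ] V) (g : ℝ → V) (s : ℝ) : V :=
  ∫ σ in Iic s, flow L (s - σ) (g σ)

lemma norm_flow_apply_le {V : Type*} [NormedAddCommGroup V] [NormedSpace ℝ V]
    {L : V →L[ℝ] V} {C : ℝ} (hC : ∀ u, 0 ≤ u → ‖flow L u‖ ≤ C)
    {g : ℝ → V} {R : ℝ} (hR : ∀ σ, ‖g σ‖ ≤ R * Real.exp (4 * σ))
    {s σ : ℝ} (h : σ ≤ s) :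
    ‖flow L (s - σ) (g σ)‖ ≤ C * R * Real.exp (4 * σ) := by
  calc _ ≤ ‖flow L (s - σ)‖ * ‖g σ‖ := ContinuousLinearMap.le_opNorm _ _
    _ ≤ C * (R * Real.exp (4 * σ)) := by
        refine mul_le_mul (hC _ (by linarith)) (hR σ) (norm_nonneg _) ?_
        exact (norm_nonneg _).trans (hC 0 le_rfl)
    _ = _ := by ring

lemma integrableOn_flow_apply {L : V →L[ℝ] V} {C : ℝ} (hC : ∀ u, 0 ≤ u → ‖flow L u‖ ≤ C)
    {g : ℝ → V} (hg : Continuous g)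
    {R : ℝ} (hR : ∀ σ, ‖g σ‖ ≤ R * Real.exp (4 * σ)) (s : ℝ) :
    IntegrableOn (fun σ => flow L (s - σ) (g σ)) (Iic s) := by
  have : CompleteSpace V := FiniteDimensional.complete ℝ V
  refine Integrable.mono' (g := fun σ => C * R * Real.exp (4 * σ))
    ((integrableOn_exp_mul_Iic (by norm_num : (0 : ℝ) < 4) s).const_mul (C * R)) ?_ ?_
  · refine Continuous.aestronglyMeasurable ?_
    exact ((continuous_flow L).comp (by fun_prop)).clm_apply hg
  · refine (ae_restrict_iff' measurableSet_Iic).2 (Eventually.of_forall fun σ hσ => ?_)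
    exact norm_flow_apply_le hC hR hσ

lemma norm_duhamel_le {V : Type*} [NormedAddCommGroup V] [NormedSpace ℝ V]
    {L : V →L[ℝ] V} {C : ℝ} (hC : ∀ u, 0 ≤ u → ‖flow L u‖ ≤ C)
    {g : ℝ → V} {R : ℝ} (hR : ∀ σ, ‖g σ‖ ≤ R * Real.exp (4 * σ))
    (s : ℝ) : ‖duhamel L g s‖ ≤ C * R / 4 * Real.exp (4 * s) := by
  have h := norm_integral_le_of_norm_le (μ := volume.restrict (Iic s))
    ((integrableOn_exp_mul_Iic (by norm_num : (0 : ℝ) < 4) s).const_mul (C * R))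
    (f := fun σ => flow L (s - σ) (g σ))
    ((ae_restrict_iff' measurableSet_Iic).2 (Eventually.of_forall fun σ hσ =>
      norm_flow_apply_le hC hR hσ))
  rw [integral_const_mul, integral_exp_mul_Iic (by norm_num : (0 : ℝ) < 4)] at h
  calc _ ≤ _ := h
    _ = _ := by ring

lemma hasDerivAt_duhamel {L : V →L[ℝ] V} {C : ℝ} (hC : ∀ u, 0 ≤ u → ‖flow L u‖ ≤ C)
    {g : ℝ → V} (hg : Continuous g)
    {R : ℝ} (hR : ∀ σ, ‖g σ‖ ≤ R * Real.exp (4 * σ)) (s : ℝ) :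
    HasDerivAt (duhamel L g) (L (duhamel L g s) + g s) s := by
  have : CompleteSpace V := FiniteDimensional.complete ℝ V
  set q : ℝ → V := fun σ => flow L (-σ) (g σ) with hq
  have hqc : Continuous q := ((continuous_flow L).comp continuous_neg).clm_apply hg
  have hfac : ∀ r σ, flow L (r - σ) (g σ) = flow L r (q σ) := by
    intro r σ
    rw [sub_eq_add_neg, flow_add]; rfl
  have hback : ∀ r σ, q σ = flow L (-r) (flow L (r - σ) (g σ)) := by
    intro r σ
    rw [hq, ← mul_apply_eq_comp, ← flow_add, neg_add_eq_sub, sub_sub_cancel_left]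
  have hqi : ∀ r, IntegrableOn q (Iic r) := by
    intro r
    have := (flow L (-r)).integrable_comp (integrableOn_flow_apply hC hg hR r)
    refine this.congr (Eventually.of_forall fun σ => (hback r σ).symm)
  have hd : duhamel L g = fun r => flow L r ((∫ σ in Iic s, q σ) + ∫ σ in s..r, q σ) := by
    funext r
    rw [← intervalIntegral.integral_Iic_sub_Iic (hqi s) (hqi r), add_sub_cancel, duhamel,
      ← ContinuousLinearMap.integral_comp_comm _ (hqi r)]
    exact integral_congr_ae (Eventually.of_forall fun σ => hfac r σ)
  have h1 : HasDerivAt (fun r => (∫ σ in Iic s, q σ) + ∫ σ in s..r, q σ) (q s) s :=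
    (intervalIntegral.integral_hasDerivAt_right (hqc.intervalIntegrable _ _)
      (hqc.stronglyMeasurableAtFilter _ _) hqc.continuousAt).const_add _
  have h2 := (hasDerivAt_flow L s).clm_apply h1
  rw [hd]
  convert h2 using 1
  rw [← hfac s s, sub_self, flow_zero]
  simp

lemma duhamel_sub {L : V →L[ℝ] V} {C : ℝ} (hC : ∀ u, 0 ≤ u → ‖flow L u‖ ≤ C)
    {g₁ g₂ : ℝ → V} (h₁ : Continuous g₁) (h₂ : Continuous g₂) {R₁ R₂ : ℝ}
    (hR₁ : ∀ σ, ‖g₁ σ‖ ≤ R₁ * Real.exp (4 * σ)) (hR₂ : ∀ σ, ‖g₂ σ‖ ≤ R₂ * Real.exp (4 * σ))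
    (s : ℝ) : duhamel L g₁ s - duhamel L g₂ s = duhamel L (fun σ => g₁ σ - g₂ σ) s := by
  rw [duhamel, duhamel, ← integral_sub (integrableOn_flow_apply hC h₁ hR₁ s)
    (integrableOn_flow_apply hC h₂ hR₂ s), duhamel]
  simp

open BoundedContinuousFunction in
/-- A semilinear equation `z' = (L - 4) z + Φ(s, z)` has a bounded solution if the Lipschitz constant
of `Φ` is small. -/
lemma exists_bounded_solution {L : V →L[ℝ] V} {C : ℝ}
    (hC : ∀ u, 0 ≤ u → ‖flow L u‖ ≤ C) (Φ : ℝ → V → V)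
    (hΦc : ∀ z : ℝ → V, Continuous z → Continuous fun s => Φ s (z s)) {κ : ℝ}
    (hκ : C * κ ≤ 2)
    (hΦL : ∀ s x y, ‖Φ s x - Φ s y‖ ≤ κ * ‖x - y‖) {R : ℝ} (hR : ∀ s, ‖Φ s 0‖ ≤ R) :
    ∃ y : ℝ → V, ∃ D : ℝ, ∀ s, ‖y s‖ ≤ D * Real.exp (4 * s) ∧
      HasDerivAt y (L (y s) + Real.exp (4 * s) • Φ s (Real.exp (-(4 * s)) • y s)) s := by
  have : CompleteSpace V := FiniteDimensional.complete ℝ V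
  have hκ0 : 0 ≤ κ ∨ Subsingleton V := by
    by_cases h : Subsingleton V
    · exact Or.inr h
    · rw [not_subsingleton_iff_nontrivial] at h
      obtain ⟨x, hx⟩ := exists_ne (0 : V)
      have := (norm_nonneg _).trans (hΦL 0 x 0)
      have hx' : 0 < ‖x - 0‖ := by simpa using hx
      exact Or.inl (nonneg_of_mul_nonneg_left this hx')
  rcases hκ0 with hκ0 | hsub
  swap
  · refine ⟨fun _ => 0, 0, fun s => ⟨by simp, ?_⟩⟩
    convert hasDerivAt_const s (0 : V) using 1
  let g : (ℝ →ᵇ V) → ℝ → V := fun z s => Real.exp (4 * s) • Φ s (z s)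
  have hgc : ∀ z, Continuous (g z) := fun z =>
    (by fun_prop : Continuous fun s : ℝ => Real.exp (4 * s)).smul (hΦc z z.continuous)
  have hgR : ∀ z σ, ‖g z σ‖ ≤ (κ * ‖z‖ + R) * Real.exp (4 * σ) := by
    intro z σ
    have h1 : ‖Φ σ (z σ)‖ ≤ κ * ‖z‖ + R := by
      have h2 := hΦL σ (z σ) 0
      have h3 := norm_le_norm_sub_add (Φ σ (z σ)) (Φ σ 0)
      have h4 : κ * ‖z σ - 0‖ ≤ κ * ‖z‖ := by
        rw [sub_zero]; exact mul_le_mul_of_nonneg_left (z.norm_coe_le_norm σ) hκ0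
      linarith [hR σ]
    simp only [g, norm_smul, Real.norm_eq_abs, Real.abs_exp]
    rw [mul_comm]
    exact mul_le_mul_of_nonneg_right h1 (Real.exp_pos _).le
  let Ψ : (ℝ →ᵇ V) → (ℝ →ᵇ V) := fun z =>
    BoundedContinuousFunction.ofNormedAddCommGroup
      (fun s => Real.exp (-(4 * s)) • duhamel L (g z) s)
      ((by fun_prop : Continuous fun s : ℝ => Real.exp (-(4 * s))).smul
        (continuous_iff_continuousAt.2 fun s =>
          (hasDerivAt_duhamel hC (hgc z) (hgR z) s).continuousAt))
      (C * (κ * ‖z‖ + R) / 4)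
      (by
        intro s
        rw [norm_smul, Real.norm_eq_abs, Real.abs_exp, Real.exp_neg]
        rw [inv_mul_le_iff₀ (Real.exp_pos _), mul_comm (Real.exp _)]
        exact norm_duhamel_le hC (hgR z) s)
  have hΨ : ContractingWith (1 / 2) Ψ := by
    refine ⟨by norm_num, LipschitzWith.of_dist_le_mul fun z w => ?_⟩
    rw [BoundedContinuousFunction.dist_le (by positivity)]
    intro s
    have h1 : ∀ σ, ‖g z σ - g w σ‖ ≤ (κ * ‖z - w‖) * Real.exp (4 * σ) := by
      intro σ
      simp only [g]
      rw [← smul_sub, norm_smul, Real.norm_eq_abs, Real.abs_exp, mul_comm]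
      refine mul_le_mul_of_nonneg_right ((hΦL _ _ _).trans ?_) (Real.exp_pos _).le
      exact mul_le_mul_of_nonneg_left ((z - w).norm_coe_le_norm σ) hκ0
    have h2 := norm_duhamel_le hC h1 s
    rw [dist_eq_norm]
    change ‖Real.exp (-(4 * s)) • duhamel L (g z) s - Real.exp (-(4 * s)) • duhamel L (g w) s‖ ≤ _
    rw [← smul_sub, duhamel_sub hC (hgc z) (hgc w) (hgR z) (hgR w), norm_smul, Real.norm_eq_abs,
      Real.abs_exp, Real.exp_neg, inv_mul_le_iff₀ (Real.exp_pos _), mul_comm (Real.exp _)]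
    refine h2.trans (mul_le_mul_of_nonneg_right ?_ (Real.exp_pos _).le)
    rw [dist_eq_norm]
    have : C * (κ * ‖z - w‖) ≤ 2 * ‖z - w‖ := by
      rw [← mul_assoc]; exact mul_le_mul_of_nonneg_right hκ (norm_nonneg _)
    simp only [NNReal.coe_div, NNReal.coe_one, NNReal.coe_ofNat]
    linarith
  have : Nonempty (ℝ →ᵇ V) := ⟨0⟩
  set z := hΨ.fixedPoint Ψ with hz
  have hfix : Ψ z = z := hΨ.fixedPoint_isFixedPt
  refine ⟨duhamel L (g z), C * (κ * ‖z‖ + R) / 4, fun s =>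
    ⟨norm_duhamel_le hC (hgR z) s, ?_⟩⟩
  have hzs : Real.exp (-(4 * s)) • duhamel L (g z) s = z s := by
    conv_rhs => rw [← hfix]
    rfl
  rw [hzs]
  exact hasDerivAt_duhamel hC (hgc z) (hgR z) s

lemma exists_forall_exp_mul_lt {ε : ℝ} (hε : 0 < ε) (D : ℝ) :
    ∃ s₀ : ℝ, ∀ s ≤ s₀, D * Real.exp (4 * s) < ε := by
  have h : Tendsto (fun s : ℝ => D * Real.exp (4 * s)) atBot (𝓝 (D * 0)) :=
    (Real.tendsto_exp_atBot.comp (tendsto_id.const_mul_atBot (by norm_num : (0 : ℝ) < 4))).const_mul D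
  rw [mul_zero] at h
  exact eventually_atBot.1 (h.eventually_lt_const hε)

/-- Existence of a solution that tends to the equilibrium `w₀` of `F` as `s → -∞`. -/
theorem exists_solution {F : V → V} {L : V →L[ℝ] V} {w₀ : V} (hF : HasStrictFDerivAt F L w₀)
    (hF0 : F w₀ = 0) (G : V →L[ℝ] V) (B : V →L[ℝ] V →L[ℝ] ℝ) (hs : ∀ x y, B x y = B y x)
    {β : ℝ} (hβ : 0 < β) (hB : ∀ x, β * ‖x‖ ^ 2 ≤ B x x) (hL : ∀ x, B x (L x) ≤ 0) :
    ∃ (w : ℝ → V) (s₀ D : ℝ), ∀ s ≤ s₀, ‖w s - w₀‖ ≤ D * Real.exp (4 * s) ∧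
      HasDerivAt w (F (w s) + Real.exp (4 * s) • G (w s)) s := by
  obtain ⟨C, hC0, hC⟩ := exists_norm_flow_le L B hs hβ hB hL
  set l : NNReal := lipschitzExtensionConstant V with hl
  have hl0 : 0 < l := lipschitzExtensionConstant_pos V
  set c : NNReal := (C.toNNReal * l)⁻¹ with hc
  have hc0 : 0 < c := by
    rw [hc]; exact inv_pos.2 (mul_pos (Real.toNNReal_pos.2 hC0) hl0)
  obtain ⟨U, hU, hUF⟩ := hF.approximates_deriv_on_nhds (Or.inr hc0)
  obtain ⟨r, hr0, hr⟩ := Metric.mem_nhds_iff.1 hU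
  have hlip : LipschitzOnWith c (fun y => F (w₀ + y) - L y) (Metric.ball 0 r) := by
    refine LipschitzOnWith.of_dist_le_mul fun x hx y hy => ?_
    have h := hUF (w₀ + x) (hr (by simpa using hx)) (w₀ + y) (hr (by simpa using hy))
    rw [dist_eq_norm, dist_eq_norm]
    rw [add_sub_add_left_eq_sub, map_sub] at h
    rw [show F (w₀ + x) - L x - (F (w₀ + y) - L y) = F (w₀ + x) - F (w₀ + y) - (L x - L y) by abel]
    exact h
  obtain ⟨N, hN, hNe⟩ := hlip.extend_finite_dimension
  have hN0 : N 0 = 0 := by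
    rw [← hNe (Metric.mem_ball_self hr0)]; simp [hF0]
  obtain ⟨s₁, hs₁⟩ := exists_forall_exp_mul_lt (inv_pos.2 hC0) ‖G‖
  have hlc : (l * c : NNReal) = (C⁻¹ : ℝ) := by
    rw [hc]; push_cast; rw [Real.coe_toNNReal _ hC0.le]
    have : (l : ℝ) ≠ 0 := by exact_mod_cast hl0.ne'
    field_simp
  let Φ : ℝ → V → V := fun s z =>
    Real.exp (-(4 * min s s₁)) • N (Real.exp (4 * min s s₁) • z) + G w₀ +
      Real.exp (4 * min s s₁) • G z
  have hΦc : ∀ z : ℝ → V, Continuous z → Continuous fun s => Φ s (z s) := by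
    intro z hz
    have := hN.continuous
    fun_prop
  have hΦL : ∀ s x y, ‖Φ s x - Φ s y‖ ≤ (2 * C⁻¹) * ‖x - y‖ := by
    intro s x y
    set e := Real.exp (4 * min s s₁) with he
    have he0 : 0 < e := Real.exp_pos _
    have h1 : Φ s x - Φ s y = e⁻¹ • (N (e • x) - N (e • y)) + e • G (x - y) := by
      simp only [Φ, Real.exp_neg, ← he, map_sub, smul_sub]; abel
    have h2 : ‖N (e • x) - N (e • y)‖ ≤ C⁻¹ * (e * ‖x - y‖) := by
      have := hN.dist_le_mul (e • x) (e • y)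
      rw [dist_eq_norm, dist_eq_norm, ← smul_sub, norm_smul, Real.norm_of_nonneg he0.le, hlc] at this
      exact this
    have h3 : ‖e • G (x - y)‖ ≤ C⁻¹ * ‖x - y‖ := by
      rw [norm_smul, Real.norm_of_nonneg he0.le]
      calc e * ‖G (x - y)‖ ≤ e * (‖G‖ * ‖x - y‖) := by gcongr; exact G.le_opNorm _
        _ = (‖G‖ * e) * ‖x - y‖ := by ring
        _ ≤ _ := by gcongr; exact (hs₁ _ (min_le_right s s₁)).le
    rw [h1]
    refine (norm_add_le _ _).trans ?_
    rw [norm_smul, norm_inv, Real.norm_of_nonneg he0.le]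
    have h4 : e⁻¹ * ‖N (e • x) - N (e • y)‖ ≤ C⁻¹ * ‖x - y‖ := by
      rw [inv_mul_le_iff₀ he0]; linarith
    linarith
  obtain ⟨y, D, hy⟩ := exists_bounded_solution hC Φ hΦc
    (κ := 2 * C⁻¹) (le_of_eq (by field_simp)) hΦL (R := ‖G w₀‖) (fun s => by simp [Φ, hN0])
  obtain ⟨s₂, hs₂⟩ := exists_forall_exp_mul_lt hr0 D
  refine ⟨fun s => w₀ + y s, min s₁ s₂, D, fun s hs' => ⟨by simpa using (hy s).1, ?_⟩⟩
  have hys : y s ∈ Metric.ball (0 : V) r := by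
    simpa using (hy s).1.trans_lt (hs₂ s (hs'.trans (min_le_right _ _)))
  convert (hy s).2.const_add w₀ using 1
  have hmin : min s s₁ = s := min_eq_left (hs'.trans (min_le_left _ _))
  simp only [Φ, hmin, Real.exp_neg, map_smul, map_add, smul_add]
  rw [smul_inv_smul₀ (Real.exp_pos _).ne', smul_inv_smul₀ (Real.exp_pos _).ne', ← hNe hys]
  simp only [smul_inv_smul₀ (Real.exp_pos (4 * s)).ne']
  abel

/-- Two solutions that approach each other faster than `exp (s / 2)` as `s → -∞`, near the equilibrium
`w₀` of `F`, agree. -/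
theorem unique_solution {V : Type*} [NormedAddCommGroup V] [NormedSpace ℝ V] {F : V → V}
    {L : V →L[ℝ] V} {w₀ : V} (hF : HasStrictFDerivAt F L w₀)
    (G : V →L[ℝ] V) (B : V →L[ℝ] V →L[ℝ] ℝ) (hs : ∀ x y, B x y = B y x)
    {β : ℝ} (hβ : 0 < β) (hB : ∀ x, β * ‖x‖ ^ 2 ≤ B x x) (hL : ∀ x, B x (L x) ≤ 0) :
    ∃ δ > 0, ∃ s₀ : ℝ, ∀ σ ≤ s₀, ∀ w₁ w₂ : ℝ → V,
      (∀ s ≤ σ, HasDerivWithinAt w₁ (F (w₁ s) + Real.exp (4 * s) • G (w₁ s)) (Iic σ) s) →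
      (∀ s ≤ σ, HasDerivWithinAt w₂ (F (w₂ s) + Real.exp (4 * s) • G (w₂ s)) (Iic σ) s) →
      (∀ s ≤ σ, ‖w₁ s - w₀‖ < δ) →
      (∃ s₁, ∀ s ≤ s₁, ‖w₂ s - w₀‖ < δ) →
      (∃ C s₁, ∀ s ≤ s₁, ‖w₁ s - w₂ s‖ ≤ C * Real.exp s) →
      ∀ s ≤ σ, w₁ s = w₂ s := by
  set b := ‖B‖ + 1 with hb
  have hb0 : 0 < b := by positivity
  set c : NNReal := (β / (4 * b)).toNNReal with hc
  have hc0 : 0 < c := Real.toNNReal_pos.2 (by positivity)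
  have hcR : (c : ℝ) = β / (4 * b) := Real.coe_toNNReal _ (by positivity)
  obtain ⟨U, hU, hUF⟩ := hF.approximates_deriv_on_nhds (Or.inr hc0)
  obtain ⟨δ, hδ0, hδ⟩ := Metric.mem_nhds_iff.1 hU
  obtain ⟨s₀, hs₀⟩ := exists_forall_exp_mul_lt (show 0 < β / (4 * b) by positivity) ‖G‖
  refine ⟨δ, hδ0, s₀, ?_⟩
  have key : ∀ σ ≤ s₀, ∀ w₁ w₂ : ℝ → V,
      (∀ s ≤ σ, HasDerivWithinAt w₁ (F (w₁ s) + Real.exp (4 * s) • G (w₁ s)) (Iic σ) s) →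
      (∀ s ≤ σ, HasDerivWithinAt w₂ (F (w₂ s) + Real.exp (4 * s) • G (w₂ s)) (Iic σ) s) →
      (∀ s < σ, ‖w₁ s - w₀‖ < δ) → (∀ s < σ, ‖w₂ s - w₀‖ < δ) →
      (∃ C s₁, ∀ s ≤ s₁, ‖w₁ s - w₂ s‖ ≤ C * Real.exp s) →
      ∀ s ≤ σ, w₁ s = w₂ s := by
    rintro σ hσ w₁ w₂ h₁ h₂ hw₁ hw₂ ⟨C, s₁, hC⟩ s hsσ
    let y : ℝ → V := fun s => w₁ s - w₂ s
    let y' : ℝ → V := fun s => (F (w₁ s) + Real.exp (4 * s) • G (w₁ s)) -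
      (F (w₂ s) + Real.exp (4 * s) • G (w₂ s))
    have hy : ∀ s ≤ σ, HasDerivWithinAt y (y' s) (Iic σ) s := fun s h => (h₁ s h).sub (h₂ s h)
    have hE : ∀ s ≤ σ, HasDerivWithinAt (fun s => B (y s) (y s)) (2 * B (y s) (y' s)) (Iic σ) s := by
      intro s h
      have := (B.hasFDerivAt.comp_hasDerivWithinAt s (hy s h)).clm_apply (hy s h)
      refine this.congr_deriv ?_
      rw [hs (y' s)]
      simp [two_mul]
    have hE' : ∀ s < σ, 2 * B (y s) (y' s) ≤ B (y s) (y s) := by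
      intro s h
      have e1 : y' s = L (y s) + ((F (w₁ s) - F (w₂ s) - L (w₁ s - w₂ s))
          + Real.exp (4 * s) • G (y s)) := by
        simp only [y, y', map_sub, smul_sub]; abel
      have e2 : ‖F (w₁ s) - F (w₂ s) - L (w₁ s - w₂ s)‖ ≤ β / (4 * b) * ‖y s‖ := by
        rw [← hcR]
        exact hUF _ (hδ (mem_ball_iff_norm.2 (hw₁ s h))) _ (hδ (mem_ball_iff_norm.2 (hw₂ s h)))
      have e3 : ‖Real.exp (4 * s) • G (y s)‖ ≤ β / (4 * b) * ‖y s‖ := by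
        rw [norm_smul, Real.norm_of_nonneg (Real.exp_pos _).le]
        calc _ ≤ Real.exp (4 * s) * (‖G‖ * ‖y s‖) := by gcongr; exact G.le_opNorm _
          _ = (‖G‖ * Real.exp (4 * s)) * ‖y s‖ := by ring
          _ ≤ _ := by gcongr; exact (hs₀ s (by linarith)).le
      rw [e1, map_add]
      set q := (F (w₁ s) - F (w₂ s) - L (w₁ s - w₂ s)) + Real.exp (4 * s) • G (y s)
      have e4 : ‖q‖ ≤ β / (2 * b) * ‖y s‖ := by
        refine (norm_add_le _ _).trans ((add_le_add e2 e3).trans (le_of_eq ?_))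
        field_simp; ring
      have e5 : B (y s) q ≤ β / 2 * ‖y s‖ ^ 2 := by
        calc B (y s) q ≤ ‖B (y s) q‖ := Real.le_norm_self _
          _ ≤ ‖B‖ * ‖y s‖ * ‖q‖ := B.le_opNorm₂ _ _
          _ ≤ b * ‖y s‖ * (β / (2 * b) * ‖y s‖) := by gcongr; simp [hb]
          _ = _ := by field_simp
      linarith [hL (y s), hB (y s)]
    have hanti : AntitoneOn (fun s => Real.exp (-s) * B (y s) (y s)) (Iic σ) := by
      refine antitoneOn_of_hasDerivWithinAt_nonpos (convex_Iic σ)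
        (f' := fun s => Real.exp (-s) * (-1) * B (y s) (y s) +
          Real.exp (-s) * (2 * B (y s) (y' s))) ?_ ?_ ?_
      · intro s h
        exact ((Real.continuous_exp.comp continuous_neg).continuousWithinAt).mul
          (hE s h).continuousWithinAt
      · intro s h
        rw [interior_Iic] at h
        have := (((hasDerivAt_neg s).exp).hasDerivWithinAt (s := Iic σ)).mul (hE s h.le)
        exact this.mono interior_subset
      · intro s h
        rw [interior_Iic] at h
        have := hE' s h
        have h2 := Real.exp_pos (-s)
        nlinarith
    have hlim : Tendsto (fun s => Real.exp (-s) * B (y s) (y s)) atBot (𝓝 0) := by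
      have hup : Tendsto (fun s : ℝ => ‖B‖ * C ^ 2 * Real.exp s) atBot (𝓝 0) := by
        simpa using Real.tendsto_exp_atBot.const_mul (‖B‖ * C ^ 2)
      refine squeeze_zero' (Eventually.of_forall fun s => ?_) ?_ hup
      · exact mul_nonneg (Real.exp_pos _).le ((by positivity : (0:ℝ) ≤ β * ‖y s‖ ^ 2).trans (hB _))
      · filter_upwards [eventually_le_atBot s₁] with s hs1
        have h3 : B (y s) (y s) ≤ ‖B‖ * ‖y s‖ * ‖y s‖ := (Real.le_norm_self _).trans (B.le_opNorm₂ _ _)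
        have h4 : B (y s) (y s) ≤ ‖B‖ * (C * Real.exp s) * (C * Real.exp s) := by
          refine h3.trans ?_
          have := hC s hs1
          have h0 := (norm_nonneg _).trans this
          gcongr
        calc _ ≤ Real.exp (-s) * (‖B‖ * (C * Real.exp s) * (C * Real.exp s)) := by gcongr
          _ = ‖B‖ * C ^ 2 * Real.exp s * (Real.exp (-s) * Real.exp s) := by ring
          _ = _ := by rw [← Real.exp_add]; simp
    have h5 : Real.exp (-s) * B (y s) (y s) ≤ 0 := by
      refine ge_of_tendsto hlim ?_
      filter_upwards [eventually_le_atBot s] with r hr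
      exact hanti (mem_Iic.2 (hr.trans hsσ)) (mem_Iic.2 hsσ) hr
    have h6 : B (y s) (y s) ≤ 0 := by
      by_contra h
      push Not at h
      exact absurd h5 (not_le.2 (mul_pos (Real.exp_pos _) h))
    have h7 : ‖y s‖ ^ 2 ≤ 0 := by
      by_contra h
      push Not at h
      linarith [hB (y s), mul_pos hβ h]
    have h8 : ‖y s‖ = 0 := pow_eq_zero_iff two_ne_zero |>.1 (le_antisymm h7 (by positivity))
    exact sub_eq_zero.1 (norm_eq_zero.1 h8)
  rintro σ hσ w₁ w₂ h₁ h₂ hw₁ ⟨s₂, hs₂⟩ ⟨C, s₁, hC⟩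
  have hsmall : ∀ ρ ≤ σ, (∀ s < ρ, ‖w₂ s - w₀‖ < δ) → ∀ s ≤ ρ, w₁ s = w₂ s := by
    intro ρ hρ h
    exact key ρ (hρ.trans hσ) w₁ w₂
      (fun s hs' => (h₁ s (hs'.trans hρ)).mono (Iic_subset_Iic.2 hρ))
      (fun s hs' => (h₂ s (hs'.trans hρ)).mono (Iic_subset_Iic.2 hρ))
      (fun s hs' => hw₁ s (hs'.le.trans hρ)) h ⟨C, s₁, hC⟩
  refine hsmall σ le_rfl ?_
  by_contra hne
  push Not at hne
  obtain ⟨s₃, hs₃, hbad⟩ := hne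
  set S : Set ℝ := {s | s ≤ σ ∧ δ ≤ ‖w₂ s - w₀‖} with hS
  have hcont : ContinuousOn w₂ (Iic σ) := fun s h => (h₂ s h).continuousWithinAt
  have hclosed : IsClosed S := by
    have : S = Iic σ ∩ (fun s => ‖w₂ s - w₀‖) ⁻¹' (Ici δ) := rfl
    rw [this]
    exact ((hcont.sub continuousOn_const).norm).preimage_isClosed_of_isClosed isClosed_Iic isClosed_Ici
  have hbdd : BddBelow S := ⟨s₂, fun s h => by
    by_contra hlt
    push Not at hlt
    exact absurd h.2 (not_le.2 (hs₂ s hlt.le))⟩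
  have hmem : sInf S ∈ S := hclosed.csInf_mem ⟨s₃, hs₃.le, hbad⟩ hbdd
  have heq := hsmall (sInf S) hmem.1 (fun s h => by
    by_contra hge
    push Not at hge
    exact absurd (csInf_le hbdd (show s ∈ S from ⟨h.le.trans hmem.1, hge⟩)) (not_le.2 h)) _ le_rfl
  have := hw₁ _ hmem.1
  rw [heq] at this
  exact absurd hmem.2 (not_le.2 this)

end DissipativeODE

namespace BianchiI

/-- Spatial tensors of second order. -/
abbrev Mat : Type := Matrix (Fin 3) (Fin 3) ℝ

/-- The operator norm on matrices, with the standard topology and algebraic structure. -/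
@[reducible] noncomputable def matNormedAddCommGroup : NormedAddCommGroup Mat :=
  let R : NormedRing Mat := Matrix.linftyOpNormedRing
  { Matrix.addCommGroup, R.toMetricSpace.replaceTopology (U := instTopologicalSpaceMatrix) rfl with
    norm := R.norm
    dist_eq := R.dist_eq }

attribute [local instance] matNormedAddCommGroup

@[reducible] noncomputable def matNormedSpace : NormedSpace ℝ Mat :=
  { Matrix.module with
    norm_smul_le := (Matrix.linftyOpNormedSpace : NormedSpace ℝ Mat).norm_smul_le }

attribute [local instance] matNormedSpace

/-- Continuous functions of the momentum with compact support that vanish near `p = 0`. -/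
structure AdmissibleWeight (w : Mom → ℝ) : Prop where
  continuous : Continuous w
  hasCompactSupport : HasCompactSupport w
  zero_notMem : (0 : Mom) ∉ tsupport w

lemma AdmissibleWeight.mul_right {w g : Mom → ℝ} (hw : AdmissibleWeight w)
    (hg : ContinuousOn g {0}ᶜ) : AdmissibleWeight fun p => w p * g p := by
  have hsub : tsupport (fun p => w p * g p) ⊆ tsupport w := tsupport_mul_subset_left
  refine ⟨?_, hw.hasCompactSupport.mul_right, fun h => hw.zero_notMem (hsub h)⟩
  refine ContinuousOn.continuous_of_tsupport_subset
    (hw.continuous.continuousOn.mul hg) isOpen_compl_singleton ?_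
  intro p hp h0
  rw [mem_singleton_iff] at h0
  exact hw.zero_notMem (h0 ▸ hsub hp)

lemma AdmissibleWeight.integrable {w : Mom → ℝ} (hw : AdmissibleWeight w) : Integrable w :=
  hw.continuous.integrable_of_hasCompactSupport hw.hasCompactSupport

lemma AdmissibleWeight.integrable_mul {w g : Mom → ℝ} (hw : AdmissibleWeight w)
    (hg : ContinuousOn g {0}ᶜ) : Integrable fun p => w p * g p :=
  (hw.mul_right hg).integrable

/-- The matrix entries as continuous linear forms. -/
noncomputable def entryCLM (i j : Fin 3) : Mat →L[ℝ] ℝ :=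
  LinearMap.toContinuousLinearMap (Matrix.entryLinearMap ℝ ℝ i j)

@[simp] lemma entryCLM_apply (i j : Fin 3) (x : Mat) : entryCLM i j x = x i j := rfl

/-- The value of a quadratic form at `p`, as a function of the form. -/
noncomputable def quadCLM (p : Mom) : Mat →L[ℝ] ℝ := ∑ i, ∑ j, (p i * p j) • entryCLM i j

@[simp] lemma quadCLM_apply (p : Mom) (x : Mat) : quadCLM p x = p ⬝ᵥ (x *ᵥ p) := by
  simp only [quadCLM, sum_apply, smul_apply,
    entryCLM_apply, smul_eq_mul, dotProduct, Matrix.mulVec, Finset.mul_sum]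
  exact Finset.sum_congr rfl fun i _ => Finset.sum_congr rfl fun j _ => by ring

lemma continuous_quadCLM : Continuous quadCLM := by
  unfold quadCLM
  fun_prop

lemma continuous_quad (x : Mat) : Continuous fun p : Mom => p ⬝ᵥ (x *ᵥ p) := by
  simp only [← quadCLM_apply]
  exact continuous_quadCLM.clm_apply continuous_const

lemma quad_pos {b : Mat} (hb : b.PosDef) {p : Mom} (hp : p ≠ 0) : 0 < p ⬝ᵥ (b *ᵥ p) := by
  simpa using hb.dotProduct_mulVec_pos hp

lemma quad_nonneg {b : Mat} (hb : b.PosSemidef) (p : Mom) : 0 ≤ p ⬝ᵥ (b *ᵥ p) := by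
  simpa using hb.dotProduct_mulVec_nonneg p

lemma exists_le_quad {b : Mat} (hb : b.PosDef) {K : Set Mom} (hK : IsCompact K)
    (h0 : (0 : Mom) ∉ K) : ∃ c > 0, ∃ M > 0, ∃ ε > 0, (∀ p ∈ K, ‖quadCLM p‖ ≤ M) ∧
      ∀ x ∈ Metric.ball b ε, ∀ p ∈ K, c ≤ p ⬝ᵥ (x *ᵥ p) := by
  rcases K.eq_empty_or_nonempty with rfl | hne
  · exact ⟨1, one_pos, 1, one_pos, 1, one_pos, by simp, by simp⟩
  obtain ⟨p₀, hp₀, hmin⟩ := hK.exists_isMinOn hne (continuous_quad b).continuousOn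
  obtain ⟨p₁, hp₁, hmax⟩ := hK.exists_isMaxOn hne continuous_quadCLM.norm.continuousOn
  set c := p₀ ⬝ᵥ (b *ᵥ p₀) with hc
  have hc0 : 0 < c := quad_pos hb fun h => h0 (h ▸ hp₀)
  set M := ‖quadCLM p₁‖ + 1 with hM
  have hM0 : 0 < M := by positivity
  have hbd : ∀ p ∈ K, ‖quadCLM p‖ ≤ M := fun p hp => by
    have : ‖quadCLM p‖ ≤ ‖quadCLM p₁‖ := hmax hp
    linarith
  refine ⟨c / 2, by positivity, M, hM0, c / (2 * M), by positivity, hbd, fun x hx p hp => ?_⟩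
  have h1 : c ≤ p ⬝ᵥ (b *ᵥ p) := hmin hp
  have h2 : |quadCLM p (x - b)| ≤ c / 2 := by
    calc |quadCLM p (x - b)| ≤ ‖quadCLM p‖ * ‖x - b‖ := (quadCLM p).le_opNorm _
      _ ≤ M * (c / (2 * M)) := by
        gcongr
        · exact hbd p hp
        · exact (mem_ball_iff_norm.1 hx).le
      _ = c / 2 := by field_simp
  rw [map_sub, quadCLM_apply, quadCLM_apply] at h2
  linarith [(abs_le.1 h2).1]

lemma hasDerivAt_inv_sqrt {u : ℝ} (hu : 0 < u) :
    HasDerivAt (fun u => (Real.sqrt u)⁻¹) (-(1 / 2) * (Real.sqrt u ^ 3)⁻¹) u := by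
  have h0 := Real.sqrt_pos.2 hu
  refine ((Real.hasDerivAt_sqrt hu.ne').inv h0.ne').congr_deriv ?_
  field_simp

lemma hasStrictFDerivAt_integral_inv_sqrt {w : Mom → ℝ} (hw : AdmissibleWeight w) {b : Mat}
    (hb : b.PosDef) :
    HasStrictFDerivAt (fun b : Mat => ∫ p, w p * (Real.sqrt (p ⬝ᵥ (b *ᵥ p)))⁻¹)
      (∫ p, (w p * (-(1 / 2) * (Real.sqrt (p ⬝ᵥ (b *ᵥ p)) ^ 3)⁻¹)) • quadCLM p) b := by
  obtain ⟨c, hc0, M, hM0, ε, hε, hM, hlow⟩ :=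
    exists_le_quad hb hw.hasCompactSupport hw.zero_notMem
  set F' : Mat → Mom → (Mat →L[ℝ] ℝ) := fun x p =>
    (w p * (-(1 / 2) * (Real.sqrt (p ⬝ᵥ (x *ᵥ p)) ^ 3)⁻¹)) • quadCLM p with hF'
  have hzero : ∀ p ∉ tsupport w, w p = 0 := fun p hp => image_eq_zero_of_notMem_tsupport hp
  have hmeasF : ∀ x : Mat, AEStronglyMeasurable
      (fun p : Mom => w p * (Real.sqrt (p ⬝ᵥ (x *ᵥ p)))⁻¹) volume := fun x =>
    ((hw.continuous.measurable).mul
      ((continuous_quad x).measurable.sqrt.inv)).aestronglyMeasurable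
  have hmeasF' : ∀ x : Mat, AEStronglyMeasurable (F' x) volume := fun x =>
    AEStronglyMeasurable.smul
      ((hw.continuous.measurable).mul
        (((continuous_quad x).measurable.sqrt.pow_const 3).inv.const_mul _)).aestronglyMeasurable
      continuous_quadCLM.aestronglyMeasurable
  have hbound : ∀ x ∈ Metric.ball b ε, ∀ p, ‖F' x p‖ ≤
      |w p| * ((1 / 2) * (Real.sqrt c ^ 3)⁻¹ * M) := by
    intro x hx p
    by_cases hp : p ∈ tsupport w
    · have h1 := hlow x hx p hp
      have h2 : Real.sqrt c ≤ Real.sqrt (p ⬝ᵥ (x *ᵥ p)) := Real.sqrt_le_sqrt h1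
      have h3 : 0 < Real.sqrt c := Real.sqrt_pos.2 hc0
      simp only [hF', norm_smul, Real.norm_eq_abs, abs_mul, abs_neg, abs_inv]
      rw [abs_of_nonneg (by positivity : (0:ℝ) ≤ 1 / 2),
        abs_of_nonneg (by positivity : (0:ℝ) ≤ Real.sqrt (p ⬝ᵥ (x *ᵥ p)) ^ 3), mul_assoc]
      have := hM p hp
      gcongr
    · simp [hF', hzero p hp]
  have hboundInt : Integrable fun p => |w p| * ((1 / 2) * (Real.sqrt c ^ 3)⁻¹ * M) :=
    hw.integrable.abs.mul_const _
  have hdiff : ∀ x ∈ Metric.ball b ε, ∀ p,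
      HasFDerivAt (fun x : Mat => w p * (Real.sqrt (p ⬝ᵥ (x *ᵥ p)))⁻¹) (F' x p) x := by
    intro x hx p
    by_cases hp : p ∈ tsupport w
    · have h1 : 0 < quadCLM p x := by
        rw [quadCLM_apply]; exact hc0.trans_le (hlow x hx p hp)
      have h2 := ((hasDerivAt_inv_sqrt h1).comp_hasFDerivAt x (quadCLM p).hasFDerivAt).const_mul (w p)
      simp only [Function.comp_def, quadCLM_apply] at h2
      refine h2.congr_fderiv ?_
      rw [hF', smul_smul]
    · simp only [hF', hzero p hp, zero_mul, zero_smul]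
      exact hasFDerivAt_const 0 x
  refine hasStrictFDerivAt_of_hasFDerivAt_of_continuousAt (f' := fun x => ∫ p, F' x p) ?_ ?_
  · filter_upwards [Metric.ball_mem_nhds b hε] with x hx
    refine hasFDerivAt_integral_of_dominated_of_fderiv_le (Metric.isOpen_ball.mem_nhds hx)
      (Eventually.of_forall hmeasF) ?_ (hmeasF' x)
      (Eventually.of_forall fun p y hy => hbound y hy p) hboundInt
      (Eventually.of_forall fun p y hy => hdiff y hy p)
    refine Integrable.mono' (hw.integrable.abs.mul_const ((Real.sqrt c)⁻¹)) (hmeasF x)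
      (Eventually.of_forall fun p => ?_)
    by_cases hp : p ∈ tsupport w
    · have h2 : Real.sqrt c ≤ Real.sqrt (p ⬝ᵥ (x *ᵥ p)) := Real.sqrt_le_sqrt (hlow x hx p hp)
      have h3 : 0 < Real.sqrt c := Real.sqrt_pos.2 hc0
      rw [norm_mul, norm_inv, Real.norm_eq_abs, Real.norm_of_nonneg (Real.sqrt_nonneg _)]
      gcongr
    · simp [hzero p hp]
  · refine continuousAt_of_dominated (Eventually.of_forall hmeasF')
      (by filter_upwards [Metric.ball_mem_nhds b hε] with x hx using
        Eventually.of_forall (hbound x hx)) hboundInt (Eventually.of_forall fun p => ?_)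
    by_cases hp : p ∈ tsupport w
    · have h1 : 0 < p ⬝ᵥ (b *ᵥ p) := hc0.trans_le (hlow b (Metric.mem_ball_self hε) p hp)
      have h2 : ContinuousAt (fun x : Mat => p ⬝ᵥ (x *ᵥ p)) b := by
        simp only [← quadCLM_apply]; exact (quadCLM p).continuous.continuousAt
      have h3 : Real.sqrt (p ⬝ᵥ (b *ᵥ p)) ^ 3 ≠ 0 := (pow_pos (Real.sqrt_pos.2 h1) 3).ne'
      simp only [hF']
      exact ((((h2.sqrt.pow 3).inv₀ h3).const_mul _).const_mul _).smul continuousAt_const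
    · simp only [hF', hzero p hp, zero_mul, zero_smul]
      exact continuousAt_const

lemma integral_smul_quadCLM_apply {w : Mom → ℝ} (hw : AdmissibleWeight w) (x : Mat) :
    (∫ p, w p • quadCLM p) x = ∫ p, w p * (p ⬝ᵥ (x *ᵥ p)) := by
  rw [ContinuousLinearMap.integral_apply]
  · simp
  · refine Continuous.integrable_of_hasCompactSupport
      (hw.continuous.smul continuous_quadCLM) (hw.hasCompactSupport.smul_right)

/-- The second moments of a function of the momentum. -/
noncomputable def moment (w : Mom → ℝ) : Mat := Matrix.of fun i j => ∫ p, w p * p i * p j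

lemma moment_apply (w : Mom → ℝ) (i j : Fin 3) : moment w i j = ∫ p, w p * p i * p j := rfl

lemma trace_mul_moment {w : Mom → ℝ} (hw : AdmissibleWeight w) (c : Mat) :
    (c * moment w).trace = ∫ p, w p * (p ⬝ᵥ (c *ᵥ p)) := by
  have hi : ∀ i j, Integrable fun p : Mom => w p * (p i * (c i j * p j)) := fun i j =>
    hw.integrable_mul (by fun_prop)
  simp only [dotProduct, Matrix.mulVec, Finset.mul_sum]
  rw [integral_finsetSum _ fun i _ => integrable_finsetSum _ fun j _ => hi i j]
  simp only [Matrix.trace, Matrix.diag, Matrix.mul_apply]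
  refine Finset.sum_congr rfl fun i _ => ?_
  rw [integral_finsetSum _ fun j _ => hi i j]
  refine Finset.sum_congr rfl fun j _ => ?_
  rw [moment_apply, ← integral_const_mul]
  exact integral_congr_ae (Eventually.of_forall fun p => by ring)

lemma transpose_moment (w : Mom → ℝ) : (moment w)ᵀ = moment w := by
  ext i j
  rw [Matrix.transpose_apply, moment_apply, moment_apply]
  exact integral_congr_ae (Eventually.of_forall fun p => by ring)

/-- Matrix multiplication as a continuous bilinear map. -/
noncomputable def mulCLM : Mat →L[ℝ] Mat →L[ℝ] Mat :=
  LinearMap.toContinuousLinearMap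
    ((LinearMap.toContinuousLinearMap (𝕜 := ℝ) (E := Mat) (F' := Mat)).toLinearMap ∘ₗ
      LinearMap.mul ℝ Mat)

@[simp] lemma mulCLM_apply (x y : Mat) : mulCLM x y = x * y := rfl

/-- The trace as a continuous linear form. -/
noncomputable def traceCLM : Mat →L[ℝ] ℝ :=
  LinearMap.toContinuousLinearMap (Matrix.traceLinearMap (Fin 3) ℝ ℝ)

@[simp] lemma traceCLM_apply (x : Mat) : traceCLM x = x.trace := rfl

/-- `f` is strictly differentiable at `a`, with derivative `f'`. -/
def HasStrictDeriv {E F : Type*} [NormedAddCommGroup E] [NormedSpace ℝ E] [NormedAddCommGroup F]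
    [NormedSpace ℝ F] (f : E → F) (f' : E → F) (a : E) : Prop :=
  ∃ L : E →L[ℝ] F, HasStrictFDerivAt f L a ∧ ∀ x, L x = f' x

section calculus

variable {E F : Type*} [NormedAddCommGroup E] [NormedSpace ℝ E] [NormedAddCommGroup F]
    [NormedSpace ℝ F]

lemma HasStrictDeriv.congr {f f' g' : E → F} {a : E} (h : HasStrictDeriv f f' a)
    (e : ∀ x, f' x = g' x) : HasStrictDeriv f g' a := by
  obtain ⟨L, hL, h⟩ := h
  exact ⟨L, hL, fun x => (h x).trans (e x)⟩

lemma HasStrictDeriv.add {f g f' g' : E → F} {a : E} (hf : HasStrictDeriv f f' a)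
    (hg : HasStrictDeriv g g' a) :
    HasStrictDeriv (fun x => f x + g x) (fun x => f' x + g' x) a := by
  obtain ⟨L, hL, h⟩ := hf
  obtain ⟨M, hM, k⟩ := hg
  exact ⟨L + M, hL.add hM, fun x => by simp [h, k]⟩

lemma HasStrictDeriv.sub {f g f' g' : E → F} {a : E} (hf : HasStrictDeriv f f' a)
    (hg : HasStrictDeriv g g' a) :
    HasStrictDeriv (fun x => f x - g x) (fun x => f' x - g' x) a := by
  obtain ⟨L, hL, h⟩ := hf
  obtain ⟨M, hM, k⟩ := hg
  exact ⟨L - M, hL.sub hM, fun x => by simp [h, k]⟩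

lemma HasStrictDeriv.neg {f f' : E → F} {a : E} (hf : HasStrictDeriv f f' a) :
    HasStrictDeriv (fun x => -f x) (fun x => -f' x) a := by
  obtain ⟨L, hL, h⟩ := hf
  exact ⟨-L, hL.neg, fun x => by simp [h]⟩

lemma HasStrictDeriv.smul {c c' : E → ℝ} {f f' : E → F} {a : E} (hc : HasStrictDeriv c c' a)
    (hf : HasStrictDeriv f f' a) :
    HasStrictDeriv (fun x => c x • f x) (fun x => c' x • f a + c a • f' x) a := by
  obtain ⟨L, hL, h⟩ := hf
  obtain ⟨M, hM, k⟩ := hc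
  exact ⟨_, hM.smul hL, fun x => by simp [h, k, add_comm]⟩

lemma HasStrictDeriv.const_smul {f f' : E → F} {a : E} (c : ℝ) (hf : HasStrictDeriv f f' a) :
    HasStrictDeriv (fun x => c • f x) (fun x => c • f' x) a := by
  obtain ⟨L, hL, h⟩ := hf
  exact ⟨_, hL.const_smul c, fun x => by simp [h]⟩

lemma HasStrictDeriv.clm_comp {G : Type*} [NormedAddCommGroup G] [NormedSpace ℝ G] (T : F →L[ℝ] G)
    {f f' : E → F} {a : E} (hf : HasStrictDeriv f f' a) :
    HasStrictDeriv (fun x => T (f x)) (fun x => T (f' x)) a := by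
  obtain ⟨L, hL, h⟩ := hf
  exact ⟨T ∘L L, T.hasStrictFDerivAt.comp a hL, fun x => by simp [h]⟩

lemma HasStrictDeriv.comp {G : Type*} [NormedAddCommGroup G] [NormedSpace ℝ G] {g g' : F → G}
    {f f' : E → F} {a : E} (hg : HasStrictDeriv g g' (f a)) (hf : HasStrictDeriv f f' a) :
    HasStrictDeriv (fun x => g (f x)) (fun x => g' (f' x)) a := by
  obtain ⟨L, hL, h⟩ := hf
  obtain ⟨M, hM, k⟩ := hg
  exact ⟨M ∘L L, hM.comp a hL, fun x => by simp [h, k]⟩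

lemma hasStrictDeriv_clm (T : E →L[ℝ] F) (a : E) : HasStrictDeriv (fun x => T x) (fun x => T x) a :=
  ⟨T, T.hasStrictFDerivAt, fun _ => rfl⟩

lemma hasStrictDeriv_const (c : F) (a : E) : HasStrictDeriv (fun _ => c) (fun _ => 0) a :=
  ⟨0, hasStrictFDerivAt_const c a, fun _ => rfl⟩

lemma HasStrictDeriv.comp_real {φ : ℝ → ℝ} {φ' : ℝ} {f f' : E → ℝ} {a : E}
    (hφ : HasStrictDerivAt φ φ' (f a)) (hf : HasStrictDeriv f f' a) :
    HasStrictDeriv (fun x => φ (f x)) (fun x => φ' * f' x) a := by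
  obtain ⟨L, hL, h⟩ := hf
  exact ⟨_, hφ.comp_hasStrictFDerivAt a hL, fun x => by simp [h]⟩

lemma HasStrictDeriv.mul {f f' g g' : E → Mat} {a : E} (hf : HasStrictDeriv f f' a)
    (hg : HasStrictDeriv g g' a) :
    HasStrictDeriv (fun x => f x * g x) (fun x => f' x * g a + f a * g' x) a := by
  obtain ⟨L, hL, h⟩ := hf
  obtain ⟨M, hM, k⟩ := hg
  exact ⟨_, mulCLM.hasStrictFDerivAt_of_bilinear hL hM, fun x => by simp [h, k, add_comm]⟩

lemma HasStrictDeriv.comp_hasDerivWithinAt {f f' : E → F} {w : ℝ → E} {w' : E} {I : Set ℝ} {s : ℝ}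
    (hf : HasStrictDeriv f f' (w s)) (hw : HasDerivWithinAt w w' I s) :
    HasDerivWithinAt (fun s => f (w s)) (f' w') I s := by
  obtain ⟨L, hL, h⟩ := hf
  rw [← h]
  exact hL.hasFDerivAt.comp_hasDerivWithinAt s hw

end calculus

lemma isUnit_det {a : Mat} (ha : a.PosDef) : IsUnit a.det := ha.det_pos.ne'.isUnit

lemma hasStrictDeriv_det {a : Mat} (ha : IsUnit a.det) :
    HasStrictDeriv (fun a : Mat => a.det) (fun x => a.det * (a⁻¹ * x).trace) a := by
  have e := fun i j => (entryCLM i j).hasStrictFDerivAt (x := a)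
  have h := (((((((e 0 0).mul (e 1 1)).mul (e 2 2)).sub (((e 0 0).mul (e 1 2)).mul (e 2 1))).sub
    (((e 0 1).mul (e 1 0)).mul (e 2 2))).add (((e 0 1).mul (e 1 2)).mul (e 2 0))).add
    (((e 0 2).mul (e 1 0)).mul (e 2 1))).sub (((e 0 2).mul (e 1 1)).mul (e 2 0))
  refine ⟨_, (h.congr_of_eventuallyEq (Eventually.of_forall fun x => ?_)), fun x => ?_⟩
  · simp [Matrix.det_fin_three]
  · change _ = a.det * (a⁻¹ * x).trace
    have h2 : a.det * (a⁻¹ * x).trace = (a.adjugate * x).trace := by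
      rw [Matrix.inv_def, Matrix.smul_mul, Matrix.trace_smul, smul_eq_mul, ← mul_assoc,
        Ring.mul_inverse_cancel _ ha, one_mul]
    rw [h2, Matrix.adjugate_fin_three]
    simp [Matrix.trace_fin_three, Matrix.vecMul, dotProduct, Fin.sum_univ_three]
    ring

lemma hasStrictDeriv_ringInverse {R : Type*} [NormedRing R] [NormedAlgebra ℝ R]
    [FiniteDimensional ℝ R] (u : Rˣ) :
    HasStrictDeriv (Ring.inverse : R → R) (fun x => -((u⁻¹ : Rˣ) * x * (u⁻¹ : Rˣ))) u := by
  have : CompleteSpace R := FiniteDimensional.complete ℝ R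
  exact ⟨_, hasStrictFDerivAt_ringInverse (𝕜 := ℝ) u, fun x => by simp⟩

lemma hasStrictDeriv_inv {a : Mat} (ha : IsUnit a.det) :
    HasStrictDeriv (fun a : Mat => a⁻¹) (fun x => -(a⁻¹ * x * a⁻¹)) a := by
  obtain ⟨u, rfl⟩ := (Matrix.isUnit_iff_isUnit_det a).2 ha
  have h2 : (fun a : Mat => a⁻¹) = Ring.inverse := by
    funext x; exact Matrix.nonsing_inv_eq_ringInverse x
  rw [h2, ← Matrix.coe_units_inv]
  exact @hasStrictDeriv_ringInverse Mat Matrix.linftyOpNormedRing Matrix.linftyOpNormedAlgebra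
    (inferInstanceAs (FiniteDimensional ℝ (Matrix (Fin 3) (Fin 3) ℝ))) u

lemma hasStrictDeriv_trace_inv_mul {a : Mat} (m : Mat) (ha : IsUnit a.det) :
    HasStrictDeriv (fun a : Mat => (a⁻¹ * m).trace) (fun x => -(a⁻¹ * x * a⁻¹ * m).trace) a := by
  refine (((hasStrictDeriv_inv ha).mul (hasStrictDeriv_const m a)).clm_comp traceCLM).congr
    fun x => by simp

/-- The second moments of `f` divided by the energy, for the inverse metric `b`. -/
noncomputable def kineticForm (f : Mom → ℝ) (b : Mat) : Mat :=
  moment fun p => f p * (Real.sqrt (p ⬝ᵥ (b *ᵥ p)))⁻¹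

/-- The derivative of `kineticForm` in the direction `x`. -/
noncomputable def kineticFormDeriv (f : Mom → ℝ) (b x : Mat) : Mat :=
  moment fun p => f p * (-(1 / 2) * (Real.sqrt (p ⬝ᵥ (b *ᵥ p)) ^ 3)⁻¹ * (p ⬝ᵥ (x *ᵥ p)))

lemma continuousOn_inv_sqrt_quad {b : Mat} (hb : b.PosDef) :
    ContinuousOn (fun p : Mom => (Real.sqrt (p ⬝ᵥ (b *ᵥ p)))⁻¹) {0}ᶜ :=
  (continuous_quad b).sqrt.continuousOn.inv₀ fun _ hp => (Real.sqrt_pos.2 (quad_pos hb hp)).ne'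

lemma continuousOn_kineticFormDeriv {b : Mat} (hb : b.PosDef) (x : Mat) :
    ContinuousOn (fun p : Mom =>
      -(1 / 2) * (Real.sqrt (p ⬝ᵥ (b *ᵥ p)) ^ 3)⁻¹ * (p ⬝ᵥ (x *ᵥ p))) {0}ᶜ := by
  refine (continuousOn_const.mul ?_).mul (continuous_quad x).continuousOn
  exact ((continuous_quad b).sqrt.pow 3).continuousOn.inv₀ fun _ hp =>
    (pow_pos (Real.sqrt_pos.2 (quad_pos hb hp)) 3).ne'

lemma hasStrictDeriv_kineticForm {f : Mom → ℝ} (hf : AdmissibleWeight f) {b : Mat} (hb : b.PosDef) :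
    HasStrictDeriv (kineticForm f) (kineticFormDeriv f b) b := by
  have hw : ∀ i j, AdmissibleWeight fun p : Mom => f p * (p i * p j) := fun i j =>
    hf.mul_right (by fun_prop)
  have h := HasStrictFDerivAt.fun_sum (u := Finset.univ) fun i _ =>
    HasStrictFDerivAt.fun_sum (u := Finset.univ) fun j _ =>
      (hasStrictFDerivAt_integral_inv_sqrt (hw i j) hb).smul_const (Matrix.single i j (1 : ℝ))
  refine ⟨_, h.congr_of_eventuallyEq (Eventually.of_forall fun x => ?_), fun x => ?_⟩
  · rw [kineticForm, Matrix.matrix_eq_sum_single (moment _)]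
    refine Finset.sum_congr rfl fun i _ => Finset.sum_congr rfl fun j _ => ?_
    rw [Matrix.smul_single, smul_eq_mul, mul_one, moment_apply]
    congr 1
    exact integral_congr_ae (Eventually.of_forall fun p => by ring)
  · rw [kineticFormDeriv, Matrix.matrix_eq_sum_single (moment _)]
    simp only [sum_apply]
    refine Finset.sum_congr rfl fun i _ => Finset.sum_congr rfl fun j _ => ?_
    have hcont : ContinuousOn (fun p : Mom =>
        -(1 / 2) * (Real.sqrt (p ⬝ᵥ (b *ᵥ p)) ^ 3)⁻¹) {0}ᶜ :=
      continuousOn_const.mul (((continuous_quad b).sqrt.pow 3).continuousOn.inv₀ fun _ hp =>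
        (pow_pos (Real.sqrt_pos.2 (quad_pos hb hp)) 3).ne')
    rw [ContinuousLinearMap.smulRight_apply, integral_smul_quadCLM_apply ((hw i j).mul_right hcont),
      Matrix.smul_single, smul_eq_mul, mul_one, moment_apply]
    congr 1
    exact integral_congr_ae (Eventually.of_forall fun p => by ring)

/-- The trace-free tensor of the magnetic field, without the density factor. -/
noncomputable def magneticForm (h : Fin 3 → ℝ) (a : Mat) : Mat :=
  (2 * (h ⬝ᵥ (a *ᵥ h))) • a - (4 : ℝ) • (a * Matrix.vecMulVec h h * a)

lemma hasStrictDeriv_magneticForm (h : Fin 3 → ℝ) (a : Mat) :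
    HasStrictDeriv (magneticForm h) (fun x => (2 * (h ⬝ᵥ (x *ᵥ h))) • a + (2 * (h ⬝ᵥ (a *ᵥ h))) • x
      - (4 : ℝ) • (x * Matrix.vecMulVec h h * a + a * Matrix.vecMulVec h h * x)) a := by
  have hid : HasStrictDeriv (fun a : Mat => a) (fun x => x) a :=
    hasStrictDeriv_clm (ContinuousLinearMap.id ℝ Mat) a
  have h1 := (((hasStrictDeriv_clm (quadCLM h) a).const_smul 2).smul hid).sub
    (((hid.mul (hasStrictDeriv_const (Matrix.vecMulVec h h) a)).mul hid).const_smul 4)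
  have h2 : magneticForm h = fun a => ((2 : ℝ) • quadCLM h a) • a -
      (4 : ℝ) • (a * Matrix.vecMulVec h h * a) := by
    funext a; simp [magneticForm]
  rw [h2]
  refine h1.congr fun x => by simp

/-- The source of the Einstein equations: `8π` times the spatial stress tensor of the kinetic matter
and of the magnetic field. -/
noncomputable def source (f : Mom → ℝ) (h : Fin 3 → ℝ) (a : Mat) : Mat :=
  (8 * Real.pi / Real.sqrt a.det) • kineticForm f a⁻¹ + a.det⁻¹ • magneticForm h a

/-- The derivative of `source` at `a` in the direction `x`. -/
noncomputable def sourceDeriv (f : Mom → ℝ) (h : Fin 3 → ℝ) (a x : Mat) : Mat :=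
  (8 * Real.pi / Real.sqrt a.det) •
      (-(1 / 2 * (a⁻¹ * x).trace) • kineticForm f a⁻¹ - kineticFormDeriv f a⁻¹ (a⁻¹ * x * a⁻¹)) +
    a.det⁻¹ • (-(a⁻¹ * x).trace • magneticForm h a + ((2 * (h ⬝ᵥ (x *ᵥ h))) • a
      + (2 * (h ⬝ᵥ (a *ᵥ h))) • x
      - (4 : ℝ) • (x * Matrix.vecMulVec h h * a + a * Matrix.vecMulVec h h * x)))

lemma kineticFormDeriv_neg (f : Mom → ℝ) (b x : Mat) :
    kineticFormDeriv f b (-x) = -kineticFormDeriv f b x := by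
  ext i j
  rw [Matrix.neg_apply, kineticFormDeriv, kineticFormDeriv, moment_apply, moment_apply,
    ← integral_neg]
  refine integral_congr_ae (Eventually.of_forall fun p => ?_)
  simp [Matrix.neg_mulVec]

lemma hasStrictDeriv_source {f : Mom → ℝ} (hf : AdmissibleWeight f) (h : Fin 3 → ℝ) {a : Mat}
    (ha : a.PosDef) : HasStrictDeriv (source f h) (sourceDeriv f h a) a := by
  have hd := isUnit_det ha
  have hpos := ha.det_pos
  have hsq := Real.sqrt_pos.2 hpos
  have h1 : HasStrictDeriv (fun a : Mat => 8 * Real.pi / Real.sqrt a.det)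
      (fun x => 8 * Real.pi / Real.sqrt a.det * (-(1 / 2 * (a⁻¹ * x).trace))) a := by
    have h2 : HasStrictDerivAt (fun u => 8 * Real.pi / Real.sqrt u) _ a.det :=
      (hasStrictDerivAt_const a.det (8 * Real.pi)).div (Real.hasStrictDerivAt_sqrt hpos.ne') hsq.ne'
    refine (HasStrictDeriv.comp_real h2 (hasStrictDeriv_det hd)).congr fun x => ?_
    field_simp
    rw [Real.sq_sqrt hpos.le]
    ring
  have h3 : HasStrictDeriv (fun a : Mat => a.det⁻¹) (fun x => a.det⁻¹ * -(a⁻¹ * x).trace) a := by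
    refine (HasStrictDeriv.comp_real (hasStrictDerivAt_inv hpos.ne') (hasStrictDeriv_det hd)).congr
      fun x => ?_
    field_simp
  have h4 := (hasStrictDeriv_kineticForm hf ha.inv).comp (hasStrictDeriv_inv hd)
  refine ((h1.smul h4).add (h3.smul (hasStrictDeriv_magneticForm h a))).congr fun x => ?_
  simp only [sourceDeriv, kineticFormDeriv_neg, smul_add, smul_sub, smul_smul, smul_neg, neg_smul,
    mul_neg]
  abel

/-- The distribution functions for which the initial metric is determined. -/
structure AdmissibleData (f : Mom → ℝ) : Prop extends AdmissibleWeight f where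
  nonneg : ∀ p, 0 ≤ f p
  ne_zero : ∃ p, f p ≠ 0

lemma volume_hyperplane {v : Mom} (hv : v ≠ 0) : volume {p : Mom | v ⬝ᵥ p = 0} = 0 := by
  let φ : Mom →ₗ[ℝ] ℝ := dotProductBilin ℝ ℝ v
  have h : {p : Mom | v ⬝ᵥ p = 0} = (LinearMap.ker φ : Submodule ℝ Mom) := by
    ext p; simp [φ]
  rw [h]
  refine Measure.addHaar_submodule _ _ fun htop => hv ?_
  have : v ∈ LinearMap.ker φ := by rw [htop]; trivial
  rw [LinearMap.mem_ker] at this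
  exact dotProduct_self_eq_zero.1 this

lemma AdmissibleData.integral_mul_pos {f : Mom → ℝ} (hf : AdmissibleData f) {g : Mom → ℝ}
    (hg : ContinuousOn g {0}ᶜ) (hg0 : ∀ p ≠ 0, 0 ≤ g p) {v : Mom} (hv : v ≠ 0)
    (hpos : ∀ p, v ⬝ᵥ p ≠ 0 → 0 < g p) : 0 < ∫ p, f p * g p := by
  have hzero : f 0 = 0 := image_eq_zero_of_notMem_tsupport hf.zero_notMem
  have hnn : ∀ p, 0 ≤ f p * g p := fun p => by
    by_cases hp : p = 0
    · rw [hp, hzero, zero_mul]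
    · exact mul_nonneg (hf.nonneg p) (hg0 p hp)
  refine lt_of_le_of_ne (integral_nonneg hnn) fun h0 => ?_
  have hae := (integral_eq_zero_iff_of_nonneg hnn (hf.integrable_mul hg)).1 h0.symm
  have hv' : ∀ᵐ p : Mom, v ⬝ᵥ p ≠ 0 := by
    rw [ae_iff]; simpa using volume_hyperplane hv
  have hfz : f =ᵐ[volume] 0 := by
    filter_upwards [hae, hv'] with p hp hvp
    exact (mul_eq_zero.1 hp).resolve_right (hpos p hvp).ne'
  have := (Continuous.ae_eq_iff_eq volume hf.continuous continuous_zero).1 hfz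
  obtain ⟨p, hp⟩ := hf.ne_zero
  exact hp (congrFun this p)

lemma exists_orthogonal_diagonal {b : Mat} (hb : b.PosDef) : ∃ (U : Mat) (d : Fin 3 → ℝ),
    Uᵀ * U = 1 ∧ (∀ i, 0 < d i) ∧ b = Uᵀ * Matrix.diagonal d * U := by
  have hs := hb.isHermitian.spectral_theorem
  refine ⟨(hb.isHermitian.eigenvectorUnitary : Mat)ᵀ, hb.isHermitian.eigenvalues, ?_,
    hb.eigenvalues_pos, ?_⟩
  · have := Unitary.coe_mul_star_self hb.isHermitian.eigenvectorUnitary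
    rw [Unitary.coe_star, Matrix.star_eq_conjTranspose,
      Matrix.conjTranspose_eq_transpose_of_trivial] at this
    rw [Matrix.transpose_transpose]
    exact this
  · rw [Unitary.conjStarAlgAut_apply] at hs
    rw [Matrix.transpose_transpose]
    refine hs.trans ?_
    rw [Matrix.star_eq_conjTranspose, Matrix.conjTranspose_eq_transpose_of_trivial]
    rfl

lemma exists_transpose_mul_self {b : Mat} (hb : b.PosDef) :
    ∃ B : Mat, IsUnit B.det ∧ b = Bᵀ * B := by
  obtain ⟨U, d, hU, hd, rfl⟩ := exists_orthogonal_diagonal hb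
  have hB : Uᵀ * Matrix.diagonal d * U = (Matrix.diagonal (fun i => Real.sqrt (d i)) * U)ᵀ *
      (Matrix.diagonal (fun i => Real.sqrt (d i)) * U) := by
    have h : Matrix.diagonal d = Matrix.diagonal (fun i => Real.sqrt (d i)) *
        Matrix.diagonal (fun i => Real.sqrt (d i)) := by
      rw [Matrix.diagonal_mul_diagonal]
      simp only [Real.mul_self_sqrt (hd _).le]
    calc _ = Uᵀ * (Matrix.diagonal (fun i => Real.sqrt (d i)) *
        Matrix.diagonal (fun i => Real.sqrt (d i))) * U := by rw [← h]
      _ = _ := by simp only [Matrix.transpose_mul, Matrix.diagonal_transpose, Matrix.mul_assoc]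
  refine ⟨_, ?_, hB⟩
  have h := hb.det_pos
  rw [hB, Matrix.det_mul] at h
  exact (right_ne_zero_of_mul h.ne').isUnit

lemma posDef_transpose_mul_self {B : Mat} (hB : IsUnit B.det) : (Bᵀ * B).PosDef := by
  have := Matrix.PosDef.conjTranspose_mul_self B
    (Matrix.mulVec_injective_of_isUnit ((Matrix.isUnit_iff_isUnit_det B).2 hB))
  rwa [Matrix.conjTranspose_eq_transpose_of_trivial] at this

/-- Two positive definite forms can be diagonalized simultaneously. -/
lemma exists_simultaneous_diagonal {b b' : Mat} (hb : b.PosDef) (hb' : b'.PosDef) :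
    ∃ (C : Mat) (x : Fin 3 → ℝ), IsUnit C.det ∧ b = Cᵀ * C ∧
      b' = Cᵀ * Matrix.diagonal (fun i => Real.exp (x i)) * C := by
  obtain ⟨R, hR, rfl⟩ := exists_transpose_mul_self hb
  have hRi : IsUnit (R⁻¹).det := by
    rw [Matrix.det_nonsing_inv]; exact hR.ringInverse
  have hP : ((R⁻¹)ᵀ * b' * R⁻¹).PosDef := by
    have := hb'.conjTranspose_mul_mul_same
      (Matrix.mulVec_injective_of_isUnit ((Matrix.isUnit_iff_isUnit_det _).2 hRi))
    rwa [Matrix.conjTranspose_eq_transpose_of_trivial] at this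
  obtain ⟨U, d, hU, hd, hUd⟩ := exists_orthogonal_diagonal hP
  have hUdet : IsUnit U.det := by
    have := congrArg Matrix.det hU
    rw [Matrix.det_mul, Matrix.det_one] at this
    exact IsUnit.of_mul_eq_one_right _ this
  refine ⟨U * R, fun i => Real.log (d i), ?_, ?_, ?_⟩
  · rw [Matrix.det_mul]; exact hUdet.mul hR
  · rw [Matrix.transpose_mul, Matrix.mul_assoc, ← Matrix.mul_assoc Uᵀ, hU, Matrix.one_mul]
  · simp only [Real.exp_log (hd _)]
    have h1 : Rᵀ * ((R⁻¹)ᵀ * b' * R⁻¹) * R = b' := by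
      have h2 : Rᵀ * (R⁻¹)ᵀ = 1 := by
        rw [← Matrix.transpose_mul, Matrix.nonsing_inv_mul _ hR, Matrix.transpose_one]
      calc _ = (Rᵀ * (R⁻¹)ᵀ) * b' * (R⁻¹ * R) := by simp only [Matrix.mul_assoc]
        _ = b' := by rw [h2, Matrix.nonsing_inv_mul _ hR, Matrix.one_mul, Matrix.mul_one]
    rw [← h1, hUd, Matrix.transpose_mul]
    simp only [Matrix.mul_assoc]

lemma trace_mul_mul_vecMulVec_mul (c u v : Mat) (h : Fin 3 → ℝ) :
    (c * (u * Matrix.vecMulVec h h * v)).trace = h ⬝ᵥ ((v * c * u) *ᵥ h) := by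
  rw [Matrix.trace_mul_comm, Matrix.mul_assoc, Matrix.trace_mul_comm, ← Matrix.mul_assoc,
    Matrix.mul_vecMulVec, Matrix.trace_vecMulVec, dotProduct_comm]

lemma trace_mul_magneticForm (h : Fin 3 → ℝ) (a c : Mat) :
    (c * magneticForm h a).trace =
      2 * (h ⬝ᵥ (a *ᵥ h)) * (c * a).trace - 4 * (h ⬝ᵥ ((a * c * a) *ᵥ h)) := by
  rw [magneticForm, Matrix.mul_sub, Matrix.trace_sub, Matrix.mul_smul, Matrix.mul_smul,
    Matrix.trace_smul, Matrix.trace_smul, trace_mul_mul_vecMulVec_mul, smul_eq_mul, smul_eq_mul]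

lemma trace_mul_kineticForm {f : Mom → ℝ} (hf : AdmissibleWeight f) {b : Mat} (hb : b.PosDef)
    (c : Mat) : (c * kineticForm f b).trace =
      ∫ p, f p * ((Real.sqrt (p ⬝ᵥ (b *ᵥ p)))⁻¹ * (p ⬝ᵥ (c *ᵥ p))) := by
  rw [kineticForm, trace_mul_moment (hf.mul_right (continuousOn_inv_sqrt_quad hb))]
  simp only [mul_assoc]

lemma trace_mul_kineticFormDeriv {f : Mom → ℝ} (hf : AdmissibleWeight f) {b : Mat} (hb : b.PosDef)
    (c x : Mat) : (c * kineticFormDeriv f b x).trace = -(1 / 2) *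
      ∫ p, f p * ((Real.sqrt (p ⬝ᵥ (b *ᵥ p)) ^ 3)⁻¹ * (p ⬝ᵥ (x *ᵥ p)) * (p ⬝ᵥ (c *ᵥ p))) := by
  rw [kineticFormDeriv, trace_mul_moment (hf.mul_right (continuousOn_kineticFormDeriv hb x)),
    ← integral_const_mul]
  exact integral_congr_ae (Eventually.of_forall fun p => by ring)

lemma trace_mul_source {f : Mom → ℝ} (hf : AdmissibleWeight f) (h : Fin 3 → ℝ) {a : Mat}
    (ha : a.PosDef) (c : Mat) : (c * source f h a).trace =
      8 * Real.pi / Real.sqrt a.det *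
        (∫ p, f p * ((Real.sqrt (p ⬝ᵥ (a⁻¹ *ᵥ p)))⁻¹ * (p ⬝ᵥ (c *ᵥ p)))) +
      a.det⁻¹ * (2 * (h ⬝ᵥ (a *ᵥ h)) * (c * a).trace - 4 * (h ⬝ᵥ ((a * c * a) *ᵥ h))) := by
  rw [source, Matrix.mul_add, Matrix.trace_add, Matrix.mul_smul, Matrix.mul_smul,
    Matrix.trace_smul, Matrix.trace_smul, trace_mul_magneticForm, smul_eq_mul, smul_eq_mul,
    trace_mul_kineticForm hf ha.inv]

lemma mul_exp_sub_one_nonneg (t : ℝ) : 0 ≤ t * (Real.exp t - 1) := by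
  rcases le_total 0 t with h | h
  · exact mul_nonneg h (by linarith [Real.one_le_exp h])
  · exact mul_nonneg_of_nonpos_of_nonpos h (by linarith [Real.exp_le_one_iff.2 h])

lemma mul_exp_sub_one_pos {t : ℝ} (ht : t ≠ 0) : 0 < t * (Real.exp t - 1) := by
  refine lt_of_le_of_ne (mul_exp_sub_one_nonneg t) fun h => ?_
  have h2 := (mul_eq_zero.1 h.symm).resolve_left ht
  exact ht (Real.exp_eq_one_iff t |>.1 (by linarith))

/-- The derivative of the convex function `s ↦ (∑ exp (s xᵢ) uᵢ) ^ (1/2)` grows from `0` to `1`. -/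
lemma sum_mul_exp_div_sqrt {x u : Fin 3 → ℝ} (hu : ∀ i, 0 ≤ u i) (hA : 0 < ∑ i, u i) :
    (Real.sqrt (∑ i, u i))⁻¹ * (∑ i, x i * u i) ≤
        (Real.sqrt (∑ i, Real.exp (x i) * u i))⁻¹ * (∑ i, x i * Real.exp (x i) * u i) ∧
      ∀ i, u i ≠ 0 → x i ≠ 0 → (Real.sqrt (∑ i, u i))⁻¹ * (∑ i, x i * u i) <
        (Real.sqrt (∑ i, Real.exp (x i) * u i))⁻¹ * (∑ i, x i * Real.exp (x i) * u i) := by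
  set A := ∑ i, u i with hAdef
  set B := ∑ i, Real.exp (x i) * u i with hBdef
  have hB : 0 < B := by
    have hnn : ∀ i ∈ Finset.univ, 0 ≤ Real.exp (x i) * u i :=
      fun i _ => mul_nonneg (Real.exp_pos _).le (hu i)
    refine (Finset.sum_nonneg hnn).lt_of_ne' fun h => ?_
    have h2 := (Finset.sum_eq_zero_iff_of_nonneg hnn).1 h
    have : A = 0 := Finset.sum_eq_zero fun i hi =>
      (mul_eq_zero.1 (h2 i hi)).resolve_left (Real.exp_pos _).ne'
    exact hA.ne' this
  set ρ := Real.log (Real.sqrt A / Real.sqrt B) with hρ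
  have hsA := Real.sqrt_pos.2 hA
  have hsB := Real.sqrt_pos.2 hB
  have hexp : Real.exp ρ = Real.sqrt A / Real.sqrt B := Real.exp_log (by positivity)
  have hAB : A * Real.exp (-ρ) = Real.exp ρ * B := by
    rw [Real.exp_neg, hexp]
    field_simp
    rw [Real.sq_sqrt hB.le, Real.sq_sqrt hA.le, mul_comm]
  have key : Real.sqrt A * ((Real.sqrt B)⁻¹ * (∑ i, x i * Real.exp (x i) * u i) -
      (Real.sqrt A)⁻¹ * (∑ i, x i * u i)) =
      (∑ i, u i * ((x i + ρ) * (Real.exp (x i + ρ) - 1))) + A * (-ρ * (Real.exp (-ρ) - 1)) := by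
    have e1 : Real.sqrt A * ((Real.sqrt B)⁻¹ * (∑ i, x i * Real.exp (x i) * u i) -
      (Real.sqrt A)⁻¹ * (∑ i, x i * u i)) =
        Real.exp ρ * (∑ i, x i * Real.exp (x i) * u i) - ∑ i, x i * u i := by
      rw [hexp]; field_simp
    rw [e1]
    have e2 : A * (-ρ * (Real.exp (-ρ) - 1)) = -ρ * (Real.exp ρ * B - A) := by
      rw [← hAB]; ring
    rw [e2, hBdef, hAdef]
    simp only [Real.exp_add, Fin.sum_univ_three]
    ring
  have h1 : 0 ≤ A * (-ρ * (Real.exp (-ρ) - 1)) := mul_nonneg hA.le (mul_exp_sub_one_nonneg _)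
  have h2 : ∀ i ∈ Finset.univ, 0 ≤ u i * ((x i + ρ) * (Real.exp (x i + ρ) - 1)) :=
    fun i _ => mul_nonneg (hu i) (mul_exp_sub_one_nonneg _)
  constructor
  · have h3 := add_nonneg (Finset.sum_nonneg h2) h1
    rw [← key] at h3
    linarith [nonneg_of_mul_nonneg_right h3 hsA]
  · intro i hui hxi
    have h3 : 0 < (∑ i, u i * ((x i + ρ) * (Real.exp (x i + ρ) - 1))) +
        A * (-ρ * (Real.exp (-ρ) - 1)) := by
      by_cases hρ0 : ρ = 0
      · refine add_pos_of_pos_of_nonneg ?_ h1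
        refine Finset.sum_pos' h2 ⟨i, Finset.mem_univ i, ?_⟩
        refine mul_pos ((hu i).lt_of_ne' hui) (mul_exp_sub_one_pos ?_)
        rwa [hρ0, add_zero]
      · exact add_pos_of_nonneg_of_pos (Finset.sum_nonneg h2)
          (mul_pos hA (mul_exp_sub_one_pos (neg_ne_zero.2 hρ0)))
    rw [← key] at h3
    linarith [pos_of_mul_pos_right h3 hsA.le]

lemma dotProduct_congr_diagonal (C : Mat) (w : Fin 3 → ℝ) (p : Fin 3 → ℝ) :
    p ⬝ᵥ ((Cᵀ * Matrix.diagonal w * C) *ᵥ p) = ∑ i, w i * (C *ᵥ p) i ^ 2 := by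
  rw [← Matrix.mulVec_mulVec, ← Matrix.mulVec_mulVec, Matrix.dotProduct_mulVec,
    Matrix.vecMul_transpose, dotProduct]
  refine Finset.sum_congr rfl fun i _ => ?_
  rw [Matrix.mulVec_diagonal]
  ring

lemma congr_diagonal_mul {C : Mat} (hC : IsUnit C.det) (u w : Fin 3 → ℝ) :
    (C⁻¹ * Matrix.diagonal u * (C⁻¹)ᵀ) * (Cᵀ * Matrix.diagonal w * C) =
      C⁻¹ * Matrix.diagonal (fun i => u i * w i) * C := by
  have h : (C⁻¹)ᵀ * Cᵀ = 1 := by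
    rw [← Matrix.transpose_mul, Matrix.mul_nonsing_inv _ hC, Matrix.transpose_one]
  calc _ = C⁻¹ * Matrix.diagonal u * ((C⁻¹)ᵀ * Cᵀ) * Matrix.diagonal w * C := by
        simp only [Matrix.mul_assoc]
    _ = C⁻¹ * (Matrix.diagonal u * Matrix.diagonal w) * C := by
        rw [h, Matrix.mul_one]; simp only [Matrix.mul_assoc]
    _ = _ := by rw [Matrix.diagonal_mul_diagonal]

lemma congr_diagonal_mul_mul {C : Mat} (hC : IsUnit C.det) (u w v : Fin 3 → ℝ) :
    (C⁻¹ * Matrix.diagonal u * (C⁻¹)ᵀ) * (Cᵀ * Matrix.diagonal w * C) *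
      (C⁻¹ * Matrix.diagonal v * (C⁻¹)ᵀ) =
      C⁻¹ * Matrix.diagonal (fun i => u i * w i * v i) * (C⁻¹)ᵀ := by
  rw [congr_diagonal_mul hC]
  calc _ = C⁻¹ * Matrix.diagonal (fun i => u i * w i) * (C * C⁻¹) * Matrix.diagonal v * (C⁻¹)ᵀ := by
        simp only [Matrix.mul_assoc]
    _ = C⁻¹ * (Matrix.diagonal (fun i => u i * w i) * Matrix.diagonal v) * (C⁻¹)ᵀ := by
        rw [Matrix.mul_nonsing_inv _ hC, Matrix.mul_one]; simp only [Matrix.mul_assoc]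
    _ = _ := by rw [Matrix.diagonal_mul_diagonal]

/-- The fixed point equation for a metric that is diagonal in the frame `C`, tested with a diagonal
tensor. -/
lemma fixed_point_diagonal {f : Mom → ℝ} (hf : AdmissibleWeight f) {h : Fin 3 → ℝ} {C : Mat}
    (hC : IsUnit C.det) {a : Mat} (ha : a.PosDef) (hfix : source f h a = a) {x : Fin 3 → ℝ}
    (hx : a⁻¹ = Cᵀ * Matrix.diagonal (fun i => Real.exp (x i)) * C) (y : Fin 3 → ℝ) :
    |(C⁻¹).det| * Real.exp (-(∑ i, x i) / 2) * (∑ i, y i) =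
      8 * Real.pi * (∫ p, f p * ((Real.sqrt (∑ i, Real.exp (x i) * (C *ᵥ p) i ^ 2))⁻¹ *
        ∑ i, y i * Real.exp (x i) * (C *ᵥ p) i ^ 2)) +
      (|(C⁻¹).det| * Real.exp (-(∑ i, x i) / 2))⁻¹ *
        ∑ i, ((C⁻¹)ᵀ *ᵥ h) i ^ 2 * Real.exp (-x i) * (2 * (∑ j, y j) - 4 * y i) := by
  set E := C⁻¹ with hE
  have hEdet : E.det ≠ 0 := by
    rw [hE, Matrix.det_nonsing_inv]; exact hC.ringInverse.ne_zero
  have haE : a = E * Matrix.diagonal (fun i => Real.exp (-x i)) * Eᵀ := by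
    have h1 : (E * Matrix.diagonal (fun i => Real.exp (-x i)) * Eᵀ) * a⁻¹ = 1 := by
      rw [hx, congr_diagonal_mul hC]
      have : (fun i => Real.exp (-x i) * Real.exp (x i)) = fun _ => (1 : ℝ) := by
        funext i; rw [← Real.exp_add]; simp
      rw [this, Matrix.diagonal_one, Matrix.mul_one, Matrix.nonsing_inv_mul _ hC]
    have h2 := congrArg (· * a) h1
    simp only [Matrix.one_mul, Matrix.mul_assoc, Matrix.nonsing_inv_mul _ (isUnit_det ha),
      Matrix.mul_one] at h2
    rw [← h2, Matrix.mul_assoc]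
  set c : Mat := Cᵀ * Matrix.diagonal (fun i => y i * Real.exp (x i)) * C with hc
  set D := |E.det| * Real.exp (-(∑ i, x i) / 2) with hD
  have hD0 : 0 < D := mul_pos (abs_pos.2 hEdet) (Real.exp_pos _)
  have hdet : a.det = D ^ 2 := by
    rw [haE, Matrix.det_mul, Matrix.det_mul, Matrix.det_transpose, Matrix.det_diagonal, hD, mul_pow,
      sq_abs, ← Real.exp_nat_mul, ← Real.exp_sum]
    have : ((2 : ℕ) : ℝ) * (-(∑ i, x i) / 2) = ∑ i, -x i := by
      rw [Finset.sum_neg_distrib]; push_cast; ring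
    rw [this]; ring
  have hsq : Real.sqrt a.det = D := by rw [hdet, Real.sqrt_sq hD0.le]
  have hca : (c * a).trace = ∑ i, y i := by
    rw [Matrix.trace_mul_comm, haE, hc, congr_diagonal_mul hC, Matrix.trace_mul_comm,
      ← Matrix.mul_assoc, Matrix.mul_nonsing_inv _ hC, Matrix.one_mul, Matrix.trace_diagonal]
    refine Finset.sum_congr rfl fun i _ => ?_
    rw [mul_left_comm, ← Real.exp_add]; simp
  have haca : a * c * a = E * Matrix.diagonal (fun i => y i * Real.exp (-x i)) * Eᵀ := by
    rw [haE, hc, congr_diagonal_mul_mul hC]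
    congr 3
    funext i
    rw [mul_left_comm, ← Real.exp_add]; simp
  have hquad : ∀ w : Fin 3 → ℝ, h ⬝ᵥ ((E * Matrix.diagonal w * Eᵀ) *ᵥ h) =
      ∑ i, w i * (Eᵀ *ᵥ h) i ^ 2 := fun w => by
    rw [← dotProduct_congr_diagonal, Matrix.transpose_transpose]
  have hah : h ⬝ᵥ (a *ᵥ h) = ∑ i, Real.exp (-x i) * (Eᵀ *ᵥ h) i ^ 2 := by
    conv_lhs => rw [haE]
    rw [hquad]
  have key := trace_mul_source hf h ha c
  rw [hfix, hca, haca, hquad, hah, hsq, hdet, hx] at key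
  simp only [dotProduct_congr_diagonal, hc] at key
  set I := ∫ p, f p * ((Real.sqrt (∑ i, Real.exp (x i) * (C *ᵥ p) i ^ 2))⁻¹ *
        ∑ i, y i * Real.exp (x i) * (C *ᵥ p) i ^ 2)
  set G := Eᵀ *ᵥ h
  have hsum : ∑ i, G i ^ 2 * Real.exp (-x i) * (2 * (∑ j, y j) - 4 * y i) =
      2 * (∑ i, Real.exp (-x i) * G i ^ 2) * (∑ i, y i) -
        4 * ∑ i, y i * Real.exp (-x i) * G i ^ 2 := by
    simp only [Fin.sum_univ_three]; ring
  rw [hsum]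
  refine (congrArg (D * ·) key).trans ?_
  field_simp

/-- The metric at the singularity is determined by the distribution function and the magnetic field. -/
theorem fixed_point_unique {f : Mom → ℝ} (hf : AdmissibleData f) {h : Fin 3 → ℝ} {a a' : Mat}
    (ha : a.PosDef) (ha' : a'.PosDef) (hfix : source f h a = a) (hfix' : source f h a' = a') :
    a = a' := by
  obtain ⟨C, x, hC, hb, hb'⟩ := exists_simultaneous_diagonal ha.inv ha'.inv
  by_cases hx : ∀ i, x i = 0
  · have : a⁻¹ = a'⁻¹ := by
      rw [hb, hb']; simp [hx]
    rw [← Matrix.nonsing_inv_nonsing_inv _ (isUnit_det ha), this,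
      Matrix.nonsing_inv_nonsing_inv _ (isUnit_det ha')]
  exfalso
  push Not at hx
  obtain ⟨i₀, hi₀⟩ := hx
  have e0 := fixed_point_diagonal hf.toAdmissibleWeight hC ha hfix (x := 0)
    (by rw [hb]; simp) x
  have e1 := fixed_point_diagonal hf.toAdmissibleWeight hC ha' hfix' hb' x
  have hCinj : ∀ p : Mom, p ≠ 0 → 0 < ∑ i, (C *ᵥ p) i ^ 2 := by
    intro p hp
    have h1 : C *ᵥ p ≠ 0 := fun h0 => hp
      (Matrix.mulVec_injective_of_isUnit ((Matrix.isUnit_iff_isUnit_det C).2 hC)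
        (h0.trans (Matrix.mulVec_zero C).symm))
    have h2 := dotProduct_self_eq_zero.not.2 h1
    have h3 : (C *ᵥ p) ⬝ᵥ (C *ᵥ p) = ∑ i, (C *ᵥ p) i ^ 2 := by
      simp [dotProduct, sq]
    rw [h3] at h2
    exact (Finset.sum_nonneg fun i _ => sq_nonneg _).lt_of_ne' h2
  have hCexp : ∀ p : Mom, p ≠ 0 → 0 < ∑ i, Real.exp (x i) * (C *ᵥ p) i ^ 2 := by
    intro p hp
    have := quad_pos ha'.inv hp
    rwa [hb', dotProduct_congr_diagonal] at this
  have hcont : Continuous fun p : Mom => C *ᵥ p := by fun_prop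
  have hc0 : ContinuousOn (fun p : Mom => (Real.sqrt (∑ i, (C *ᵥ p) i ^ 2))⁻¹ *
      ∑ i, x i * (C *ᵥ p) i ^ 2) {0}ᶜ := by
    refine ContinuousOn.mul (ContinuousOn.inv₀ (by fun_prop) fun p hp => ?_) (by fun_prop)
    exact (Real.sqrt_pos.2 (hCinj p hp)).ne'
  have hc1 : ContinuousOn (fun p : Mom => (Real.sqrt (∑ i, Real.exp (x i) * (C *ᵥ p) i ^ 2))⁻¹ *
      ∑ i, x i * Real.exp (x i) * (C *ᵥ p) i ^ 2) {0}ᶜ := by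
    refine ContinuousOn.mul (ContinuousOn.inv₀ (by fun_prop) fun p hp => ?_) (by fun_prop)
    exact (Real.sqrt_pos.2 (hCexp p hp)).ne'
  simp only [Pi.zero_apply, Real.exp_zero, one_mul, mul_one, Finset.sum_const_zero, neg_zero,
    zero_div] at e0
  set I₀ := ∫ p, f p * ((Real.sqrt (∑ i, (C *ᵥ p) i ^ 2))⁻¹ * ∑ i, x i * (C *ᵥ p) i ^ 2) with hI₀
  set I₁ := ∫ p, f p * ((Real.sqrt (∑ i, Real.exp (x i) * (C *ᵥ p) i ^ 2))⁻¹ *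
        ∑ i, x i * Real.exp (x i) * (C *ᵥ p) i ^ 2) with hI₁
  have hI : 0 < I₁ - I₀ := by
    rw [hI₁, hI₀, ← integral_sub (hf.integrable_mul hc1) (hf.integrable_mul hc0)]
    simp only [← mul_sub]
    have hrow : C i₀ ≠ 0 := fun h0 => by
      have : C.det = 0 := Matrix.det_eq_zero_of_row_eq_zero i₀ fun j => congrFun h0 j
      exact hC.ne_zero this
    refine hf.integral_mul_pos (hc1.sub hc0) (fun p hp => ?_) hrow fun p hp => ?_
    · exact sub_nonneg.2 (sum_mul_exp_div_sqrt (fun i => sq_nonneg _) (hCinj p hp)).1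
    · have hp0 : p ≠ 0 := fun h0 => hp (by rw [h0, dotProduct_zero])
      exact sub_pos.2 ((sum_mul_exp_div_sqrt (fun i => sq_nonneg _) (hCinj p hp0)).2 i₀
        (pow_ne_zero 2 hp) hi₀)
  set G := (C⁻¹)ᵀ *ᵥ h
  set d := |(C⁻¹).det| with hd
  have hd0 : 0 < d := by
    refine abs_pos.2 ?_
    rw [Matrix.det_nonsing_inv]; exact hC.ringInverse.ne_zero
  set θ := ∑ i, x i with hθ
  have hterm : ∀ i, 0 ≤ G i ^ 2 * ((2 * θ - 4 * x i) * (Real.exp (θ / 2 - x i) - 1)) := fun i => by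
    refine mul_nonneg (sq_nonneg _) ?_
    have := mul_exp_sub_one_nonneg (θ / 2 - x i)
    nlinarith
  have hθ0 : 0 ≤ d * (θ * (1 - Real.exp (-θ / 2))) := by
    refine mul_nonneg hd0.le ?_
    have := mul_exp_sub_one_nonneg (-θ / 2)
    nlinarith
  have hinv : (d * Real.exp (-θ / 2))⁻¹ = d⁻¹ * Real.exp (θ / 2) := by
    rw [mul_inv, ← Real.exp_neg]; congr 2; ring
  have hsum : (d * Real.exp (-θ / 2))⁻¹ *
      (∑ i, G i ^ 2 * Real.exp (-x i) * (2 * θ - 4 * x i)) -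
      d⁻¹ * (∑ i, G i ^ 2 * (2 * θ - 4 * x i)) =
      d⁻¹ * ∑ i, G i ^ 2 * ((2 * θ - 4 * x i) * (Real.exp (θ / 2 - x i) - 1)) := by
    rw [hinv]
    have : ∀ i, Real.exp (θ / 2 - x i) = Real.exp (θ / 2) * Real.exp (-x i) := fun i => by
      rw [← Real.exp_add]; rfl
    simp only [this, Fin.sum_univ_three]
    ring
  have hlast : 0 ≤ d⁻¹ * ∑ i, G i ^ 2 * ((2 * θ - 4 * x i) * (Real.exp (θ / 2 - x i) - 1)) :=
    mul_nonneg (inv_nonneg.2 hd0.le) (Finset.sum_nonneg fun i _ => hterm i)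
  have hpi := mul_pos (mul_pos (by norm_num : (0 : ℝ) < 8) Real.pi_pos) hI
  linarith

lemma transpose_eq_of_posDef {a : Mat} (ha : a.PosDef) : aᵀ = a := by
  have := ha.isHermitian.eq
  rwa [Matrix.conjTranspose_eq_transpose_of_trivial] at this

lemma exists_ball_posDef {a : Mat} (ha : a.PosDef) :
    ∃ ε > 0, ∀ x ∈ Metric.ball a ε, xᵀ = x → x.PosDef := by
  obtain ⟨c, hc, M, hM, ε, hε, -, hlow⟩ := exists_le_quad ha (isCompact_sphere (0 : Mom) 1)
    (by simp)
  refine ⟨ε, hε, fun x hx hsym => Matrix.PosDef.of_dotProduct_mulVec_pos ?_ fun p hp => ?_⟩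
  · rw [Matrix.IsHermitian, Matrix.conjTranspose_eq_transpose_of_trivial, hsym]
  · have hp0 : 0 < ‖p‖ := norm_pos_iff.2 hp
    have h1 := hlow x hx (‖p‖⁻¹ • p) (by simp [norm_smul, hp0.ne'])
    rw [Matrix.mulVec_smul, dotProduct_smul, smul_dotProduct, smul_eq_mul, smul_eq_mul] at h1
    have h2 : 0 < ‖p‖⁻¹ * (‖p‖⁻¹ * p ⬝ᵥ x *ᵥ p) := hc.trans_le h1
    rw [star_trivial]
    have h3 := pos_of_mul_pos_right h2 (inv_nonneg.2 hp0.le)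
    exact pos_of_mul_pos_right h3 (inv_nonneg.2 hp0.le)

lemma continuousAt_inv {a : Mat} (ha : IsUnit a.det) : ContinuousAt (fun a : Mat => a⁻¹) a := by
  obtain ⟨L, hL, -⟩ := hasStrictDeriv_inv ha
  exact hL.continuousAt

lemma transpose_magneticForm (h : Fin 3 → ℝ) {a : Mat} (ha : aᵀ = a) :
    (magneticForm h a)ᵀ = magneticForm h a := by
  rw [magneticForm, Matrix.transpose_sub, Matrix.transpose_smul, Matrix.transpose_smul,
    Matrix.transpose_mul, Matrix.transpose_mul, ha, Matrix.transpose_vecMulVec, Matrix.mul_assoc]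

lemma transpose_source (f : Mom → ℝ) (h : Fin 3 → ℝ) {a : Mat} (ha : aᵀ = a) :
    (source f h a)ᵀ = source f h a := by
  rw [source, Matrix.transpose_add, Matrix.transpose_smul, Matrix.transpose_smul,
    transpose_magneticForm h ha, kineticForm, transpose_moment]

lemma quad_transpose_mul_self (B : Mat) (p : Mom) :
    p ⬝ᵥ ((Bᵀ * B) *ᵥ p) = (B *ᵥ p) ⬝ᵥ (B *ᵥ p) := by
  rw [← Matrix.mulVec_mulVec, Matrix.dotProduct_mulVec, Matrix.vecMul_transpose]

/-- The total energy, for the inverse metric `BᵀB`. -/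
noncomputable def totalEnergy (f : Mom → ℝ) (B : Mat) : ℝ :=
  ∫ p, f p * Real.sqrt (p ⬝ᵥ ((Bᵀ * B) *ᵥ p))

lemma continuous_totalEnergy {f : Mom → ℝ} (hf : AdmissibleWeight f) :
    Continuous (totalEnergy f) := by
  have h1 : Continuous (Function.uncurry fun (B : Mat) (p : Mom) =>
      f p * Real.sqrt (p ⬝ᵥ ((Bᵀ * B) *ᵥ p))) := by
    have := hf.continuous
    unfold Function.uncurry
    fun_prop
  have h2 := continuous_parametric_integral_of_continuous (μ := volume) h1 hf.hasCompactSupport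
  refine h2.congr fun B => ?_
  refine setIntegral_eq_integral_of_forall_compl_eq_zero fun p hp => ?_
  rw [image_eq_zero_of_notMem_tsupport hp, zero_mul]

lemma totalEnergy_smul (f : Mom → ℝ) {t : ℝ} (ht : 0 ≤ t) (B : Mat) :
    totalEnergy f (t • B) = t * totalEnergy f B := by
  rw [totalEnergy, totalEnergy, ← integral_const_mul]
  refine integral_congr_ae (Eventually.of_forall fun p => ?_)
  have : p ⬝ᵥ (((t • B)ᵀ * (t • B)) *ᵥ p) = t ^ 2 * (p ⬝ᵥ ((Bᵀ * B) *ᵥ p)) := by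
    rw [quad_transpose_mul_self, quad_transpose_mul_self, Matrix.smul_mulVec, dotProduct_smul,
      smul_dotProduct, smul_eq_mul, smul_eq_mul]
    ring
  simp only [this]
  rw [Real.sqrt_mul (sq_nonneg t), Real.sqrt_sq ht]
  ring

lemma AdmissibleData.exists_le_totalEnergy {f : Mom → ℝ} (hf : AdmissibleData f) :
    ∃ c > 0, ∀ B : Mat, c * ‖B‖ ≤ totalEnergy f B := by
  have : ProperSpace Mat := FiniteDimensional.proper ℝ Mat
  obtain ⟨B₀, hB₀, hmin⟩ := (isCompact_sphere (0 : Mat) 1).exists_isMinOn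
    (NormedSpace.sphere_nonempty.2 zero_le_one)
    (continuous_totalEnergy hf.toAdmissibleWeight).continuousOn
  have hB₀n : B₀ ≠ 0 := by
    rintro rfl
    simp at hB₀
  have hpos : 0 < totalEnergy f B₀ := by
    obtain ⟨i, hi⟩ : ∃ i, B₀ i ≠ 0 := by
      by_contra! h
      exact hB₀n (funext h)
    refine hf.integral_mul_pos (by fun_prop) (fun p _ => Real.sqrt_nonneg _) hi fun p hp => ?_
    rw [quad_transpose_mul_self]
    refine Real.sqrt_pos.2 ?_
    have h1 : B₀ *ᵥ p ≠ 0 := fun h0 => hp (congrFun h0 i)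
    refine lt_of_le_of_ne ?_ (Ne.symm (dotProduct_self_eq_zero.not.2 h1))
    exact Finset.sum_nonneg fun j _ => mul_self_nonneg _
  refine ⟨_, hpos, fun B => ?_⟩
  by_cases hB : B = 0
  · rw [hB, norm_zero, mul_zero]
    exact integral_nonneg fun p => mul_nonneg (hf.nonneg p) (Real.sqrt_nonneg _)
  · have hn : 0 < ‖B‖ := norm_pos_iff.2 hB
    have h1 : totalEnergy f B₀ ≤ totalEnergy f (‖B‖⁻¹ • B) := hmin (by simp [norm_smul, hn.ne'])
    rw [totalEnergy_smul f (inv_nonneg.2 hn.le), ← div_eq_inv_mul, le_div_iff₀ hn] at h1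
    exact h1

/-- The functional that the initial metric minimizes, in terms of `B` where `BᵀB` is the inverse
metric. -/
noncomputable def potential (f : Mom → ℝ) (h : Fin 3 → ℝ) (B : Mat) : ℝ :=
  16 * Real.pi * totalEnergy f B + 4 * |B.det| * (h ⬝ᵥ ((Bᵀ * B)⁻¹ *ᵥ h)) + 2 / |B.det|

lemma AdmissibleData.exists_potential_le {f : Mom → ℝ} (hf : AdmissibleData f) (h : Fin 3 → ℝ) :
    ∃ B₀ : Mat, IsUnit B₀.det ∧ ∀ B : Mat, IsUnit B.det → potential f h B₀ ≤ potential f h B := by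
  have : ProperSpace Mat := FiniteDimensional.proper ℝ Mat
  obtain ⟨c, hc, hcB⟩ := hf.exists_le_totalEnergy
  have hpi := Real.pi_pos
  have hmid : ∀ B : Mat, IsUnit B.det → 0 ≤ 4 * |B.det| * (h ⬝ᵥ ((Bᵀ * B)⁻¹ *ᵥ h)) := fun B hB =>
    mul_nonneg (by positivity) (quad_nonneg (posDef_transpose_mul_self hB).inv.posSemidef h)
  have hen : ∀ B, 0 ≤ totalEnergy f B := fun B => (by positivity : 0 ≤ c * ‖B‖).trans (hcB B)
  set w := potential f h 1 with hw
  have hw0 : 0 < w := by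
    have h1 := hmid 1 (by simp)
    have h2 := hen 1
    rw [hw, potential]
    have : (0 : ℝ) < 2 / |(1 : Mat).det| := by simp
    positivity
  set K : Set Mat := Metric.closedBall 0 (w / (16 * Real.pi * c)) ∩ {B | 2 / w ≤ |B.det|} with hK
  have hmem : ∀ B : Mat, IsUnit B.det → potential f h B ≤ w → B ∈ K := by
    intro B hB hle
    have h1 := hmid B hB
    have h2 := hcB B
    have h3 : 0 < |B.det| := abs_pos.2 hB.ne_zero
    have h4 : 0 < 2 / |B.det| := by positivity
    have h5 : 0 ≤ 16 * Real.pi * totalEnergy f B := mul_nonneg (by positivity) (hen B)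
    rw [potential] at hle
    refine ⟨?_, ?_⟩
    · rw [mem_closedBall_zero_iff, le_div_iff₀ (by positivity)]
      have : 16 * Real.pi * (c * ‖B‖) ≤ 16 * Real.pi * totalEnergy f B := by gcongr
      linarith
    · have h6 : 2 / |B.det| ≤ w := by linarith
      rw [div_le_iff₀ h3] at h6
      change 2 / w ≤ |B.det|
      rw [div_le_iff₀ hw0]
      linarith
  have hKc : IsCompact K := (isCompact_closedBall _ _).inter_right
    (isClosed_le continuous_const (by fun_prop : Continuous fun B : Mat => |B.det|))
  have hKu : ∀ B ∈ K, IsUnit B.det := fun B hB => by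
    have h1 : 0 < |B.det| := (by positivity : 0 < 2 / w).trans_le hB.2
    exact (abs_pos.1 h1).isUnit
  have hcont : ContinuousOn (potential f h) K := by
    intro B hB
    refine ContinuousAt.continuousWithinAt ?_
    have hd := hKu B hB
    have h1 : ContinuousAt (fun B : Mat => (Bᵀ * B)⁻¹) B :=
      ContinuousAt.comp (f := fun B : Mat => Bᵀ * B)
        (continuousAt_inv (isUnit_det (posDef_transpose_mul_self hd)))
        (by fun_prop : Continuous fun B : Mat => Bᵀ * B).continuousAt
    have h2 : Continuous fun B : Mat => |B.det| := by fun_prop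
    have h3 : ContinuousAt (fun B : Mat => h ⬝ᵥ ((Bᵀ * B)⁻¹ *ᵥ h)) B := by
      simp only [← quadCLM_apply]
      exact (quadCLM h).continuous.continuousAt.comp h1
    have h4 := (continuous_totalEnergy hf.toAdmissibleWeight).continuousAt (x := B)
    exact ((h4.const_mul _).add ((h2.continuousAt.const_mul 4).mul h3)).add
      (continuousAt_const.div h2.continuousAt (abs_pos.2 hd.ne_zero).ne')
  have h1K : (1 : Mat) ∈ K := hmem 1 (by simp) le_rfl
  obtain ⟨B₀, hB₀, hmin⟩ := hKc.exists_isMinOn ⟨1, h1K⟩ hcont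
  refine ⟨B₀, hKu B₀ hB₀, fun B hB => ?_⟩
  by_cases hBK : B ∈ K
  · exact hmin hBK
  · have h2 : potential f h B₀ ≤ w := hmin h1K
    by_contra hlt
    push Not at hlt
    exact hBK (hmem B hB (hlt.le.trans h2))

lemma sqrt_le_add_div {u v : ℝ} (hu : 0 < u) (hv : 0 ≤ v) :
    Real.sqrt v ≤ Real.sqrt u + 1 / 2 * ((Real.sqrt u)⁻¹ * (v - u)) := by
  have hs := Real.sqrt_pos.2 hu
  have h1 : Real.sqrt u * (Real.sqrt u + 1 / 2 * ((Real.sqrt u)⁻¹ * (v - u))) =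
      (Real.sqrt u ^ 2 + Real.sqrt v ^ 2) / 2 := by
    rw [Real.sq_sqrt hv, Real.sq_sqrt hu.le]
    field_simp
    rw [Real.sq_sqrt hu.le]
    ring
  have h2 := two_mul_le_add_sq (Real.sqrt u) (Real.sqrt v)
  nlinarith

/-- Existence of the metric at the singularity. -/
theorem AdmissibleData.exists_fixed_point {f : Mom → ℝ} (hf : AdmissibleData f) (h : Fin 3 → ℝ) :
    ∃ a : Mat, a.PosDef ∧ source f h a = a := by
  obtain ⟨B₀, hB₀, hmin⟩ := hf.exists_potential_le h
  have hb₀ := posDef_transpose_mul_self hB₀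
  set b₀ := B₀ᵀ * B₀ with hb₀def
  set a₀ := b₀⁻¹ with ha₀def
  have ha₀ : a₀.PosDef := hb₀.inv
  have hb₀' : a₀⁻¹ = b₀ := Matrix.nonsing_inv_nonsing_inv _ (isUnit_det hb₀)
  have hd₀ := isUnit_det ha₀
  have hdpos := ha₀.det_pos
  set J := kineticForm f b₀ with hJ
  set U : Mat → ℝ := fun a => 8 * Real.pi * (a⁻¹ * J).trace +
    4 * ((Real.sqrt a.det)⁻¹ * (h ⬝ᵥ (a *ᵥ h))) + 2 * Real.sqrt a.det with hU
  have hUmin : ∀ a : Mat, a.PosDef → U a₀ ≤ U a := by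
    intro a ha
    obtain ⟨B, hB, hbB⟩ := exists_transpose_mul_self ha.inv
    have hdet : ∀ (a B : Mat), a.PosDef → IsUnit B.det → a⁻¹ = Bᵀ * B →
        |B.det| = (Real.sqrt a.det)⁻¹ := by
      intro a B ha hB hbB
      have h1 := congrArg Matrix.det hbB
      rw [Matrix.det_nonsing_inv, Ring.inverse_eq_inv', Matrix.det_mul, Matrix.det_transpose] at h1
      rw [← Real.sqrt_inv, h1, ← sq, Real.sqrt_sq_eq_abs]
    have hpot : ∀ (a B : Mat), a.PosDef → IsUnit B.det → a⁻¹ = Bᵀ * B →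
        potential f h B = 16 * Real.pi * totalEnergy f B +
          4 * ((Real.sqrt a.det)⁻¹ * (h ⬝ᵥ (a *ᵥ h))) + 2 * Real.sqrt a.det := by
      intro a B ha hB hbB
      rw [potential, hdet a B ha hB hbB, ← hbB, Matrix.nonsing_inv_nonsing_inv _ (isUnit_det ha),
        div_inv_eq_mul, mul_assoc 4]
    have h1 := hmin B hB
    rw [hpot a B ha hB hbB, hpot a₀ B₀ ha₀ hB₀ hb₀'] at h1
    have hk1 := trace_mul_kineticForm hf.toAdmissibleWeight hb₀ a⁻¹
    have hk0 := trace_mul_kineticForm hf.toAdmissibleWeight hb₀ b₀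
    have hint : ∀ c : Mat, Integrable fun p =>
        f p * ((Real.sqrt (p ⬝ᵥ (b₀ *ᵥ p)))⁻¹ * (p ⬝ᵥ (c *ᵥ p))) := fun c =>
      hf.integrable_mul ((continuousOn_inv_sqrt_quad hb₀).mul (continuous_quad c).continuousOn)
    have hintE : ∀ c : Mat, Integrable fun p => f p * Real.sqrt (p ⬝ᵥ (c *ᵥ p)) := fun c =>
      hf.integrable_mul (continuous_quad c).sqrt.continuousOn
    have h2 : totalEnergy f B ≤ totalEnergy f B₀ +
        1 / 2 * ((a⁻¹ * J).trace - (b₀ * J).trace) := by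
      have hdiff : Integrable fun p => 1 / 2 *
          (f p * ((Real.sqrt (p ⬝ᵥ (b₀ *ᵥ p)))⁻¹ * (p ⬝ᵥ (a⁻¹ *ᵥ p))) -
            f p * ((Real.sqrt (p ⬝ᵥ (b₀ *ᵥ p)))⁻¹ * (p ⬝ᵥ (b₀ *ᵥ p)))) :=
        ((hint _).sub (hint _)).const_mul _
      rw [hJ, hk1, hk0, totalEnergy, totalEnergy, ← hbB, ← hb₀def, ← integral_sub (hint _) (hint _),
        ← integral_const_mul, ← integral_add (hintE _) hdiff]
      refine integral_mono (hintE _) ((hintE _).add hdiff) fun p => ?_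
      by_cases hp : p = 0
      · simp [hp]
      · have := mul_le_mul_of_nonneg_left
          (sqrt_le_add_div (quad_pos hb₀ hp) (quad_pos ha.inv hp).le) (hf.nonneg p)
        refine this.trans (le_of_eq ?_)
        ring
    have h3 := mul_le_mul_of_nonneg_left h2 (by positivity : 0 ≤ 16 * Real.pi)
    simp only [hU, hb₀']
    linarith
  have hUder : HasStrictDeriv U (fun x => 8 * Real.pi * -(b₀ * x * b₀ * J).trace +
      4 * ((Real.sqrt a₀.det)⁻¹ * (h ⬝ᵥ (x *ᵥ h) - 1 / 2 * (b₀ * x).trace * (h ⬝ᵥ (a₀ *ᵥ h)))) +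
      Real.sqrt a₀.det * (b₀ * x).trace) a₀ := by
    have hsq := Real.sqrt_pos.2 hdpos
    have d1 := (hasStrictDeriv_trace_inv_mul J hd₀).const_smul (8 * Real.pi)
    have d2 := HasStrictDeriv.comp_real (Real.hasStrictDerivAt_sqrt hdpos.ne')
      (hasStrictDeriv_det hd₀)
    have d3 : HasStrictDeriv (fun a : Mat => (Real.sqrt a.det)⁻¹) _ a₀ :=
      HasStrictDeriv.comp_real (hasStrictDerivAt_inv hsq.ne') d2
    have d4 := (d3.smul (hasStrictDeriv_clm (quadCLM h) a₀)).const_smul 4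
    have d5 := (d1.add d4).add (d2.const_smul 2)
    rw [hb₀'] at d5
    simp only [smul_eq_mul, quadCLM_apply] at d5
    refine d5.congr fun x => ?_
    have hdet : a₀.det = Real.sqrt a₀.det ^ 2 := (Real.sq_sqrt hdpos.le).symm
    set D := Real.sqrt a₀.det with hDdef
    rw [hdet]
    field_simp
    ring
  set Y := a₀ - source f h a₀ with hY
  have ha₀T := transpose_eq_of_posDef ha₀
  have hYT : Yᵀ = Y := by rw [hY, Matrix.transpose_sub, transpose_source f h ha₀T, ha₀T]
  set x := a₀ * Y * a₀ with hx
  have hxT : xᵀ = x := by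
    rw [hx, Matrix.transpose_mul, Matrix.transpose_mul, hYT, ha₀T, Matrix.mul_assoc]
  have hba : b₀ * a₀ = 1 := Matrix.mul_nonsing_inv _ (isUnit_det hb₀)
  have hab : a₀ * b₀ = 1 := Matrix.nonsing_inv_mul _ (isUnit_det hb₀)
  have hbx : b₀ * x = Y * a₀ := by
    rw [hx, ← Matrix.mul_assoc, ← Matrix.mul_assoc, hba, Matrix.one_mul]
  have hbxb : b₀ * x * b₀ = Y := by rw [hbx, Matrix.mul_assoc, hab, Matrix.mul_one]
  obtain ⟨L, hL, hLx⟩ := hUder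
  have hline : HasDerivAt (fun s : ℝ => a₀ + s • x) x 0 := by
    simpa using ((hasDerivAt_id (0 : ℝ)).smul_const x).const_add a₀
  have hcomp : HasDerivAt (fun s : ℝ => U (a₀ + s • x)) (L x) 0 := by
    have hL' : HasFDerivAt U L (a₀ + (0 : ℝ) • x) := by simpa using hL.hasFDerivAt
    exact hL'.comp_hasDerivAt (0 : ℝ) hline
  have hloc : IsLocalMin (fun s : ℝ => U (a₀ + s • x)) 0 := by
    obtain ⟨ε, hε, hball⟩ := exists_ball_posDef ha₀
    have : ∀ᶠ s : ℝ in 𝓝 0, a₀ + s • x ∈ Metric.ball a₀ ε := by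
      refine hline.continuousAt.eventually_mem ?_
      simpa using Metric.ball_mem_nhds a₀ hε
    filter_upwards [this] with s hs
    simp only [zero_smul, add_zero]
    refine hUmin _ (hball _ hs ?_)
    rw [Matrix.transpose_add, Matrix.transpose_smul, ha₀T, hxT]
  have hzero := hloc.hasDerivAt_eq_zero hcomp
  simp only [hLx, hbxb] at hzero
  rw [hbx] at hzero
  have hsrc := trace_mul_source hf.toAdmissibleWeight h ha₀ Y
  rw [hb₀', ← trace_mul_kineticForm hf.toAdmissibleWeight hb₀, ← hJ, ← hx] at hsrc
  have hYY : (Y * Y).trace = 0 := by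
    have e1 : (Y * Y).trace = (Y * a₀).trace - (Y * source f h a₀).trace := by
      conv_lhs => rw [hY, ← hY, Matrix.mul_sub, Matrix.trace_sub]
    have hD := Real.sqrt_pos.2 hdpos
    have hdet : a₀.det = Real.sqrt a₀.det ^ 2 := (Real.sq_sqrt hdpos.le).symm
    set D := Real.sqrt a₀.det with hDdef
    have e2 : D * (Y * Y).trace = 0 := by
      rw [e1, hsrc, hdet, ← hzero]
      field_simp
      ring
    exact (mul_eq_zero.1 e2).resolve_left hD.ne'
  refine ⟨a₀, ha₀, ?_⟩
  have hY0 : Y = 0 := by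
    rw [← Matrix.trace_conjTranspose_mul_self_eq_zero_iff,
      Matrix.conjTranspose_eq_transpose_of_trivial, hYT, hYY]
  exact (sub_eq_zero.1 hY0).symm

lemma trace_congr_mul {a : Mat} (ha : IsUnit a.det) (y : Mat) :
    (a⁻¹ * y * a⁻¹ * a).trace = (a⁻¹ * y).trace := by
  rw [Matrix.mul_assoc, Matrix.nonsing_inv_mul _ ha, Matrix.mul_one]

lemma mul_congr_mul {a : Mat} (ha : IsUnit a.det) (y : Mat) : a * (a⁻¹ * y * a⁻¹) = y * a⁻¹ := by
  rw [Matrix.mul_assoc a⁻¹, ← Matrix.mul_assoc, Matrix.mul_nonsing_inv _ ha, Matrix.one_mul]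

lemma congr_mul_self {a : Mat} (ha : IsUnit a.det) (y : Mat) : (a⁻¹ * y * a⁻¹) * a = a⁻¹ * y := by
  rw [Matrix.mul_assoc, Matrix.nonsing_inv_mul _ ha, Matrix.mul_one]

lemma mul_congr_mul_self {a : Mat} (ha : IsUnit a.det) (y : Mat) :
    a * (a⁻¹ * y * a⁻¹) * a = y := by
  rw [mul_congr_mul ha, Matrix.mul_assoc, Matrix.nonsing_inv_mul _ ha, Matrix.mul_one]

/-- The pairing of the derivative of `source` with a tensor. -/
lemma trace_congr_mul_sourceDeriv {f : Mom → ℝ} (hf : AdmissibleWeight f) (h : Fin 3 → ℝ) {a : Mat}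
    (ha : a.PosDef) (x y : Mat) :
    (a⁻¹ * y * a⁻¹ * sourceDeriv f h a x).trace =
      -(1 / 2 * (a⁻¹ * x).trace) *
        (8 * Real.pi / Real.sqrt a.det * (a⁻¹ * y * a⁻¹ * kineticForm f a⁻¹).trace) +
      4 * Real.pi / Real.sqrt a.det * (∫ p, f p * ((Real.sqrt (p ⬝ᵥ (a⁻¹ *ᵥ p)) ^ 3)⁻¹ *
        (p ⬝ᵥ ((a⁻¹ * x * a⁻¹) *ᵥ p)) * (p ⬝ᵥ ((a⁻¹ * y * a⁻¹) *ᵥ p)))) +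
      a.det⁻¹ * (-(a⁻¹ * x).trace * (2 * (h ⬝ᵥ (a *ᵥ h)) * (a⁻¹ * y).trace - 4 * (h ⬝ᵥ (y *ᵥ h))) +
        2 * (h ⬝ᵥ (x *ᵥ h)) * (a⁻¹ * y).trace + 2 * (h ⬝ᵥ (a *ᵥ h)) * (a⁻¹ * y * a⁻¹ * x).trace -
        4 * (h ⬝ᵥ ((y * a⁻¹ * x) *ᵥ h) + h ⬝ᵥ ((x * a⁻¹ * y) *ᵥ h))) := by
  have hd := isUnit_det ha
  have e1 := trace_mul_kineticFormDeriv hf ha.inv (a⁻¹ * y * a⁻¹) (a⁻¹ * x * a⁻¹)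
  have e2 := trace_mul_magneticForm h a (a⁻¹ * y * a⁻¹)
  rw [trace_congr_mul hd, mul_congr_mul_self hd] at e2
  have e3 := trace_mul_mul_vecMulVec_mul (a⁻¹ * y * a⁻¹) x a h
  rw [mul_congr_mul hd] at e3
  have e4 := trace_mul_mul_vecMulVec_mul (a⁻¹ * y * a⁻¹) a x h
  rw [Matrix.mul_assoc x, congr_mul_self hd, ← Matrix.mul_assoc x] at e4
  simp only [sourceDeriv, Matrix.mul_add, Matrix.mul_sub, Matrix.mul_smul, Matrix.trace_add,
    Matrix.trace_sub, Matrix.trace_smul, smul_eq_mul, e1, e2, e3, e4, trace_congr_mul hd]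
  ring

/-- The linearization of the fixed point equation, as a bilinear form. -/
lemma trace_linearization {f : Mom → ℝ} (hf : AdmissibleWeight f) {h : Fin 3 → ℝ} {a : Mat}
    (ha : a.PosDef) (hfix : source f h a = a) (x y : Mat) :
    (a⁻¹ * y * a⁻¹ * (x - sourceDeriv f h a x)).trace =
      (a⁻¹ * y * a⁻¹ * x).trace + 1 / 2 * (a⁻¹ * x).trace * (a⁻¹ * y).trace -
      4 * Real.pi / Real.sqrt a.det * (∫ p, f p * ((Real.sqrt (p ⬝ᵥ (a⁻¹ *ᵥ p)) ^ 3)⁻¹ *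
        (p ⬝ᵥ ((a⁻¹ * x * a⁻¹) *ᵥ p)) * (p ⬝ᵥ ((a⁻¹ * y * a⁻¹) *ᵥ p)))) +
      a.det⁻¹ * ((h ⬝ᵥ (a *ᵥ h)) * (a⁻¹ * x).trace * (a⁻¹ * y).trace
        - 2 * (a⁻¹ * x).trace * (h ⬝ᵥ (y *ᵥ h)) - 2 * (a⁻¹ * y).trace * (h ⬝ᵥ (x *ᵥ h))
        - 2 * (h ⬝ᵥ (a *ᵥ h)) * (a⁻¹ * y * a⁻¹ * x).trace
        + 4 * (h ⬝ᵥ ((y * a⁻¹ * x) *ᵥ h) + h ⬝ᵥ ((x * a⁻¹ * y) *ᵥ h))) := by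
  have hd := isUnit_det ha
  have e1 := trace_mul_source hf h ha (a⁻¹ * y * a⁻¹)
  rw [hfix, trace_congr_mul hd, mul_congr_mul_self hd, ← trace_mul_kineticForm hf ha.inv] at e1
  have e2 : 8 * Real.pi / Real.sqrt a.det * (a⁻¹ * y * a⁻¹ * kineticForm f a⁻¹).trace =
      (a⁻¹ * y).trace - a.det⁻¹ * (2 * (h ⬝ᵥ (a *ᵥ h)) * (a⁻¹ * y).trace - 4 * (h ⬝ᵥ (y *ᵥ h))) := by
    linarith
  rw [Matrix.mul_sub, Matrix.trace_sub, trace_congr_mul_sourceDeriv hf h ha, e2]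
  ring

lemma trace_linearization_comm {f : Mom → ℝ} (hf : AdmissibleWeight f) {h : Fin 3 → ℝ} {a : Mat}
    (ha : a.PosDef) (hfix : source f h a = a) (x y : Mat) :
    (a⁻¹ * y * a⁻¹ * (x - sourceDeriv f h a x)).trace =
      (a⁻¹ * x * a⁻¹ * (y - sourceDeriv f h a y)).trace := by
  rw [trace_linearization hf ha hfix, trace_linearization hf ha hfix]
  have e1 : (a⁻¹ * y * a⁻¹ * x).trace = (a⁻¹ * x * a⁻¹ * y).trace := by
    rw [Matrix.mul_assoc, Matrix.trace_mul_comm, ← Matrix.mul_assoc]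
  have e2 : (∫ p, f p * ((Real.sqrt (p ⬝ᵥ (a⁻¹ *ᵥ p)) ^ 3)⁻¹ *
        (p ⬝ᵥ ((a⁻¹ * x * a⁻¹) *ᵥ p)) * (p ⬝ᵥ ((a⁻¹ * y * a⁻¹) *ᵥ p)))) =
      ∫ p, f p * ((Real.sqrt (p ⬝ᵥ (a⁻¹ *ᵥ p)) ^ 3)⁻¹ *
        (p ⬝ᵥ ((a⁻¹ * y * a⁻¹) *ᵥ p)) * (p ⬝ᵥ ((a⁻¹ * x * a⁻¹) *ᵥ p))) :=
    integral_congr_ae (Eventually.of_forall fun p => by ring)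
  rw [e1, e2]
  ring

lemma dotProduct_mulVec_comm {b : Mat} (hb : bᵀ = b) (p v : Fin 3 → ℝ) :
    v ⬝ᵥ (b *ᵥ p) = p ⬝ᵥ (b *ᵥ v) := by
  rw [Matrix.dotProduct_mulVec, ← Matrix.mulVec_transpose, hb, dotProduct_comm]

lemma quad_cauchy_schwarz {b : Mat} (hb : b.PosDef) {p : Fin 3 → ℝ} (hp : p ≠ 0) (v : Fin 3 → ℝ) :
    (p ⬝ᵥ (b *ᵥ v)) ^ 2 ≤ (p ⬝ᵥ (b *ᵥ p)) * (v ⬝ᵥ (b *ᵥ v)) := by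
  have hs := quad_pos hb hp
  have hsym := dotProduct_mulVec_comm (transpose_eq_of_posDef hb) p v
  set s := p ⬝ᵥ (b *ᵥ p)
  set t := p ⬝ᵥ (b *ᵥ v)
  have h0 := quad_nonneg hb.posSemidef (t • p - s • v)
  have h1 : (t • p - s • v) ⬝ᵥ (b *ᵥ (t • p - s • v)) = s * (s * (v ⬝ᵥ (b *ᵥ v)) - t ^ 2) := by
    simp only [Matrix.mulVec_sub, Matrix.mulVec_smul, dotProduct_sub, sub_dotProduct,
      dotProduct_smul, smul_dotProduct, smul_eq_mul]
    rw [hsym]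
    change t * (t * s - s * t) - s * (t * t - s * (v ⬝ᵥ (b *ᵥ v))) = _
    ring
  rw [h1] at h0
  linarith [nonneg_of_mul_nonneg_right h0 hs]

lemma AdmissibleData.trace_linearization_pos {f : Mom → ℝ} (hf : AdmissibleData f) {h : Fin 3 → ℝ}
    {a : Mat} (ha : a.PosDef) (hfix : source f h a = a) {x : Mat} (hx : xᵀ = x) (hx0 : x ≠ 0) :
    0 < (a⁻¹ * x * a⁻¹ * (x - sourceDeriv f h a x)).trace := by
  have hd := isUnit_det ha
  have hb := ha.inv
  have hbT := transpose_eq_of_posDef hb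
  have hdpos := ha.det_pos
  have hsq := Real.sqrt_pos.2 hdpos
  rw [trace_linearization hf.toAdmissibleWeight ha hfix]
  have e1 := trace_mul_source hf.toAdmissibleWeight h ha (a⁻¹ * (x * a⁻¹ * x) * a⁻¹)
  rw [hfix, trace_congr_mul hd, mul_congr_mul_self hd] at e1
  set b := a⁻¹ with hbdef
  have e2 : (b * (x * b * x)).trace = (b * x * b * x).trace := by simp only [Matrix.mul_assoc]
  rw [e2] at e1
  set T := (b * x * b * x).trace
  set θ := (b * x).trace
  set D := Real.sqrt a.det
  have hv1 : ∀ p : Mom, p ⬝ᵥ ((b * x * b) *ᵥ p) = p ⬝ᵥ (b *ᵥ ((x * b) *ᵥ p)) := fun p => by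
    rw [Matrix.mul_assoc, ← Matrix.mulVec_mulVec]
  have hv2 : ∀ p : Mom, p ⬝ᵥ ((b * (x * b * x) * b) *ᵥ p) =
      ((x * b) *ᵥ p) ⬝ᵥ (b *ᵥ ((x * b) *ᵥ p)) := fun p => by
    have : b * (x * b * x) * b = (x * b)ᵀ * b * (x * b) := by
      rw [Matrix.transpose_mul, hx, hbT]; simp only [Matrix.mul_assoc]
    rw [this, ← Matrix.mulVec_mulVec, ← Matrix.mulVec_mulVec, Matrix.dotProduct_mulVec,
      Matrix.vecMul_transpose]
  set g : Mom → ℝ := fun p =>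
    2 * ((Real.sqrt (p ⬝ᵥ (b *ᵥ p)))⁻¹ * (p ⬝ᵥ ((b * (x * b * x) * b) *ᵥ p))) -
      (Real.sqrt (p ⬝ᵥ (b *ᵥ p)) ^ 3)⁻¹ * (p ⬝ᵥ ((b * x * b) *ᵥ p)) * (p ⬝ᵥ ((b * x * b) *ᵥ p))
    with hg
  have hlow : ∀ p : Mom, p ≠ 0 → (Real.sqrt (p ⬝ᵥ (b *ᵥ p)))⁻¹ *
      (((x * b) *ᵥ p) ⬝ᵥ (b *ᵥ ((x * b) *ᵥ p))) ≤ g p := by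
    intro p hp
    have h1 := quad_pos hb hp
    have h2 := Real.sqrt_pos.2 h1
    have h3 := quad_cauchy_schwarz hb hp ((x * b) *ᵥ p)
    simp only [hg, hv1, hv2]
    set u := p ⬝ᵥ (b *ᵥ p)
    set r := Real.sqrt u
    have hu : u = r ^ 2 := (Real.sq_sqrt h1.le).symm
    rw [hu] at h3
    set z := ((x * b) *ᵥ p) ⬝ᵥ (b *ᵥ ((x * b) *ᵥ p))
    set t := p ⬝ᵥ (b *ᵥ ((x * b) *ᵥ p))
    have h4 : (r ^ 3)⁻¹ * t * t ≤ r⁻¹ * z := by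
      calc (r ^ 3)⁻¹ * t * t = (r ^ 3)⁻¹ * t ^ 2 := by ring
        _ ≤ (r ^ 3)⁻¹ * (r ^ 2 * z) := by gcongr
        _ = r⁻¹ * z := by field_simp
    linarith
  have hc1 : ContinuousOn (fun p : Mom =>
      (Real.sqrt (p ⬝ᵥ (b *ᵥ p)))⁻¹ * (p ⬝ᵥ ((b * (x * b * x) * b) *ᵥ p))) {0}ᶜ :=
    (continuousOn_inv_sqrt_quad hb).mul (continuous_quad _).continuousOn
  have hc2 : ContinuousOn (fun p : Mom => (Real.sqrt (p ⬝ᵥ (b *ᵥ p)) ^ 3)⁻¹ *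
      (p ⬝ᵥ ((b * x * b) *ᵥ p)) * (p ⬝ᵥ ((b * x * b) *ᵥ p))) {0}ᶜ := by
    refine ((ContinuousOn.inv₀ ((continuous_quad b).sqrt.pow 3).continuousOn fun p hp => ?_).mul
      (continuous_quad _).continuousOn).mul (continuous_quad _).continuousOn
    exact (pow_pos (Real.sqrt_pos.2 (quad_pos hb hp)) 3).ne'
  have hxb : x * b ≠ 0 := fun h0 => hx0 (by
    have := congrArg (· * a) h0
    simpa [Matrix.mul_assoc, hbdef, Matrix.nonsing_inv_mul _ hd] using this)
  obtain ⟨i, hi⟩ : ∃ i, (x * b) i ≠ 0 := by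
    by_contra! h0
    exact hxb (funext h0)
  have hIpos : 0 < ∫ p, f p * g p := by
    refine hf.integral_mul_pos ((hc1.const_mul 2).sub hc2) (fun p hp => ?_) hi fun p hp => ?_
    · exact (mul_nonneg (inv_nonneg.2 (Real.sqrt_nonneg _))
        (quad_nonneg hb.posSemidef _)).trans (hlow p hp)
    · have hp0 : p ≠ 0 := fun h0 => hp (by rw [h0, dotProduct_zero])
      have hv0 : (x * b) *ᵥ p ≠ 0 := fun h0 => hp (congrFun h0 i)
      exact (mul_pos (inv_pos.2 (Real.sqrt_pos.2 (quad_pos hb hp0))) (quad_pos hb hv0)).trans_le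
        (hlow p hp0)
  have hIeq : ∫ p, f p * g p =
      2 * (∫ p, f p * ((Real.sqrt (p ⬝ᵥ (b *ᵥ p)))⁻¹ * (p ⬝ᵥ ((b * (x * b * x) * b) *ᵥ p)))) -
      ∫ p, f p * ((Real.sqrt (p ⬝ᵥ (b *ᵥ p)) ^ 3)⁻¹ *
        (p ⬝ᵥ ((b * x * b) *ᵥ p)) * (p ⬝ᵥ ((b * x * b) *ᵥ p))) := by
    rw [← integral_const_mul,
      ← integral_sub ((hf.integrable_mul hc1).const_mul 2) (hf.integrable_mul hc2)]
    exact integral_congr_ae (Eventually.of_forall fun p => by simp only [hg]; ring)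
  have hmag : 0 ≤ 4 * (h ⬝ᵥ ((x * b * x) *ᵥ h)) - 4 * θ * (h ⬝ᵥ (x *ᵥ h)) +
      θ ^ 2 * (h ⬝ᵥ (a *ᵥ h)) := by
    have h0 := quad_nonneg hb.posSemidef (((2 : ℝ) • x - θ • a) *ᵥ h)
    refine h0.trans (le_of_eq ?_)
    have haT := transpose_eq_of_posDef ha
    have h1 : (((2 : ℝ) • x - θ • a) *ᵥ h) ⬝ᵥ (b *ᵥ (((2 : ℝ) • x - θ • a) *ᵥ h)) =
        h ⬝ᵥ ((((2 : ℝ) • x - θ • a)ᵀ * b * ((2 : ℝ) • x - θ • a)) *ᵥ h) := by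
      rw [← Matrix.mulVec_mulVec, ← Matrix.mulVec_mulVec, Matrix.dotProduct_mulVec h,
        Matrix.vecMul_transpose]
    have h2 : ((2 : ℝ) • x - θ • a)ᵀ * b * ((2 : ℝ) • x - θ • a) =
        (4 : ℝ) • (x * b * x) - (4 * θ) • x + (θ ^ 2) • a := by
      rw [Matrix.transpose_sub, Matrix.transpose_smul, Matrix.transpose_smul, hx, haT]
      have hab : a * b = 1 := Matrix.mul_nonsing_inv _ hd
      have hba : b * a = 1 := Matrix.nonsing_inv_mul _ hd
      simp only [Matrix.sub_mul, Matrix.mul_sub, Matrix.smul_mul, Matrix.mul_smul, hab,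
        Matrix.mul_assoc, hba, Matrix.one_mul, Matrix.mul_one]
      module
    rw [h1, h2]
    simp only [Matrix.add_mulVec, Matrix.sub_mulVec, Matrix.smul_mulVec, dotProduct_add,
      dotProduct_sub, dotProduct_smul, smul_eq_mul]
  have hfinal := mul_pos (div_pos (mul_pos (by norm_num : (0 : ℝ) < 4) Real.pi_pos) hsq) hIpos
  rw [hIeq] at hfinal
  have hmag' := mul_nonneg (inv_nonneg.2 hdpos.le) hmag
  have hθ := sq_nonneg θ
  set I₁ := ∫ p, f p * ((Real.sqrt (p ⬝ᵥ (b *ᵥ p)))⁻¹ * (p ⬝ᵥ ((b * (x * b * x) * b) *ᵥ p)))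
  set I₂ := ∫ p, f p * ((Real.sqrt (p ⬝ᵥ (b *ᵥ p)) ^ 3)⁻¹ *
        (p ⬝ᵥ ((b * x * b) *ᵥ p)) * (p ⬝ᵥ ((b * x * b) *ᵥ p)))
  have e3 : 8 * Real.pi / D * I₁ = 4 * Real.pi / D * (2 * I₁) := by ring
  rw [e3] at e1
  have e4 : T + 1 / 2 * θ * θ - 4 * Real.pi / D * I₂ + a.det⁻¹ * ((h ⬝ᵥ (a *ᵥ h)) * θ * θ
        - 2 * θ * (h ⬝ᵥ (x *ᵥ h)) - 2 * θ * (h ⬝ᵥ (x *ᵥ h)) - 2 * (h ⬝ᵥ (a *ᵥ h)) * T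
        + 4 * (h ⬝ᵥ ((x * b * x) *ᵥ h) + h ⬝ᵥ ((x * b * x) *ᵥ h))) =
      4 * Real.pi / D * (2 * I₁ - I₂) + 1 / 2 * θ ^ 2 + a.det⁻¹ * (4 * (h ⬝ᵥ ((x * b * x) *ᵥ h)) -
        4 * θ * (h ⬝ᵥ (x *ᵥ h)) + θ ^ 2 * (h ⬝ᵥ (a *ᵥ h))) := by
    linear_combination e1
  rw [e4]
  linarith

/-- The space of symmetric tensors. -/
def symMat : Submodule ℝ Mat where
  carrier := {x | xᵀ = x}
  add_mem' := fun {x y} hx hy => by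
    change (x + y)ᵀ = x + y
    rw [Matrix.transpose_add, show xᵀ = x from hx, show yᵀ = y from hy]
  zero_mem' := Matrix.transpose_zero
  smul_mem' := fun c x hx => by
    change (c • x)ᵀ = c • x
    rw [Matrix.transpose_smul, show xᵀ = x from hx]

lemma symMat.transpose_coe (x : symMat) : (x : Mat)ᵀ = x := x.2

/-- The symmetric part of a tensor. -/
noncomputable def symPart : Mat →L[ℝ] symMat :=
  LinearMap.toContinuousLinearMap
    { toFun := fun x => ⟨(1 / 2 : ℝ) • (x + xᵀ), by
        change ((1 / 2 : ℝ) • (x + xᵀ))ᵀ = _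
        rw [Matrix.transpose_smul, Matrix.transpose_add, Matrix.transpose_transpose, add_comm]⟩
      map_add' := fun x y => by
        ext1
        simp only [Submodule.coe_add, Matrix.transpose_add]
        module
      map_smul' := fun c x => by
        ext1
        simp only [Submodule.coe_smul, Matrix.transpose_smul, RingHom.id_apply]
        module }

lemma coe_symPart (x : Mat) : (symPart x : Mat) = (1 / 2 : ℝ) • (x + xᵀ) := rfl

lemma coe_symPart_of_transpose_eq {x : Mat} (hx : xᵀ = x) : (symPart x : Mat) = x := by
  rw [coe_symPart, hx]; module

lemma trace_mul_symPart {c : Mat} (hc : cᵀ = c) (x : Mat) :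
    (c * (symPart x : Mat)).trace = (c * x).trace := by
  have h : (c * xᵀ).trace = (c * x).trace := by
    rw [← Matrix.trace_transpose, Matrix.transpose_mul, Matrix.transpose_transpose, hc,
      Matrix.trace_mul_comm]
  rw [coe_symPart, Matrix.mul_smul, Matrix.mul_add, Matrix.trace_smul, Matrix.trace_add, h,
    smul_eq_mul]
  ring

/-- The rate of change of the rescaled velocity `m`, without the contribution of the cosmological
constant, in logarithmic time. -/
noncomputable def accel (f : Mom → ℝ) (h : Fin 3 → ℝ) (a m : Mat) : Mat :=
  -m - (a⁻¹ * m).trace • a - (2 : ℝ) • (a - source f h a) - (1 / 2 * (a⁻¹ * m).trace) • m +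
    m * a⁻¹ * m

lemma transpose_accel (f : Mom → ℝ) (h : Fin 3 → ℝ) {a m : Mat} (ha : aᵀ = a) (hm : mᵀ = m) :
    (accel f h a m)ᵀ = accel f h a m := by
  simp only [accel, Matrix.transpose_add, Matrix.transpose_sub, Matrix.transpose_smul,
    Matrix.transpose_neg, Matrix.transpose_mul, Matrix.transpose_nonsing_inv, ha, hm,
    transpose_source f h ha, Matrix.mul_assoc]

/-- Pairs of a rescaled metric and its rate of change. -/
abbrev State : Type := symMat × symMat

/-- The evolution equations in logarithmic time, for vanishing cosmological constant. -/
noncomputable def field (f : Mom → ℝ) (h : Fin 3 → ℝ) (w : State) : State :=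
  (w.2, symPart (accel f h w.1 w.2))

/-- The contribution of the cosmological constant to the evolution equations. -/
noncomputable def forcing (Λ : ℝ) : State →L[ℝ] State :=
  ContinuousLinearMap.inr ℝ symMat symMat ∘L ((2 * Λ) • ContinuousLinearMap.fst ℝ symMat symMat)

lemma forcing_apply (Λ : ℝ) (w : State) : forcing Λ w = (0, (2 * Λ) • w.1) := rfl

lemma HasStrictDeriv.prodMk {E F G : Type*} [NormedAddCommGroup E] [NormedSpace ℝ E]
    [NormedAddCommGroup F] [NormedSpace ℝ F] [NormedAddCommGroup G] [NormedSpace ℝ G] {f f' : E → F}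
    {g g' : E → G} {a : E} (hf : HasStrictDeriv f f' a) (hg : HasStrictDeriv g g' a) :
    HasStrictDeriv (fun x => (f x, g x)) (fun x => (f' x, g' x)) a := by
  obtain ⟨L, hL, h⟩ := hf
  obtain ⟨M, hM, k⟩ := hg
  exact ⟨L.prod M, hL.prodMk hM, fun x => by simp [h, k]⟩

lemma hasStrictDeriv_field {f : Mom → ℝ} (hf : AdmissibleWeight f) (h : Fin 3 → ℝ) {a : Mat}
    (ha : a.PosDef) : HasStrictDeriv (field f h)
      (fun w => (w.2, symPart (-(w.2 : Mat) - (a⁻¹ * (w.2 : Mat)).trace • a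
        - (2 : ℝ) • ((w.1 : Mat) - sourceDeriv f h a w.1))))
      (⟨a, transpose_eq_of_posDef ha⟩, 0) := by
  set w₀ : State := (⟨a, transpose_eq_of_posDef ha⟩, 0) with hw₀
  have hd := isUnit_det ha
  have d1 : HasStrictDeriv (fun w : State => (w.1 : Mat)) (fun w => (w.1 : Mat)) w₀ :=
    hasStrictDeriv_clm (symMat.subtypeL ∘L ContinuousLinearMap.fst ℝ symMat symMat) w₀
  have d2 : HasStrictDeriv (fun w : State => (w.2 : Mat)) (fun w => (w.2 : Mat)) w₀ :=
    hasStrictDeriv_clm (symMat.subtypeL ∘L ContinuousLinearMap.snd ℝ symMat symMat) w₀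
  have d2' : HasStrictDeriv (fun w : State => w.2) (fun w => w.2) w₀ :=
    hasStrictDeriv_clm (ContinuousLinearMap.snd ℝ symMat symMat) w₀
  have d3 : HasStrictDeriv (fun w : State => (w.1 : Mat)⁻¹) _ w₀ :=
    HasStrictDeriv.comp (g := fun a : Mat => a⁻¹) (f := fun w : State => (w.1 : Mat))
      (hasStrictDeriv_inv hd) d1
  have d4 : HasStrictDeriv (fun w : State => source f h (w.1 : Mat)) _ w₀ :=
    HasStrictDeriv.comp (g := source f h) (f := fun w : State => (w.1 : Mat))
      (hasStrictDeriv_source hf h ha) d1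
  have d5 := (d3.mul d2).clm_comp traceCLM
  have d6 := ((((d2.neg).sub (d5.smul d1)).sub ((d1.sub d4).const_smul 2)).sub
    ((d5.const_smul (1 / 2)).smul d2)).add ((d2.mul d3).mul d2)
  refine (d2'.prodMk (d6.clm_comp symPart)).congr fun w => ?_
  simp [hw₀]

lemma exists_mul_sq_le {V : Type*} [NormedAddCommGroup V] [NormedSpace ℝ V] [FiniteDimensional ℝ V]
    (B : V →L[ℝ] V →L[ℝ] ℝ) (hB : ∀ x, x ≠ 0 → 0 < B x x) :
    ∃ β > 0, ∀ x, β * ‖x‖ ^ 2 ≤ B x x := by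
  by_cases hV : Subsingleton V
  · exact ⟨1, one_pos, fun x => by simp [Subsingleton.elim x 0]⟩
  rw [not_subsingleton_iff_nontrivial] at hV
  have : ProperSpace V := FiniteDimensional.proper ℝ V
  obtain ⟨x₀, hx₀, hmin⟩ := (isCompact_sphere (0 : V) 1).exists_isMinOn
    (NormedSpace.sphere_nonempty.2 zero_le_one)
    (by fun_prop : Continuous fun x => B x x).continuousOn
  have hx₀' : x₀ ≠ 0 := by
    rintro rfl
    simp at hx₀
  refine ⟨B x₀ x₀, hB x₀ hx₀', fun x => ?_⟩
  by_cases hx : x = 0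
  · simp [hx]
  · have hn : 0 < ‖x‖ := norm_pos_iff.2 hx
    have h1 : B x₀ x₀ ≤ B (‖x‖⁻¹ • x) (‖x‖⁻¹ • x) := hmin (by simp [norm_smul, hn.ne'])
    simp only [map_smul, smul_apply, smul_eq_mul] at h1
    have h2 : ‖x‖⁻¹ * (‖x‖⁻¹ * B x x) = B x x / ‖x‖ ^ 2 := by field_simp
    rw [h2, le_div_iff₀ (by positivity)] at h1
    exact h1

lemma trace_congr_mul_self_pos {b : Mat} (hb : b.PosDef) {x : Mat} (hx : xᵀ = x) (hx0 : x ≠ 0) :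
    0 < (b * x * b * x).trace := by
  obtain ⟨R, hR, rfl⟩ := exists_transpose_mul_self hb
  have hRT : IsUnit (Rᵀ).det := by rwa [Matrix.det_transpose]
  set Y := R * x * Rᵀ with hY
  have hYT : Yᵀ = Y := by
    rw [hY, Matrix.transpose_mul, Matrix.transpose_mul, Matrix.transpose_transpose, hx,
      Matrix.mul_assoc]
  have e1 : (Rᵀ * R * x * (Rᵀ * R) * x).trace = (Yᴴ * Y).trace := by
    rw [Matrix.conjTranspose_eq_transpose_of_trivial, hYT, hY]
    have : Rᵀ * R * x * (Rᵀ * R) * x = Rᵀ * (R * x * Rᵀ * R * x) := by simp only [Matrix.mul_assoc]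
    rw [this, Matrix.trace_mul_comm]
    simp only [Matrix.mul_assoc]
  rw [e1]
  refine lt_of_le_of_ne (Matrix.posSemidef_conjTranspose_mul_self Y).trace_nonneg fun h0 => hx0 ?_
  have h1 := (Matrix.trace_conjTranspose_mul_self_eq_zero_iff).1 h0.symm
  have h2 : R⁻¹ * Y * (Rᵀ)⁻¹ = x := by
    rw [hY, Matrix.mul_assoc R, ← Matrix.mul_assoc R⁻¹, Matrix.nonsing_inv_mul _ hR, Matrix.one_mul,
      Matrix.mul_assoc, Matrix.mul_nonsing_inv _ hRT, Matrix.mul_one]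
  rw [← h2, h1, Matrix.mul_zero, Matrix.zero_mul]

/-- The linearization of the evolution equations at the initial metric is dissipative with respect to
an inner product. -/
theorem AdmissibleData.exists_dissipative {f : Mom → ℝ} (hf : AdmissibleData f) {h : Fin 3 → ℝ}
    {a : Mat} (ha : a.PosDef) (hfix : source f h a = a) :
    ∃ (L : State →L[ℝ] State) (B : State →L[ℝ] State →L[ℝ] ℝ) (β : ℝ),
      HasStrictFDerivAt (field f h) L (⟨a, transpose_eq_of_posDef ha⟩, 0) ∧
      (∀ x y, B x y = B y x) ∧ 0 < β ∧ (∀ x, β * ‖x‖ ^ 2 ≤ B x x) ∧ ∀ x, B x (L x) ≤ 0 := by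
  obtain ⟨L, hL, hLw⟩ := hasStrictDeriv_field hf.toAdmissibleWeight h ha
  obtain ⟨S, -, hS⟩ := hasStrictDeriv_source hf.toAdmissibleWeight h ha
  have hbT := transpose_eq_of_posDef ha.inv
  have hd := isUnit_det ha
  set b := a⁻¹ with hb
  let B : State →L[ℝ] State →L[ℝ] ℝ := LinearMap.toContinuousBilinearMap <| LinearMap.mk₂ ℝ
    (fun w v : State => (b * (w.2 : Mat) * b * (v.2 : Mat)).trace +
      2 * (b * (w.1 : Mat) * b * ((v.1 : Mat) - S v.1)).trace)
    (fun w₁ w₂ v => by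
      simp only [Prod.fst_add, Prod.snd_add, Submodule.coe_add, Matrix.mul_add, Matrix.add_mul,
        Matrix.trace_add]
      ring)
    (fun c w v => by
      simp only [Prod.smul_fst, Prod.smul_snd, Submodule.coe_smul, Matrix.mul_smul, Matrix.smul_mul,
        Matrix.trace_smul, smul_eq_mul]
      ring)
    (fun w v₁ v₂ => by
      simp only [Prod.fst_add, Prod.snd_add, Submodule.coe_add, Matrix.mul_add, Matrix.mul_sub,
        map_add, Matrix.trace_add, Matrix.trace_sub]
      ring)
    (fun c w v => by
      simp only [Prod.smul_fst, Prod.smul_snd, Submodule.coe_smul, Matrix.mul_smul, Matrix.mul_sub,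
        map_smul, Matrix.trace_smul, Matrix.trace_sub, smul_eq_mul]
      ring)
  have hB : ∀ w v : State, B w v = (b * (w.2 : Mat) * b * (v.2 : Mat)).trace +
      2 * (b * (w.1 : Mat) * b * ((v.1 : Mat) - sourceDeriv f h a v.1)).trace := fun w v => by
    rw [← hS]; rfl
  have hBpos : ∀ w, w ≠ 0 → 0 < B w w := by
    intro w hw
    rw [hB]
    have h1 : ∀ x : symMat, x ≠ 0 → (x : Mat) ≠ 0 := fun x hx h0 => hx (Subtype.ext h0)
    by_cases hw1 : w.1 = 0
    · have hw2 : w.2 ≠ 0 := fun h0 => hw (Prod.ext hw1 h0)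
      have := trace_congr_mul_self_pos ha.inv w.2.2 (h1 _ hw2)
      simpa [hw1] using this
    · have e1 := hf.trace_linearization_pos ha hfix w.1.2 (h1 _ hw1)
      by_cases hw2 : w.2 = 0
      · simpa [hw2] using e1
      · have := trace_congr_mul_self_pos ha.inv w.2.2 (h1 _ hw2)
        positivity
  obtain ⟨β, hβ, hβB⟩ := exists_mul_sq_le B hBpos
  refine ⟨L, B, β, hL, fun w v => ?_, hβ, hβB, fun w => ?_⟩
  · rw [hB, hB, trace_linearization_comm hf.toAdmissibleWeight ha hfix, Matrix.mul_assoc,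
      Matrix.trace_mul_comm, ← Matrix.mul_assoc]
  · have hc : (b * (w.2 : Mat) * b)ᵀ = b * (w.2 : Mat) * b := by
      rw [Matrix.transpose_mul, Matrix.transpose_mul, hbT, symMat.transpose_coe, Matrix.mul_assoc]
    rw [hB, hLw, trace_mul_symPart hc, trace_linearization_comm hf.toAdmissibleWeight ha hfix]
    have e1 : 0 ≤ (b * (w.2 : Mat) * b * (w.2 : Mat)).trace := by
      by_cases h0 : (w.2 : Mat) = 0
      · simp [h0]
      · exact (trace_congr_mul_self_pos ha.inv w.2.2 h0).le
    have e2 : (b * (w.2 : Mat) * b * a).trace = (b * (w.2 : Mat)).trace := trace_congr_mul hd _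
    simp only [Matrix.mul_sub, Matrix.mul_neg, Matrix.mul_smul, Matrix.trace_sub, Matrix.trace_neg,
      Matrix.trace_smul, smul_eq_mul, e2]
    nlinarith [mul_self_nonneg (b * (w.2 : Mat)).trace]

lemma hasDerivWithinAt_mat {w : ℝ → Mat} {w' : Mat} {I : Set ℝ} {t : ℝ} :
    HasDerivWithinAt w w' I t ↔ ∀ i j, HasDerivWithinAt (fun s => w s i j) (w' i j) I t := by
  refine ⟨fun hw i j => (entryCLM i j).hasFDerivAt.comp_hasDerivWithinAt t hw, fun hw => ?_⟩
  have h := HasDerivWithinAt.fun_sum (u := Finset.univ) fun i _ =>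
    HasDerivWithinAt.fun_sum (u := Finset.univ) fun j _ =>
      (hw i j).smul_const (Matrix.single i j (1 : ℝ))
  have e : ∀ x : Mat, ∑ i, ∑ j, x i j • Matrix.single i j (1 : ℝ) = x := fun x => by
    conv_rhs => rw [Matrix.matrix_eq_sum_single x]
    simp
  simpa only [e] using h

lemma hasDerivWithinAt_inv_mul {a k : ℝ → Mat} {k₁ : Mat} {I : Set ℝ} {t : ℝ}
    (ha : IsUnit (a t).det) (hda : HasDerivWithinAt a (k t) I t) (hdk : HasDerivWithinAt k k₁ I t) :
    HasDerivWithinAt (fun s => (a s)⁻¹ * k s)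
      ((a t)⁻¹ * k₁ - (a t)⁻¹ * k t * ((a t)⁻¹ * k t)) I t := by
  have h1 := (hasStrictDeriv_inv ha).comp_hasDerivWithinAt hda
  obtain ⟨M, hM, e⟩ := (hasStrictDeriv_clm (ContinuousLinearMap.fst ℝ Mat Mat)
    ((a t)⁻¹, k t)).mul (hasStrictDeriv_clm (ContinuousLinearMap.snd ℝ Mat Mat) ((a t)⁻¹, k t))
  have h2 := hM.hasFDerivAt.comp_hasDerivWithinAt t (h1.prodMk hdk)
  refine h2.congr_deriv ?_
  rw [e]
  simp only [ContinuousLinearMap.coe_fst', ContinuousLinearMap.coe_snd', Matrix.neg_mul]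
  simp only [Matrix.mul_assoc]
  abel

lemma inv_metric {a : ℝ → Mat} {t : ℝ} (ha : IsUnit (a t).det) :
    (metric a t)⁻¹ = Matrix.fromBlocks (-1) 0 0 (a t)⁻¹ := by
  refine Matrix.inv_eq_right_inv ?_
  rw [metric, Matrix.fromBlocks_multiply]
  simp [Matrix.mul_nonsing_inv _ ha, Matrix.fromBlocks_one]

section curvature

variable {I : Set ℝ} {a k : ℝ → Mat} {t : ℝ}

lemma christoffel_time_space_space (ht : UniqueDiffWithinAt ℝ I t) (ha : IsUnit (a t).det)
    (hda : HasDerivWithinAt a (k t) I t) (u : Fin 1) (i j : Fin 3) :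
    christoffel I (metric a) (Sum.inl u) (Sum.inr i) (Sum.inr j) t = 1 / 2 * k t i j := by
  have e := (hasDerivWithinAt_mat.1 hda i j).derivWithin ht
  obtain rfl := Subsingleton.elim u 0
  rw [christoffel, inv_metric ha]
  simp [Fintype.sum_sum_type, pd, metric, e]

lemma christoffel_space_time_space (ht : UniqueDiffWithinAt ℝ I t) (ha : IsUnit (a t).det)
    (hda : HasDerivWithinAt a (k t) I t) (u : Fin 1) (i j : Fin 3) :
    christoffel I (metric a) (Sum.inr i) (Sum.inl u) (Sum.inr j) t =
      1 / 2 * ((a t)⁻¹ * k t) i j := by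
  have e := fun i j => (hasDerivWithinAt_mat.1 hda i j).derivWithin ht
  rw [christoffel, inv_metric ha]
  simp [Fintype.sum_sum_type, pd, metric, e, Matrix.mul_apply]

lemma christoffel_space_space_time (ht : UniqueDiffWithinAt ℝ I t) (ha : IsUnit (a t).det)
    (hda : HasDerivWithinAt a (k t) I t) (u : Fin 1) (i j : Fin 3) :
    christoffel I (metric a) (Sum.inr i) (Sum.inr j) (Sum.inl u) t =
      1 / 2 * ((a t)⁻¹ * k t) i j := by
  have e := fun i j => (hasDerivWithinAt_mat.1 hda i j).derivWithin ht
  rw [christoffel, inv_metric ha]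
  simp [Fintype.sum_sum_type, pd, metric, e, Matrix.mul_apply]

lemma christoffel_space_space_space (ha : IsUnit (a t).det) (i j l : Fin 3) :
    christoffel I (metric a) (Sum.inr i) (Sum.inr j) (Sum.inr l) t = 0 := by
  rw [christoffel, inv_metric ha]
  simp [Fintype.sum_sum_type, pd, metric]

lemma christoffel_space_time_time (i : Fin 3) (u v : Fin 1) :
    christoffel I (metric a) (Sum.inr i) (Sum.inl u) (Sum.inl v) t = 0 := by
  simp [christoffel, Fintype.sum_sum_type, pd, metric]

lemma christoffel_time_time (ha : IsUnit (a t).det) (u v : Fin 1) (μ : Idx) :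
    christoffel I (metric a) (Sum.inl u) (Sum.inl v) μ t = 0 := by
  rw [christoffel, inv_metric ha]
  rcases μ with μ | μ <;> simp [Fintype.sum_sum_type, pd, metric]

lemma christoffel_time_space_time (ha : IsUnit (a t).det) (u v : Fin 1) (i : Fin 3) :
    christoffel I (metric a) (Sum.inl u) (Sum.inr i) (Sum.inl v) t = 0 := by
  rw [christoffel, inv_metric ha]
  simp [Fintype.sum_sum_type, pd, metric]

/-- The values of the Christoffel symbols. -/
noncomputable def christoffelValue (a k : Mat) : Idx → Idx → Idx → ℝ
  | Sum.inl _, Sum.inr i, Sum.inr j => 1 / 2 * k i j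
  | Sum.inr i, Sum.inl _, Sum.inr j => 1 / 2 * (a⁻¹ * k) i j
  | Sum.inr i, Sum.inr j, Sum.inl _ => 1 / 2 * (a⁻¹ * k) i j
  | _, _, _ => 0

lemma christoffel_eq (ht : UniqueDiffWithinAt ℝ I t) (ha : IsUnit (a t).det)
    (hda : HasDerivWithinAt a (k t) I t) (α β γ : Idx) :
    christoffel I (metric a) α β γ t = christoffelValue (a t) (k t) α β γ := by
  rcases α with u | i <;> rcases β with v | j <;> rcases γ with w | l
  · exact christoffel_time_time ha ..
  · exact christoffel_time_time ha ..
  · exact christoffel_time_space_time ha ..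
  · exact christoffel_time_space_space ht ha hda ..
  · exact christoffel_space_time_time ..
  · exact christoffel_space_time_space ht ha hda ..
  · exact christoffel_space_space_time ht ha hda ..
  · exact christoffel_space_space_space ha ..

lemma pd_christoffel (hI : UniqueDiffOn ℝ I) (ha : ∀ t ∈ I, IsUnit (a t).det)
    (hda : ∀ t ∈ I, HasDerivWithinAt a (k t) I t) (ht : t ∈ I) (u : Fin 1) (α β γ : Idx) {c : ℝ}
    (hc : HasDerivWithinAt (fun s => christoffelValue (a s) (k s) α β γ) c I t) :
    pd I (Sum.inl u) (christoffel I (metric a) α β γ) t = c := by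
  change derivWithin _ I t = c
  refine (hc.congr (fun s hs => ?_) ?_).derivWithin (hI t ht)
  · exact christoffel_eq (hI s hs) (ha s hs) (hda s hs) ..
  · exact christoffel_eq (hI t ht) (ha t ht) (hda t ht) ..

lemma ricci_time_time (hI : UniqueDiffOn ℝ I) (ha : ∀ t ∈ I, IsUnit (a t).det)
    (hda : ∀ t ∈ I, HasDerivWithinAt a (k t) I t) (ht : t ∈ I) {k₁ : Mat}
    (hdk : HasDerivWithinAt k k₁ I t) (u v : Fin 1) :
    ricci I (metric a) (Sum.inl u) (Sum.inl v) t = -(1 / 2) * ((a t)⁻¹ * k₁).trace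
      + 1 / 4 * ((a t)⁻¹ * k t * ((a t)⁻¹ * k t)).trace := by
  have h0 := pd_christoffel hI ha hda ht 0 (Sum.inl 0) (Sum.inl u) (Sum.inl v)
    (hasDerivWithinAt_const t I 0)
  have hK := hasDerivWithinAt_mat.1 (hasDerivWithinAt_inv_mul (ha t ht) (hda t ht) hdk)
  have h2 := fun i : Fin 3 => pd_christoffel hI ha hda ht u (Sum.inr i) (Sum.inr i) (Sum.inl v)
    ((hK i i).const_mul (1 / 2))
  have e := christoffel_eq (hI t ht) (ha t ht) (hda t ht)
  obtain rfl := Subsingleton.elim u 0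
  obtain rfl := Subsingleton.elim v 0
  simp only [ricci, Fintype.sum_sum_type, Fintype.sum_unique, Fin.default_eq_zero, h0, h2, e,
    christoffelValue]
  generalize (a t)⁻¹ * k t = K
  generalize (a t)⁻¹ * k₁ = K₁
  simp only [pd, Matrix.trace, Matrix.diag, Matrix.mul_apply, Fin.sum_univ_three, Matrix.sub_apply]
  ring

lemma ricci_time_space (hI : UniqueDiffOn ℝ I) (ha : ∀ t ∈ I, IsUnit (a t).det)
    (hda : ∀ t ∈ I, HasDerivWithinAt a (k t) I t) (ht : t ∈ I) (u : Fin 1) (i : Fin 3) :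
    ricci I (metric a) (Sum.inl u) (Sum.inr i) t = 0 ∧
      ricci I (metric a) (Sum.inr i) (Sum.inl u) t = 0 := by
  have h0 := fun α β γ (h : ∀ s, christoffelValue (a s) (k s) α β γ = 0) =>
    pd_christoffel hI ha hda ht 0 α β γ
    ((hasDerivWithinAt_const t I 0).congr_of_eventuallyEq (Eventually.of_forall h) (h t))
  have h1 := h0 (Sum.inl 0) (Sum.inl u) (Sum.inr i) fun _ => rfl
  have h2 := h0 (Sum.inl 0) (Sum.inr i) (Sum.inl u) fun _ => rfl
  have h4 := fun j => h0 (Sum.inr j) (Sum.inr j) (Sum.inr i) fun _ => rfl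
  have e := christoffel_eq (hI t ht) (ha t ht) (hda t ht)
  obtain rfl := Subsingleton.elim u 0
  constructor <;>
  simp [ricci, Fintype.sum_sum_type, h1, h2, h4, e, christoffelValue] <;> simp [pd]

lemma ricci_space_space (hI : UniqueDiffOn ℝ I) (ha : ∀ t ∈ I, IsUnit (a t).det)
    (hda : ∀ t ∈ I, HasDerivWithinAt a (k t) I t) (ht : t ∈ I) {k₁ : Mat}
    (hdk : HasDerivWithinAt k k₁ I t) (haT : (a t)ᵀ = a t) (hkT : (k t)ᵀ = k t) (i j : Fin 3) :
    ricci I (metric a) (Sum.inr i) (Sum.inr j) t = 1 / 2 * k₁ i j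
      + 1 / 4 * ((a t)⁻¹ * k t).trace * k t i j - 1 / 2 * (k t * (a t)⁻¹ * k t) i j := by
  have h0 := pd_christoffel hI ha hda ht 0 (Sum.inl 0) (Sum.inr i) (Sum.inr j)
    ((hasDerivWithinAt_mat.1 hdk i j).const_mul (1 / 2))
  have e := christoffel_eq (hI t ht) (ha t ht) (hda t ht)
  simp only [ricci, Fintype.sum_sum_type, Fintype.sum_unique, Fin.default_eq_zero, h0, e,
    christoffelValue]
  have hs : (k t * ((a t)⁻¹ * k t)) j i = (k t * ((a t)⁻¹ * k t)) i j := by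
    have hT : (k t * ((a t)⁻¹ * k t))ᵀ = k t * ((a t)⁻¹ * k t) := by
      simp only [Matrix.transpose_mul, Matrix.transpose_nonsing_inv, haT, hkT, Matrix.mul_assoc]
    exact congrFun (congrFun hT i) j
  have hk : ∀ i j, k t i j = k t j i := fun i j => congrFun (congrFun hkT j) i
  rw [Matrix.mul_assoc]
  generalize (a t)⁻¹ * k t = K at *
  simp only [Matrix.mul_apply, Fin.sum_univ_three] at hs
  simp only [pd, Matrix.trace, Matrix.diag, Matrix.mul_apply, Fin.sum_univ_three]
  linear_combination (-1 / 4) * hs - 1 / 4 * (K 0 i * hk 0 j + K 1 i * hk 1 j + K 2 i * hk 2 j)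
    - 1 / 4 * (K 0 j * hk 0 i + K 1 j * hk 1 i + K 2 j * hk 2 i)

end curvature

/-- Source-free Maxwell equations hold in every Bianchi I space-time. -/
lemma maxwell_of_metric {I : Set ℝ} {a k : ℝ → Mat} {t : ℝ} (ht : UniqueDiffWithinAt ℝ I t)
    (ha : IsUnit (a t).det) (hda : HasDerivWithinAt a (k t) I t) (haT : (a t)ᵀ = a t)
    (hkT : (k t)ᵀ = k t) (h : Fin 3 → ℝ) (β : Idx) :
    ∑ γ, ∑ α, (metric a t)⁻¹ γ α * covDeriv I (metric a) (faraday h) γ α β t = 0 := by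
  have e := christoffel_eq ht ha hda
  have hbT : ((a t)⁻¹)ᵀ = (a t)⁻¹ := by rw [Matrix.transpose_nonsing_inv, haT]
  have hbk : ((a t)⁻¹ * k t * (a t)⁻¹)ᵀ = (a t)⁻¹ * k t * (a t)⁻¹ := by
    simp only [Matrix.transpose_mul, hbT, hkT, Matrix.mul_assoc]
  rw [inv_metric ha]
  simp only [covDeriv, e, Fintype.sum_sum_type, Fintype.sum_unique, Fin.default_eq_zero, faraday,
    Matrix.fromBlocks_apply₁₁, Matrix.fromBlocks_apply₁₂, Matrix.fromBlocks_apply₂₁,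
    Matrix.fromBlocks_apply₂₂, christoffelValue]
  rcases β with u | j
  · obtain rfl := Subsingleton.elim u 0
    generalize (a t)⁻¹ * k t = K at hbk
    have hs := fun i j => congrFun (congrFun hbk i) j
    have h01 := hs 0 1
    have h02 := hs 0 2
    have h12 := hs 1 2
    simp only [Matrix.transpose_apply, Matrix.mul_apply, Fin.sum_univ_three] at h01 h02 h12
    simp [Fin.sum_univ_three]
    linear_combination (1 / 2 * h 1) * h02 - (1 / 2 * h 2) * h01 - (1 / 2 * h 0) * h12
  · simp

/-- The spatial part of the electromagnetic field tensor. -/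
def crossMat (h : Fin 3 → ℝ) : Mat := !![0, h 2, -h 1; -h 2, 0, h 0; h 1, -h 0, 0]

lemma crossMat_mul_inv_mul (h : Fin 3 → ℝ) {a : Mat} (ha : aᵀ = a) :
    crossMat h * a⁻¹ * (crossMat h)ᵀ =
      a.det⁻¹ • ((h ⬝ᵥ (a *ᵥ h)) • a - a * Matrix.vecMulVec h h * a) := by
  rw [Matrix.inv_def, Matrix.mul_smul, Matrix.smul_mul, Ring.inverse_eq_inv']
  congr 1
  have e := fun i j => congrFun (congrFun ha i) j
  simp only [Matrix.transpose_apply] at e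
  have e10 := e 0 1
  have e20 := e 0 2
  have e21 := e 1 2
  rw [Matrix.adjugate_fin_three]
  ext i j
  fin_cases i <;> fin_cases j <;>
  · simp [crossMat, Matrix.mul_apply, Fin.sum_univ_three, Matrix.vecMulVec_apply, dotProduct,
      Matrix.mulVec, e10, e20, e21]
    ring

lemma sum_mul_mul_mul_eq_trace (b F : Mat) (hb : bᵀ = b) :
    ∑ γ, ∑ δ, ∑ l, ∑ m, b γ δ * b l m * F γ l * F δ m = (b * (F * b * Fᵀ)).trace := by
  conv_rhs => rw [← hb]
  rw [hb]
  conv_rhs => enter [1, 1]; rw [← hb]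
  simp only [Matrix.trace, Matrix.diag, Matrix.mul_apply, Fin.sum_univ_three,
    Matrix.transpose_apply]
  ring

lemma stressMax_contraction {a : Mat} (ha : IsUnit a.det) (haT : aᵀ = a) (h : Fin 3 → ℝ) :
    ∑ γ, ∑ δ, ∑ l, ∑ m, a⁻¹ γ δ * a⁻¹ l m * crossMat h γ l * crossMat h δ m =
      a.det⁻¹ * (2 * (h ⬝ᵥ (a *ᵥ h))) := by
  rw [sum_mul_mul_mul_eq_trace _ _ (by rw [Matrix.transpose_nonsing_inv, haT]),
    crossMat_mul_inv_mul h haT, Matrix.mul_smul, Matrix.trace_smul, Matrix.mul_sub,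
    Matrix.mul_smul, Matrix.trace_sub, Matrix.trace_smul, trace_mul_mul_vecMulVec_mul,
    Matrix.nonsing_inv_mul _ ha, Matrix.mul_nonsing_inv _ ha, Matrix.one_mul, Matrix.trace_one]
  simp only [smul_eq_mul, Fintype.card_fin]
  push_cast
  ring

lemma eight_pi_mul_stressMax {a : ℝ → Mat} {t : ℝ} (ha : IsUnit (a t).det) (haT : (a t)ᵀ = a t)
    (h : Fin 3 → ℝ) (i j : Fin 3) :
    8 * Real.pi * stressMax (metric a t) (faraday h) (Sum.inr i) (Sum.inr j) =
      ((a t).det)⁻¹ * magneticForm h (a t) i j := by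
  have e1 : ∑ γ, ∑ δ, (a t)⁻¹ γ δ * crossMat h i δ * crossMat h j γ =
      ((a t).det)⁻¹ * ((h ⬝ᵥ (a t *ᵥ h)) * a t i j - (a t * Matrix.vecMulVec h h * a t) i j) := by
    have h1 := congrFun (congrFun (crossMat_mul_inv_mul h haT) i) j
    simp only [Matrix.smul_apply, Matrix.sub_apply, smul_eq_mul] at h1
    rw [← h1]
    conv_rhs => rw [← haT, ← Matrix.transpose_nonsing_inv]
    simp only [Matrix.mul_apply, Fin.sum_univ_three, Matrix.transpose_apply]
    ring
  rw [stressMax, inv_metric ha]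
  have hF : faraday h = Matrix.fromBlocks 0 0 0 (crossMat h) := rfl
  simp only [hF, Fintype.sum_sum_type, metric, Matrix.fromBlocks_apply₁₁,
    Matrix.fromBlocks_apply₁₂, Matrix.fromBlocks_apply₂₁, Matrix.fromBlocks_apply₂₂,
    Matrix.zero_apply, mul_zero, zero_mul, Finset.sum_const_zero, zero_add, add_zero, e1,
    stressMax_contraction ha haT, magneticForm, Matrix.sub_apply, Matrix.smul_apply, smul_eq_mul]
  field_simp
  ring

lemma stressMax_time_space {a : ℝ → Mat} {t : ℝ} (ha : IsUnit (a t).det) (h : Fin 3 → ℝ)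
    (u : Fin 1) (i : Fin 3) : stressMax (metric a t) (faraday h) (Sum.inl u) (Sum.inr i) = 0 ∧
      stressMax (metric a t) (faraday h) (Sum.inr i) (Sum.inl u) = 0 := by
  rw [stressMax, stressMax, inv_metric ha]
  constructor <;> simp [Fintype.sum_sum_type, metric, faraday]

lemma eight_pi_mul_stressMax_time {a : ℝ → Mat} {t : ℝ} (ha : IsUnit (a t).det) (haT : (a t)ᵀ = a t)
    (h : Fin 3 → ℝ) (u v : Fin 1) :
    8 * Real.pi * stressMax (metric a t) (faraday h) (Sum.inl u) (Sum.inl v) =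
      ((a t).det)⁻¹ * (2 * (h ⬝ᵥ (a t *ᵥ h))) := by
  rw [stressMax, inv_metric ha]
  have hF : faraday h = Matrix.fromBlocks 0 0 0 (crossMat h) := rfl
  obtain rfl := Subsingleton.elim u 0
  obtain rfl := Subsingleton.elim v 0
  simp only [hF, Fintype.sum_sum_type, metric, Matrix.fromBlocks_apply₁₁,
    Matrix.fromBlocks_apply₁₂, Matrix.fromBlocks_apply₂₁, Matrix.fromBlocks_apply₂₂,
    Matrix.zero_apply, mul_zero, zero_mul, Finset.sum_const_zero, zero_add, add_zero,
    stressMax_contraction ha haT, Matrix.neg_apply, Matrix.one_apply_eq]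
  field_simp
  ring

section stress

variable {f g : Mom → ℝ} {a : Mat}

lemma sq_sqrt_quad {b : Mat} (hb : b.PosDef) (p : Mom) :
    Real.sqrt (p ⬝ᵥ (b *ᵥ p)) * Real.sqrt (p ⬝ᵥ (b *ᵥ p)) = p ⬝ᵥ (b *ᵥ p) :=
  Real.mul_self_sqrt (quad_nonneg hb.posSemidef p)

lemma stressKin_space (hg : g =ᵐ[volume] f) (i j : Fin 3) :
    stressKin a g (Sum.inr i) (Sum.inr j) = (Real.sqrt a.det)⁻¹ * kineticForm f a⁻¹ i j := by
  rw [stressKin, kineticForm, moment_apply, ← integral_const_mul]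
  refine integral_congr_ae ?_
  filter_upwards [hg] with p hp
  simp only [hp, nullCovector, energy, Sum.elim_inr, div_eq_mul_inv, mul_inv]
  ring

lemma stressKin_time_space (hf : AdmissibleWeight f) (ha : a.PosDef)
    (hmom : ∀ i, ∫ p : Mom, f p * p i = 0) (hg : g =ᵐ[volume] f) (u : Fin 1) (i : Fin 3) :
    stressKin a g (Sum.inl u) (Sum.inr i) = 0 ∧ stressKin a g (Sum.inr i) (Sum.inl u) = 0 := by
  have h0 : stressKin a g (Sum.inl u) (Sum.inr i) =
      ∫ p : Mom, -(Real.sqrt a.det)⁻¹ * (f p * p i) := by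
    refine integral_congr_ae ?_
    filter_upwards [hg] with p hp
    by_cases h : p = 0
    · have : f p = 0 := by rw [h]; exact image_eq_zero_of_notMem_tsupport hf.zero_notMem
      simp [hp, this]
    · have hE : energy a p ≠ 0 := (Real.sqrt_pos.2 (quad_pos ha.inv h)).ne'
      simp only [hp, nullCovector, Sum.elim_inl, Sum.elim_inr]
      field_simp
  have h1 : stressKin a g (Sum.inr i) (Sum.inl u) = stressKin a g (Sum.inl u) (Sum.inr i) :=
    integral_congr_ae (Eventually.of_forall fun p => by simp only [mul_right_comm])
  rw [h1, and_self, h0, integral_const_mul, hmom, mul_zero]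

lemma stressKin_time (ha : a.PosDef) (hg : g =ᵐ[volume] f) (u v : Fin 1) :
    stressKin a g (Sum.inl u) (Sum.inl v) = (Real.sqrt a.det)⁻¹ *
      ∫ p, f p * ((Real.sqrt (p ⬝ᵥ (a⁻¹ *ᵥ p)))⁻¹ * (p ⬝ᵥ (a⁻¹ *ᵥ p))) := by
  rw [stressKin, ← integral_const_mul]
  refine integral_congr_ae ?_
  filter_upwards [hg] with p hp
  simp only [hp, nullCovector, energy, Sum.elim_inl, div_eq_mul_inv, mul_inv]
  have e := sq_sqrt_quad ha.inv p
  generalize Real.sqrt (p ⬝ᵥ (a⁻¹ *ᵥ p)) = E at *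
  rw [← e]
  ring

lemma trace_inv_mul_source (hf : AdmissibleWeight f) (h : Fin 3 → ℝ) (ha : a.PosDef) :
    (a⁻¹ * source f h a).trace = 8 * Real.pi / Real.sqrt a.det *
        (∫ p, f p * ((Real.sqrt (p ⬝ᵥ (a⁻¹ *ᵥ p)))⁻¹ * (p ⬝ᵥ (a⁻¹ *ᵥ p)))) +
      a.det⁻¹ * (2 * (h ⬝ᵥ (a *ᵥ h))) := by
  rw [trace_mul_source hf h ha, Matrix.nonsing_inv_mul _ (isUnit_det ha),
    Matrix.mul_nonsing_inv _ (isUnit_det ha), Matrix.one_mul, Matrix.trace_one]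
  simp only [Fintype.card_fin]
  push_cast
  ring

end stress

lemma source_apply (f : Mom → ℝ) (h : Fin 3 → ℝ) (a : Mat) (i j : Fin 3) :
    source f h a i j = 8 * Real.pi * ((Real.sqrt a.det)⁻¹ * kineticForm f a⁻¹ i j) +
      a.det⁻¹ * magneticForm h a i j := by
  simp only [source, Matrix.add_apply, Matrix.smul_apply, smul_eq_mul]
  ring

lemma source_smul (f : Mom → ℝ) (h : Fin 3 → ℝ) {a : Mat} (ha : a.PosDef) {c : ℝ} (hc : 0 < c) :
    source f h (c • a) = c⁻¹ • source f h a := by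
  have hdet : (c • a).det = c ^ 3 * a.det := by simp
  have hinv : (c • a)⁻¹ = c⁻¹ • a⁻¹ := Matrix.inv_smul' a (Units.mk0 c hc.ne') (isUnit_det ha)
  have hkin : kineticForm f (c⁻¹ • a⁻¹) = Real.sqrt c • kineticForm f a⁻¹ := by
    ext i j
    rw [Matrix.smul_apply, kineticForm, kineticForm, moment_apply, moment_apply, smul_eq_mul,
      ← integral_const_mul]
    refine integral_congr_ae (Eventually.of_forall fun p => ?_)
    simp only [Matrix.smul_mulVec, dotProduct_smul, smul_eq_mul]
    rw [Real.sqrt_mul (inv_pos.2 hc).le, Real.sqrt_inv, mul_inv, inv_inv]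
    ring
  have hmag : magneticForm h (c • a) = c ^ 2 • magneticForm h a := by
    simp only [magneticForm, Matrix.smul_mulVec, dotProduct_smul, Matrix.smul_mul, Matrix.mul_smul,
      smul_sub, smul_smul, smul_eq_mul]
    congr 2 <;> ring
  have hs : Real.sqrt (c ^ 3 * a.det) = c * Real.sqrt c * Real.sqrt a.det := by
    rw [Real.sqrt_mul (by positivity), pow_succ, Real.sqrt_mul (by positivity),
      Real.sqrt_sq hc.le]
  have hd := ha.det_pos
  have h1 := Real.sqrt_pos.2 hd
  have h2 := Real.sqrt_pos.2 hc
  rw [source, source, hdet, hinv, hkin, hmag, hs, smul_add, smul_smul, smul_smul, smul_smul,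
    smul_smul]
  congr 2
  · field_simp
  · field_simp

lemma trace_inv_mul_sourceDeriv {f : Mom → ℝ} (hf : AdmissibleWeight f) (h : Fin 3 → ℝ) {a : Mat}
    (ha : a.PosDef) (x : Mat) : (a⁻¹ * sourceDeriv f h a x).trace =
      -(1 / 2) * (a⁻¹ * x).trace * (a⁻¹ * source f h a).trace +
        1 / 2 * (a⁻¹ * x * a⁻¹ * source f h a).trace := by
  have hd := isUnit_det ha
  have e1 : a⁻¹ * a * a⁻¹ = a⁻¹ := by rw [Matrix.nonsing_inv_mul _ hd, Matrix.one_mul]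
  have h0 := trace_congr_mul_sourceDeriv hf h ha x a
  rw [e1, trace_mul_kineticForm hf ha.inv, Matrix.nonsing_inv_mul _ hd,
    Matrix.mul_nonsing_inv _ hd, Matrix.trace_one, Matrix.one_mul,
    Matrix.mul_assoc x, Matrix.nonsing_inv_mul _ hd, Matrix.mul_one, Fintype.card_fin] at h0
  rw [h0, trace_inv_mul_source hf h ha, trace_mul_source hf h ha, mul_congr_mul_self hd,
    trace_congr_mul hd]
  have e2 : ∫ p, f p * ((Real.sqrt (p ⬝ᵥ (a⁻¹ *ᵥ p)) ^ 3)⁻¹ *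
        (p ⬝ᵥ ((a⁻¹ * x * a⁻¹) *ᵥ p)) * (p ⬝ᵥ (a⁻¹ *ᵥ p))) =
      ∫ p, f p * ((Real.sqrt (p ⬝ᵥ (a⁻¹ *ᵥ p)))⁻¹ * (p ⬝ᵥ ((a⁻¹ * x * a⁻¹) *ᵥ p))) := by
    refine integral_congr_ae (Eventually.of_forall fun p => ?_)
    change f p * _ = f p * _
    by_cases hp : p = 0
    · simp [hp]
    · have hE := Real.sqrt_pos.2 (quad_pos ha.inv hp)
      rw [← sq_sqrt_quad ha.inv p]
      rw [Real.sqrt_mul_self hE.le]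
      field_simp
  rw [e2]
  push_cast
  ring

lemma stress_space {f g : Mom → ℝ} {a : ℝ → Mat} {t : ℝ} (ha : (a t).PosDef)
    (hg : g =ᵐ[volume] f) (h : Fin 3 → ℝ) (i j : Fin 3) :
    8 * Real.pi * (stressMax (metric a t) (faraday h) (Sum.inr i) (Sum.inr j) +
      stressKin (a t) g (Sum.inr i) (Sum.inr j)) = source f h (a t) i j := by
  rw [mul_add, eight_pi_mul_stressMax (isUnit_det ha) (transpose_eq_of_posDef ha),
    stressKin_space hg, source_apply, add_comm]

lemma stress_time_space {f g : Mom → ℝ} (hf : AdmissibleWeight f) {a : ℝ → Mat} {t : ℝ}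
    (ha : (a t).PosDef) (hmom : ∀ i, ∫ p : Mom, f p * p i = 0) (hg : g =ᵐ[volume] f)
    (h : Fin 3 → ℝ) (u : Fin 1) (i : Fin 3) :
    8 * Real.pi * (stressMax (metric a t) (faraday h) (Sum.inl u) (Sum.inr i) +
      stressKin (a t) g (Sum.inl u) (Sum.inr i)) = 0 ∧
    8 * Real.pi * (stressMax (metric a t) (faraday h) (Sum.inr i) (Sum.inl u) +
      stressKin (a t) g (Sum.inr i) (Sum.inl u)) = 0 := by
  obtain ⟨e1, e2⟩ := stressMax_time_space (isUnit_det ha) h u i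
  obtain ⟨e3, e4⟩ := stressKin_time_space hf ha hmom hg u i
  rw [e1, e2, e3, e4]
  simp

lemma stress_time {f g : Mom → ℝ} (hf : AdmissibleWeight f) {a : ℝ → Mat} {t : ℝ}
    (ha : (a t).PosDef) (hg : g =ᵐ[volume] f) (h : Fin 3 → ℝ) (u v : Fin 1) :
    8 * Real.pi * (stressMax (metric a t) (faraday h) (Sum.inl u) (Sum.inl v) +
      stressKin (a t) g (Sum.inl u) (Sum.inl v)) = ((a t)⁻¹ * source f h (a t)).trace := by
  rw [mul_add, eight_pi_mul_stressMax_time (isUnit_det ha) (transpose_eq_of_posDef ha),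
    stressKin_time ha hg, trace_inv_mul_source hf h ha]
  ring

/-- The evolution equations in the rescaled variables. -/
lemma evolution_iff (f : Mom → ℝ) (h : Fin 3 → ℝ) {α : Mat} (hα : α.PosDef) (m k₁ : Mat) (Λ : ℝ)
    {c : ℝ} (hc : 0 < c) :
    ((1 / 2 : ℝ) • k₁ + (1 / 4 * ((c • α)⁻¹ * ((2 : ℝ) • α + m)).trace) • ((2 : ℝ) • α + m)
        - (1 / 2 : ℝ) • (((2 : ℝ) • α + m) * (c • α)⁻¹ * ((2 : ℝ) • α + m))
        = source f h (c • α) + Λ • (c • α)) ↔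
      c • k₁ - (2 : ℝ) • m = accel f h α m + (2 * Λ * c ^ 2) • α := by
  have hd := isUnit_det hα
  have hinv : (c • α)⁻¹ = c⁻¹ • α⁻¹ := Matrix.inv_smul' α (Units.mk0 c hc.ne') hd
  have e1 : (α⁻¹ * ((2 : ℝ) • α + m)).trace = 6 + (α⁻¹ * m).trace := by
    rw [Matrix.mul_add, Matrix.mul_smul, Matrix.nonsing_inv_mul _ hd, Matrix.trace_add,
      Matrix.trace_smul, Matrix.trace_one]
    norm_num
  have e2 : ((2 : ℝ) • α + m) * α⁻¹ * ((2 : ℝ) • α + m) =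
      (4 : ℝ) • α + (4 : ℝ) • m + m * α⁻¹ * m := by
    rw [Matrix.add_mul, Matrix.smul_mul, Matrix.mul_nonsing_inv _ hd, Matrix.add_mul,
      Matrix.mul_add, Matrix.mul_add, Matrix.mul_assoc m α⁻¹ ((2 : ℝ) • α), Matrix.mul_smul α⁻¹,
      Matrix.nonsing_inv_mul _ hd]
    simp only [Matrix.smul_mul, Matrix.mul_smul, Matrix.one_mul, Matrix.mul_one]
    module
  have hS := source_smul f h hα hc
  rw [hinv, hS, Matrix.smul_mul, Matrix.trace_smul, e1, Matrix.mul_smul, Matrix.smul_mul, e2, accel,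
    smul_eq_mul]
  generalize source f h α = S
  generalize (α⁻¹ * m).trace = θ
  generalize m * α⁻¹ * m = q
  rw [← sub_eq_zero, ← sub_eq_zero (b := _ + _ • α)]
  have hc2 : (c • k₁ - (2 : ℝ) • m - (-m - θ • α - (2 : ℝ) • (α - S) - (1 / 2 * θ) • m + q +
      (2 * Λ * c ^ 2) • α)) = (2 * c) • ((1 / 2 : ℝ) • k₁ + (1 / 4 * (c⁻¹ * (6 + θ))) •
      ((2 : ℝ) • α + m) - (1 / 2 : ℝ) • c⁻¹ • ((4 : ℝ) • α + (4 : ℝ) • m + q) -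
      (c⁻¹ • S + Λ • c • α)) := by
    ext i j
    simp only [Matrix.sub_apply, Matrix.add_apply, Matrix.smul_apply, smul_eq_mul, Matrix.neg_apply]
    field_simp
    ring
  rw [hc2, smul_eq_zero_iff_right (by positivity)]

/-- The Hamiltonian constraint in the rescaled variables. -/
noncomputable def constraint (f : Mom → ℝ) (h : Fin 3 → ℝ) (α m : Mat) (l : ℝ) : ℝ :=
  24 + 8 * (α⁻¹ * m).trace + (α⁻¹ * m).trace ^ 2 - (α⁻¹ * m * (α⁻¹ * m)).trace
    - 8 * (α⁻¹ * source f h α).trace - 8 * l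

lemma hamiltonian_of_constraint (f : Mom → ℝ) (h : Fin 3 → ℝ) {α : Mat} (hα : α.PosDef)
    {m k₁ : Mat} {Λ c : ℝ} (hc : 0 < c)
    (hev : c • k₁ - (2 : ℝ) • m = accel f h α m + (2 * Λ * c ^ 2) • α)
    (hC : constraint f h α m (Λ * c ^ 2) = 0) :
    -(1 / 2) * ((c • α)⁻¹ * k₁).trace + 1 / 4 * ((c • α)⁻¹ * ((2 : ℝ) • α + m) *
      ((c • α)⁻¹ * ((2 : ℝ) • α + m))).trace =
      ((c • α)⁻¹ * source f h (c • α)).trace - Λ := by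
  have hd := isUnit_det hα
  have hinv : (c • α)⁻¹ = c⁻¹ • α⁻¹ := Matrix.inv_smul' α (Units.mk0 c hc.ne') hd
  have e0 : α⁻¹ * ((2 : ℝ) • α + m) = (2 : ℝ) • 1 + α⁻¹ * m := by
    rw [Matrix.mul_add, Matrix.mul_smul, Matrix.nonsing_inv_mul _ hd]
  have e1 := congrArg (fun x => (α⁻¹ * x).trace) hev
  simp only [accel, Matrix.mul_sub, Matrix.mul_add, Matrix.mul_smul, Matrix.mul_neg,
    Matrix.trace_sub, Matrix.trace_add, Matrix.trace_smul, Matrix.trace_neg, smul_eq_mul,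
    Matrix.nonsing_inv_mul _ hd, Matrix.trace_one, Fintype.card_fin, ← Matrix.mul_assoc] at e1
  rw [hinv, source_smul f h hα hc, Matrix.smul_mul, Matrix.trace_smul, Matrix.smul_mul, e0,
    Matrix.smul_mul, Matrix.mul_smul, Matrix.smul_mul, Matrix.mul_smul, Matrix.trace_smul,
    Matrix.trace_smul, Matrix.trace_smul, Matrix.trace_smul]
  simp only [constraint, ← Matrix.mul_assoc] at hC
  simp only [Matrix.mul_add, Matrix.add_mul, Matrix.smul_mul, Matrix.mul_smul, Matrix.trace_add,
    Matrix.trace_smul, Matrix.one_mul, Matrix.mul_one, Matrix.trace_one, Fintype.card_fin,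
    smul_eq_mul, ← Matrix.mul_assoc]
  generalize (α⁻¹ * source f h α).trace = ρ at *
  generalize (α⁻¹ * m).trace = θ at *
  generalize (α⁻¹ * m * α⁻¹ * m).trace = q at *
  push_cast at *
  field_simp
  linear_combination (-4 : ℝ) * e1 + 2 * hC

lemma HasDerivWithinAt.matMul {x y : ℝ → Mat} {x' y' : Mat} {I : Set ℝ} {s : ℝ}
    (hx : HasDerivWithinAt x x' I s) (hy : HasDerivWithinAt y y' I s) :
    HasDerivWithinAt (fun s => x s * y s) (x' * y s + x s * y') I s :=
  (((hasStrictDeriv_clm (ContinuousLinearMap.fst ℝ Mat Mat) (x s, y s)).mul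
    (hasStrictDeriv_clm (ContinuousLinearMap.snd ℝ Mat Mat) (x s, y s))).comp_hasDerivWithinAt
    (hx.prodMk hy) :)

lemma hasDerivWithinAt_constraint {f : Mom → ℝ} (hf : AdmissibleWeight f) (h : Fin 3 → ℝ)
    {α m : ℝ → Mat} {I : Set ℝ} {s Λ : ℝ} (hα : (α s).PosDef)
    (hdα : HasDerivWithinAt α (m s) I s)
    (hdm : HasDerivWithinAt m
      (accel f h (α s) (m s) + (2 * Λ * Real.exp (2 * s) ^ 2) • α s) I s) :
    HasDerivWithinAt (fun s => constraint f h (α s) (m s) (Λ * Real.exp (2 * s) ^ 2))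
      (-(2 + ((α s)⁻¹ * m s).trace) * constraint f h (α s) (m s) (Λ * Real.exp (2 * s) ^ 2)) I s := by
  have hd := isUnit_det hα
  have hN := hasDerivWithinAt_inv_mul hd hdα hdm
  have hρ := ((hasStrictDeriv_inv hd).mul (hasStrictDeriv_source hf h hα)).comp_hasDerivWithinAt hdα
  have hN2 := HasDerivWithinAt.matMul hN hN
  have hθ := traceCLM.hasFDerivAt.comp_hasDerivWithinAt s hN
  have hq := traceCLM.hasFDerivAt.comp_hasDerivWithinAt s hN2
  have hρ' := traceCLM.hasFDerivAt.comp_hasDerivWithinAt s hρ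
  have hl : HasDerivWithinAt (fun s : ℝ => Λ * Real.exp (2 * s) ^ 2)
      (4 * (Λ * Real.exp (2 * s) ^ 2)) I s := by
    have h1 : HasDerivAt (fun s : ℝ => 2 * s) 2 s := by simpa using (hasDerivAt_id s).const_mul 2
    refine (((h1.exp.pow 2).const_mul Λ).hasDerivWithinAt).congr_deriv ?_
    push_cast
    ring
  refine ((((((hθ.const_mul 8).const_add 24).add (hθ.pow 2)).sub hq).sub (hρ'.const_mul 8)).sub
    (hl.const_mul 8)).congr_deriv ?_
  have hS := trace_inv_mul_sourceDeriv hf h hα (m s)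
  rw [traceCLM_apply (_ + _), Matrix.trace_add, Matrix.trace_mul_comm (_ - _)]
  simp only [constraint, accel, Function.comp, traceCLM_apply, Matrix.mul_sub, Matrix.mul_add,
    Matrix.mul_smul, Matrix.mul_neg, Matrix.neg_mul, Matrix.trace_sub, Matrix.trace_add,
    Matrix.trace_smul, Matrix.trace_neg, smul_eq_mul, Matrix.nonsing_inv_mul _ hd, Matrix.trace_one,
    Fintype.card_fin, Matrix.mul_one, ← Matrix.mul_assoc, hS]
  push_cast
  ring

lemma eq_zero_of_hasDerivWithinAt_neg_mul {u v : ℝ → ℝ} {σ : ℝ}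
    (hu : ∀ s ≤ σ, HasDerivWithinAt u (-v s * u s) (Iic σ) s) (hv : ∀ s ≤ σ, 0 ≤ v s)
    (hlim : Tendsto u atBot (𝓝 0)) : ∀ s ≤ σ, u s = 0 := by
  have hanti : AntitoneOn (fun s => u s ^ 2) (Iic σ) := by
    refine antitoneOn_of_hasDerivWithinAt_nonpos (f' := fun s => 2 * u s * (-v s * u s))
      (convex_Iic σ) (fun s hs => ((hu s hs).continuousWithinAt.pow 2)) (fun s hs => ?_)
      fun s hs => ?_
    · have hs' : s ∈ Iic σ := interior_subset hs
      refine ((hu s hs').mono interior_subset).pow 2 |>.congr_deriv ?_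
      push_cast
      ring
    · have hs' : s ∈ Iic σ := interior_subset hs
      nlinarith [hv s hs', mul_nonneg (hv s hs') (sq_nonneg (u s))]
  intro s hs
  have h0 : Tendsto (fun r => u r ^ 2) atBot (𝓝 0) := by simpa using hlim.pow 2
  have h1 : u s ^ 2 ≤ 0 := ge_of_tendsto h0 <| (eventually_le_atBot s).mono fun r hr =>
    hanti (mem_Iic.2 (hr.trans hs)) (mem_Iic.2 hs) hr
  exact pow_eq_zero_iff two_ne_zero |>.1 (le_antisymm h1 (sq_nonneg _))

section solution

variable {Λ : ℝ} {h : Fin 3 → ℝ} {f₀ : Mom → ℝ} {T : ℝ} {a k : ℝ → Mat}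
  {f : ℝ → Lp ℝ 1 (volume : Measure Mom)}

lemma IsSolution.derivWithin_eq_zero (hs : IsSolution Λ h f₀ T a k f) {t : ℝ} (ht : t ∈ Ioc 0 T) :
    derivWithin f (Ioc 0 T) t = 0 := by
  have h0 : ∀ᵐ p : Mom, p ≠ 0 := by simp [ae_iff]
  refine Lp.ext ?_
  filter_upwards [h0, hs.vlasov t ht, Lp.coeFn_zero ℝ 1 (volume : Measure Mom)] with p hp hv h1
  rw [h1]
  exact (mul_eq_zero.1 hv).resolve_left (Real.sqrt_pos.2 (quad_pos (hs.posDef t ht).inv hp)).ne'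

lemma IsSolution.ae_eq (hs : IsSolution Λ h f₀ T a k f) (hf₀ : Continuous f₀) {t : ℝ}
    (ht : t ∈ Ioc 0 T) : f t =ᵐ[volume] f₀ := by
  have hdiff : DifferentiableOn ℝ f (Ioc 0 T) := hs.contDiffF.differentiableOn one_ne_zero
  have hconst : ∀ r ∈ Ioc 0 T, f r = f t := fun r hr => by
    refine (convex_Ioc 0 T).is_const_of_fderivWithin_eq_zero (𝕜 := ℝ) hdiff (fun x hx => ?_) hr ht
    ext1
    exact fderivWithin_derivWithin.trans (by simpa using hs.derivWithin_eq_zero hx)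
  have hT : 0 < T := ht.1.trans_le ht.2
  have h1 : Tendsto (fun _ : ℝ => eLpNorm (fun p : Mom => f t p - f₀ p) 1 volume) (𝓝[>] 0) (𝓝 0) := by
    refine hs.initialF.congr' ?_
    filter_upwards [Ioc_mem_nhdsGT hT] with r hr
    rw [hconst r hr]
  have h2 := tendsto_nhds_unique tendsto_const_nhds h1
  replace h2 := (eLpNorm_eq_zero_iff ((Lp.aestronglyMeasurable (f t)).sub
    hf₀.aestronglyMeasurable) one_ne_zero).1 h2
  filter_upwards [h2] with p hp
  exact sub_eq_zero.1 hp

lemma IsSolution.hasDerivWithinAt (hs : IsSolution Λ h f₀ T a k f) {t : ℝ} (ht : t ∈ Ioc 0 T) :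
    HasDerivWithinAt a (k t) (Ioc 0 T) t :=
  hasDerivWithinAt_mat.2 (hs.hasDeriv t ht)

lemma IsSolution.transpose_k (hs : IsSolution Λ h f₀ T a k f) {t : ℝ} (ht : t ∈ Ioc 0 T) :
    (k t)ᵀ = k t := by
  ext i j
  have e : ∀ r ∈ Ioc 0 T, a r i j = a r j i := fun r hr =>
    congrFun (congrFun (transpose_eq_of_posDef (hs.posDef r hr)) j) i
  exact (uniqueDiffOn_Ioc 0 T t ht).eq_deriv _ (hs.hasDeriv t ht j i)
    ((hs.hasDeriv t ht i j).congr (fun r hr => (e r hr).symm) (e t ht).symm)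

/-- The metric in logarithmic time, after a conformal rescaling. -/
noncomputable def rescaledMetric (a : ℝ → Mat) (s : ℝ) : Mat :=
  (Real.exp (2 * s))⁻¹ • a (Real.exp (2 * s) / 2)

/-- The rate of change of the rescaled metric in logarithmic time. -/
noncomputable def rescaledVelocity (a k : ℝ → Mat) (s : ℝ) : Mat :=
  k (Real.exp (2 * s) / 2) - (2 : ℝ) • rescaledMetric a s

lemma exp_two_mul_div_two_mem {σ s : ℝ} (hσ : Real.exp (2 * σ) = 2 * T) (hs : s ≤ σ) :
    Real.exp (2 * s) / 2 ∈ Ioc 0 T := by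
  have := Real.exp_le_exp.2 (mul_le_mul_of_nonneg_left hs zero_le_two)
  exact ⟨by positivity, by linarith⟩

lemma hasDerivAt_exp_two_mul (s : ℝ) :
    HasDerivAt (fun s : ℝ => Real.exp (2 * s)) (2 * Real.exp (2 * s)) s := by
  have h1 : HasDerivAt (fun s : ℝ => 2 * s) 2 s := by simpa using (hasDerivAt_id s).const_mul 2
  exact h1.exp.congr_deriv (mul_comm _ _)

lemma IsSolution.rescaled (hs : IsSolution Λ h f₀ T a k f) (hf₀ : Continuous f₀) {σ : ℝ}
    (hσ : Real.exp (2 * σ) = 2 * T) {s : ℝ} (hsσ : s ≤ σ) :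
    (rescaledMetric a s).PosDef ∧ (rescaledVelocity a k s)ᵀ = rescaledVelocity a k s ∧
    HasDerivWithinAt (rescaledMetric a) (rescaledVelocity a k s) (Iic σ) s ∧
    HasDerivWithinAt (rescaledVelocity a k)
      (accel f₀ h (rescaledMetric a s) (rescaledVelocity a k s) +
        (2 * Λ * Real.exp (2 * s) ^ 2) • rescaledMetric a s) (Iic σ) s := by
  set t := Real.exp (2 * s) / 2 with htdef
  have ht : t ∈ Ioc 0 T := exp_two_mul_div_two_mem hσ hsσ
  set c := Real.exp (2 * s) with hc
  have hc0 : 0 < c := Real.exp_pos _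
  have hφ : HasDerivWithinAt (fun s : ℝ => Real.exp (2 * s) / 2) c (Iic σ) s :=
    ((hasDerivAt_exp_two_mul s).div_const 2).hasDerivWithinAt.congr_deriv (by rw [hc]; ring)
  have hmaps : MapsTo (fun s : ℝ => Real.exp (2 * s) / 2) (Iic σ) (Ioc 0 T) := fun r hr =>
    exp_two_mul_div_two_mem hσ hr
  have hα : (rescaledMetric a s).PosDef := (hs.posDef t ht).smul (inv_pos.2 hc0)
  have haα : a t = c • rescaledMetric a s := by
    rw [rescaledMetric, smul_smul, mul_inv_cancel₀ hc0.ne', one_smul]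
  have hkα : k t = (2 : ℝ) • rescaledMetric a s + rescaledVelocity a k s := by
    rw [rescaledVelocity, add_sub_cancel]
  have hdα : HasDerivWithinAt (rescaledMetric a) (rescaledVelocity a k s) (Iic σ) s := by
    have h1 := HasDerivWithinAt.scomp s (hs.hasDerivWithinAt ht) hφ hmaps
    have h2 := (((hasDerivAt_exp_two_mul s).inv hc0.ne').hasDerivWithinAt (s := Iic σ)).smul h1
    refine h2.congr_deriv ?_
    simp only [Function.comp, Pi.inv_apply]
    rw [← hc, ← htdef, rescaledVelocity, ← htdef, haα, smul_smul, smul_smul,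
      inv_mul_cancel₀ hc0.ne', one_smul, sub_eq_add_neg, ← neg_smul]
    congr 2
    field_simp
  have hdk : HasDerivWithinAt k (Matrix.of fun i j => derivWithin (fun s => k s i j) (Ioc 0 T) t)
      (Ioc 0 T) t := hasDerivWithinAt_mat.2 fun i j => (hs.diffK i j t ht).hasDerivWithinAt
  set k₁ : Mat := Matrix.of fun i j => derivWithin (fun s => k s i j) (Ioc 0 T) t
  have hdm : HasDerivWithinAt (rescaledVelocity a k) (c • k₁ - (2 : ℝ) • rescaledVelocity a k s)
      (Iic σ) s :=
    (HasDerivWithinAt.scomp s hdk hφ hmaps).fun_sub (hdα.fun_const_smul 2)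
  have hαT := transpose_eq_of_posDef hα
  refine ⟨hα, ?_, hdα, hdm.congr_deriv ?_⟩
  · rw [rescaledVelocity, Matrix.transpose_sub, hs.transpose_k ht, Matrix.transpose_smul, hαT]
  · refine (evolution_iff f₀ h hα (rescaledVelocity a k s) k₁ Λ hc0).1 ?_
    rw [← haα, ← hkα]
    ext i j
    have hE := hs.einstein t ht (Sum.inr i) (Sum.inr j)
    rw [ricci_space_space (uniqueDiffOn_Ioc 0 T) (fun r hr => isUnit_det (hs.posDef r hr))
      (fun r hr => hs.hasDerivWithinAt hr) ht hdk (transpose_eq_of_posDef (hs.posDef t ht))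
      (hs.transpose_k ht), stress_space (hs.posDef t ht) (hs.ae_eq hf₀ ht)] at hE
    simpa [metric] using hE

end solution

/-- The logarithmic time `s` for which `exp (2 * s) = 2 * t`. -/
noncomputable def logTime (t : ℝ) : ℝ := 1 / 2 * Real.log (2 * t)

lemma exp_two_mul_logTime {t : ℝ} (ht : 0 < t) : Real.exp (2 * logTime t) = 2 * t := by
  rw [logTime, ← mul_assoc, mul_one_div_cancel two_ne_zero, one_mul, Real.exp_log (by positivity)]

lemma hasDerivAt_logTime {t : ℝ} (ht : 0 < t) : HasDerivAt logTime (2 * t)⁻¹ t := by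
  have h1 : HasDerivAt (fun t : ℝ => 2 * t) 2 t := by simpa using (hasDerivAt_id t).const_mul 2
  refine ((h1.log (by positivity)).const_mul (1 / 2)).congr_deriv ?_
  field_simp

lemma logTime_le {t σ : ℝ} (ht : 0 < t) (h : 2 * t ≤ Real.exp (2 * σ)) : logTime t ≤ σ := by
  have := Real.exp_le_exp.1 ((exp_two_mul_logTime ht).le.trans h)
  linarith

lemma tendsto_logTime : Tendsto logTime (𝓝[>] 0) atBot := by
  have h1 : Tendsto (fun t : ℝ => 2 * t) (𝓝[>] 0) (𝓝[>] 0) := by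
    refine tendsto_nhdsWithin_iff.2 ⟨?_, ?_⟩
    · have : Tendsto (fun t : ℝ => 2 * t) (𝓝 0) (𝓝 (2 * 0)) := tendsto_id.const_mul 2
      rw [mul_zero] at this
      exact this.mono_left nhdsWithin_le_nhds
    · filter_upwards [self_mem_nhdsWithin] with t ht
      exact mul_pos two_pos (mem_Ioi.1 ht)
  exact (Real.tendsto_log_nhdsGT_zero.comp h1).const_mul_atBot (by norm_num)

/-- The spatial metric with the given rescaled metric. -/
noncomputable def physicalMetric (w : ℝ → State) (t : ℝ) : Mat :=
  (2 * t) • ((w (logTime t)).1 : Mat)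

/-- The rate of change of the spatial metric, in terms of rescaled variables. -/
noncomputable def physicalVelocity (w : ℝ → State) (t : ℝ) : Mat :=
  (2 : ℝ) • ((w (logTime t)).1 : Mat) + ((w (logTime t)).2 : Mat)

/-- A solution of the evolution equations in logarithmic time for which the metric remains positive
definite and does not contract too fast. -/
structure IsRescaledSolution (f : Mom → ℝ) (h : Fin 3 → ℝ) (Λ σ : ℝ) (w : ℝ → State) : Prop where
  hasDerivAt : ∀ s ≤ σ, HasDerivAt w (field f h (w s) + Real.exp (4 * s) • forcing Λ (w s)) s
  posDef : ∀ s ≤ σ, ((w s).1 : Mat).PosDef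
  trace_ge : ∀ s ≤ σ, -2 ≤ (((w s).1 : Mat)⁻¹ * ((w s).2 : Mat)).trace

section rescaled

variable {f : Mom → ℝ} {h : Fin 3 → ℝ} {Λ σ : ℝ} {w : ℝ → State}

lemma IsRescaledSolution.hasDerivAt_fst (hw : IsRescaledSolution f h Λ σ w) {s : ℝ} (hs : s ≤ σ) :
    HasDerivAt (fun s => ((w s).1 : Mat)) ((w s).2 : Mat) s := by
  refine ((symMat.subtypeL ∘L ContinuousLinearMap.fst ℝ symMat symMat).hasFDerivAt.comp_hasDerivAt s
    (hw.hasDerivAt s hs)).congr_deriv ?_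
  simp [field, forcing_apply]

lemma IsRescaledSolution.hasDerivAt_snd (hw : IsRescaledSolution f h Λ σ w) {s : ℝ} (hs : s ≤ σ) :
    HasDerivAt (fun s => ((w s).2 : Mat)) (accel f h (w s).1 (w s).2 +
      (2 * Λ * Real.exp (2 * s) ^ 2) • ((w s).1 : Mat)) s := by
  refine ((symMat.subtypeL ∘L ContinuousLinearMap.snd ℝ symMat symMat).hasFDerivAt.comp_hasDerivAt s
    (hw.hasDerivAt s hs)).congr_deriv ?_
  have e : Real.exp (4 * s) = Real.exp (2 * s) ^ 2 := by
    rw [← Real.exp_nat_mul]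
    congr 1
    push_cast
    ring
  have e2 := coe_symPart_of_transpose_eq
    (transpose_accel f h (symMat.transpose_coe (w s).1) (symMat.transpose_coe (w s).2))
  rw [e]
  simp only [ContinuousLinearMap.comp_apply, ContinuousLinearMap.coe_snd', Submodule.subtypeL_apply,
    field, forcing_apply, Prod.snd_add, Prod.smul_snd, Submodule.coe_add, Submodule.coe_smul, e2,
    smul_smul]
  rw [mul_comm]

lemma IsRescaledSolution.hasDerivAt_physicalMetric (hw : IsRescaledSolution f h Λ σ w) {t : ℝ}
    (ht : t ∈ Ioc 0 (Real.exp (2 * σ) / 2)) :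
    HasDerivAt (physicalMetric w) (physicalVelocity w t) t := by
  have hs : logTime t ≤ σ := logTime_le ht.1 (by linarith [ht.2])
  have h1 : HasDerivAt (fun t : ℝ => 2 * t) 2 t := by simpa using (hasDerivAt_id t).const_mul 2
  refine (h1.smul (HasDerivAt.scomp t (hw.hasDerivAt_fst hs) (hasDerivAt_logTime ht.1))).congr_deriv
    ?_
  have h0 : 2 * t ≠ 0 := by have := ht.1; positivity
  rw [smul_smul, mul_inv_cancel₀ h0, one_smul, physicalVelocity, add_comm]
  rfl

lemma IsRescaledSolution.hasDerivAt_physicalVelocity (hw : IsRescaledSolution f h Λ σ w) {t : ℝ}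
    (ht : t ∈ Ioc 0 (Real.exp (2 * σ) / 2)) :
    HasDerivAt (physicalVelocity w) ((2 * t)⁻¹ • ((2 : ℝ) • ((w (logTime t)).2 : Mat) +
      (accel f h (w (logTime t)).1 (w (logTime t)).2 +
        (2 * Λ * (2 * t) ^ 2) • ((w (logTime t)).1 : Mat)))) t := by
  have hs : logTime t ≤ σ := logTime_le ht.1 (by linarith [ht.2])
  have h1 := HasDerivAt.scomp t (((hw.hasDerivAt_fst hs).fun_const_smul (2 : ℝ)).fun_add
    (hw.hasDerivAt_snd hs)) (hasDerivAt_logTime ht.1)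
  rw [exp_two_mul_logTime ht.1] at h1
  exact h1

lemma tendsto_constraint (hf : AdmissibleWeight f) {a₀ : Mat} (ha : a₀.PosDef)
    (hfix : source f h a₀ = a₀)
    (hlim : Tendsto w atBot (𝓝 (⟨a₀, transpose_eq_of_posDef ha⟩, 0))) :
    Tendsto (fun s => constraint f h (w s).1 (w s).2 (Λ * Real.exp (2 * s) ^ 2)) atBot (𝓝 0) := by
  have hd := isUnit_det ha
  have h1 : Tendsto (fun s => ((w s).1 : Mat)) atBot (𝓝 a₀) :=
    (continuous_subtype_val.tendsto _).comp ((continuous_fst.tendsto _).comp hlim)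
  have h2 : Tendsto (fun s => ((w s).2 : Mat)) atBot (𝓝 0) :=
    (continuous_subtype_val.tendsto _).comp ((continuous_snd.tendsto _).comp hlim)
  have hmul : ∀ {x y : ℝ → Mat} {x₀ y₀ : Mat}, Tendsto x atBot (𝓝 x₀) → Tendsto y atBot (𝓝 y₀) →
      Tendsto (fun s => x s * y s) atBot (𝓝 (x₀ * y₀)) := fun {x y x₀ y₀} hx hy =>
    ((continuous_fst.matrix_mul continuous_snd).tendsto (x₀, y₀)).comp (hx.prodMk_nhds hy)
  have htr : ∀ {x : ℝ → Mat} {x₀ : Mat}, Tendsto x atBot (𝓝 x₀) →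
      Tendsto (fun s => (x s).trace) atBot (𝓝 x₀.trace) := fun {x x₀} hx =>
    (traceCLM.continuous.tendsto x₀).comp hx
  have h3 : Tendsto (fun s => ((w s).1 : Mat)⁻¹) atBot (𝓝 a₀⁻¹) :=
    (continuousAt_inv hd).tendsto.comp h1
  obtain ⟨L, hL, -⟩ := hasStrictDeriv_source hf h ha
  have h4 : Tendsto (fun s => source f h (w s).1) atBot (𝓝 (source f h a₀)) :=
    hL.continuousAt.tendsto.comp h1
  have h5 : Tendsto (fun s : ℝ => Λ * Real.exp (2 * s) ^ 2) atBot (𝓝 0) := by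
    have := ((Real.tendsto_exp_atBot.comp
      (tendsto_id.const_mul_atBot two_pos : Tendsto (fun s : ℝ => 2 * s) atBot atBot)).pow 2).const_mul Λ
    simpa using this
  have hN := hmul h3 h2
  have key := ((((((htr hN).const_mul 8).const_add 24).add ((htr hN).pow 2)).sub
    (htr (hmul hN hN))).sub ((htr (hmul h3 h4)).const_mul 8)).sub (h5.const_mul 8)
  have e : (24 + 8 * (a₀⁻¹ * (0 : Mat)).trace + (a₀⁻¹ * (0 : Mat)).trace ^ 2 -
      (a₀⁻¹ * (0 : Mat) * (a₀⁻¹ * (0 : Mat))).trace - 8 * (a₀⁻¹ * source f h a₀).trace - 8 * 0) =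
      (0 : ℝ) := by
    rw [hfix, Matrix.nonsing_inv_mul _ hd, Matrix.mul_zero, Matrix.mul_zero, Matrix.trace_zero,
      Matrix.trace_one, Fintype.card_fin]
    norm_num
  rw [e] at key
  exact key

lemma IsRescaledSolution.constraint_eq_zero (hf : AdmissibleWeight f)
    (hw : IsRescaledSolution f h Λ σ w) {a₀ : Mat} (ha : a₀.PosDef) (hfix : source f h a₀ = a₀)
    (hlim : Tendsto w atBot (𝓝 (⟨a₀, transpose_eq_of_posDef ha⟩, 0))) {s : ℝ} (hs : s ≤ σ) :
    constraint f h (w s).1 (w s).2 (Λ * Real.exp (2 * s) ^ 2) = 0 := by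
  refine eq_zero_of_hasDerivWithinAt_neg_mul
    (u := fun s => constraint f h (w s).1 (w s).2 (Λ * Real.exp (2 * s) ^ 2))
    (v := fun s => 2 + (((w s).1 : Mat)⁻¹ * ((w s).2 : Mat)).trace)
    (fun s hs => ?_) (fun s hs => by linarith [hw.trace_ge s hs])
    (tendsto_constraint hf ha hfix hlim) s hs
  exact hasDerivWithinAt_constraint (α := fun s => ((w s).1 : Mat)) (m := fun s => ((w s).2 : Mat))
    hf h (hw.posDef s hs) (hw.hasDerivAt_fst hs).hasDerivWithinAt
    (hw.hasDerivAt_snd hs).hasDerivWithinAt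

theorem IsRescaledSolution.isSolution (hf : AdmissibleData f)
    (hmom : ∀ i, ∫ p : Mom, f p * p i = 0) (hw : IsRescaledSolution f h Λ σ w) {a₀ : Mat}
    (ha : a₀.PosDef) (hfix : source f h a₀ = a₀)
    (hlim : Tendsto w atBot (𝓝 (⟨a₀, transpose_eq_of_posDef ha⟩, 0)))
    {F : Lp ℝ 1 (volume : Measure Mom)} (hF : F =ᵐ[volume] f) :
    IsSolution Λ h f (Real.exp (2 * σ) / 2) (physicalMetric w) (physicalVelocity w) fun _ => F := by
  set T := Real.exp (2 * σ) / 2 with hT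
  have hlog : ∀ t ∈ Ioc 0 T, logTime t ≤ σ := fun t ht => logTime_le ht.1 (by linarith [ht.2])
  have hpos : ∀ t ∈ Ioc 0 T, (physicalMetric w t).PosDef := fun t ht =>
    (hw.posDef _ (hlog t ht)).smul (by have := ht.1; positivity)
  have hunit : ∀ t ∈ Ioc 0 T, IsUnit (physicalMetric w t).det := fun t ht => isUnit_det (hpos t ht)
  have hda : ∀ t ∈ Ioc 0 T, HasDerivWithinAt (physicalMetric w) (physicalVelocity w t) (Ioc 0 T) t :=
    fun t ht => (hw.hasDerivAt_physicalMetric ht).hasDerivWithinAt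
  have hdk := fun t (ht : t ∈ Ioc 0 T) => (hw.hasDerivAt_physicalVelocity ht).hasDerivWithinAt
    (s := Ioc 0 T)
  have hkT : ∀ t, (physicalVelocity w t)ᵀ = physicalVelocity w t := fun t => by
    rw [physicalVelocity, Matrix.transpose_add, Matrix.transpose_smul, symMat.transpose_coe,
      symMat.transpose_coe]
  refine
    { posDef := hpos
      hasDeriv := fun t ht => hasDerivWithinAt_mat.1 (hda t ht)
      contK := fun i j t ht => (hasDerivWithinAt_mat.1 (hdk t ht) i j).continuousWithinAt
      diffK := fun i j t ht => (hasDerivWithinAt_mat.1 (hdk t ht) i j).differentiableWithinAt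
      contDiffF := contDiffOn_const
      nonnegF := fun t _ => ?_
      integrableF := fun t _ => ?_
      initialF := ?_
      vlasov := fun t _ => ?_
      maxwell := fun t ht β => maxwell_of_metric (uniqueDiffOn_Ioc 0 T t ht) (hunit t ht) (hda t ht)
        (transpose_eq_of_posDef (hpos t ht)) (hkT t) h β
      einstein := fun t ht => ?_ }
  · filter_upwards [hF] with p hp
    rw [hp]
    exact hf.nonneg p
  · refine (hf.integrable_mul (g := fun p => ‖p‖) (by fun_prop)).congr ?_
    filter_upwards [hF] with p hp
    rw [hp, mul_comm]
  · have h0 : eLpNorm (fun p : Mom => F p - f p) 1 volume = 0 := by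
      refine eLpNorm_eq_zero_of_ae_zero ?_
      filter_upwards [hF] with p hp
      simp [hp]
    simp only [h0]
    exact tendsto_const_nhds
  · rw [derivWithin_fun_const]
    filter_upwards [Lp.coeFn_zero ℝ 1 (volume : Measure Mom)] with p hp
    change energy _ p * (0 : Lp ℝ 1 (volume : Measure Mom)) p = 0
    rw [hp, Pi.zero_apply, mul_zero]
  · have ht0 : 0 < 2 * t := by have := ht.1; positivity
    have hα := hw.posDef _ (hlog t ht)
    set k₁ := (2 * t)⁻¹ • ((2 : ℝ) • ((w (logTime t)).2 : Mat) +
      (accel f h (w (logTime t)).1 (w (logTime t)).2 +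
        (2 * Λ * (2 * t) ^ 2) • ((w (logTime t)).1 : Mat))) with hk₁
    have hev : (2 * t) • k₁ - (2 : ℝ) • ((w (logTime t)).2 : Mat) =
        accel f h (w (logTime t)).1 (w (logTime t)).2 +
        (2 * Λ * (2 * t) ^ 2) • ((w (logTime t)).1 : Mat) := by
      rw [hk₁, smul_smul, mul_inv_cancel₀ ht0.ne', one_smul, add_sub_cancel_left]
    rintro (u | i) (v | j)
    · rw [ricci_time_time (uniqueDiffOn_Ioc 0 T) hunit hda ht (hdk t ht),
        stress_time hf.toAdmissibleWeight (hpos t ht) hF]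
      have hC := hw.constraint_eq_zero hf.toAdmissibleWeight ha hfix hlim (hlog t ht)
      rw [exp_two_mul_logTime ht.1] at hC
      have := hamiltonian_of_constraint f h hα ht0 hev hC
      obtain rfl := Subsingleton.elim u v
      have e : metric (physicalMetric w) t (Sum.inl u) (Sum.inl u) = -1 := by simp [metric]
      rw [e, mul_neg_one, ← sub_eq_add_neg]
      exact this
    · rw [(ricci_time_space (uniqueDiffOn_Ioc 0 T) hunit hda ht u j).1,
        (stress_time_space hf.toAdmissibleWeight (hpos t ht) hmom hF h u j).1]
      simp [metric]
    · rw [(ricci_time_space (uniqueDiffOn_Ioc 0 T) hunit hda ht v i).2,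
        (stress_time_space hf.toAdmissibleWeight (hpos t ht) hmom hF h v i).2]
      simp [metric]
    · rw [ricci_space_space (uniqueDiffOn_Ioc 0 T) hunit hda ht (hdk t ht)
        (transpose_eq_of_posDef (hpos t ht)) (hkT t), stress_space (hpos t ht) hF]
      have := (evolution_iff f h hα ((w (logTime t)).2 : Mat) k₁ Λ ht0).2 hev
      rw [metric, Matrix.fromBlocks_apply₂₂]
      exact congrFun (congrFun this i) j

end rescaled

lemma contDiffOn_one_of_hasDerivWithinAt {u u' : ℝ → ℝ} {I : Set ℝ} (hI : UniqueDiffOn ℝ I)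
    (hu : ∀ t ∈ I, HasDerivWithinAt u (u' t) I t) (hc : ContinuousOn u' I) : ContDiffOn ℝ 1 u I := by
  rw [contDiffOn_one_iff_derivWithin hI]
  exact ⟨fun t ht => (hu t ht).differentiableWithinAt,
    hc.congr fun t ht => (hu t ht).derivWithin (hI t ht)⟩

/-- A function of the logarithm of time, extended to time zero by its limit. -/
noncomputable def extendLog {E : Type*} (x₀ : E) (x : ℝ → E) (τ : ℝ) : E :=
  if τ ≤ 0 then x₀ else x (Real.log τ)

lemma extendLog_zero {E : Type*} (x₀ : E) (x : ℝ → E) : extendLog x₀ x 0 = x₀ := if_pos le_rfl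

lemma extendLog_of_pos {E : Type*} (x₀ : E) (x : ℝ → E) {τ : ℝ} (hτ : 0 < τ) :
    extendLog x₀ x τ = x (Real.log τ) := if_neg hτ.not_ge

lemma extendLog_eventuallyEq {E : Type*} (x₀ : E) (x : ℝ → E) {τ : ℝ} (hτ : 0 < τ) :
    extendLog x₀ x =ᶠ[𝓝 τ] fun τ => x (Real.log τ) := by
  filter_upwards [lt_mem_nhds hτ] with r hr using extendLog_of_pos x₀ x hr

lemma log_le_of_mem {σ τ : ℝ} (hτ : 0 < τ) (h : τ ≤ Real.exp σ) : Real.log τ ≤ σ :=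
  (Real.log_le_iff_le_exp hτ).2 h

lemma continuousOn_extendLog {E : Type*} [NormedAddCommGroup E] {x₀ : E} {x : ℝ → E} {σ : ℝ}
    (hx : ∀ s ≤ σ, ContinuousAt x s)
    (hlim : Tendsto x atBot (𝓝 x₀)) : ContinuousOn (extendLog x₀ x) (Icc 0 (Real.exp σ)) := by
  intro τ hτ
  rcases hτ.1.eq_or_lt with rfl | h0
  · have h1 : Tendsto (extendLog x₀ x) (𝓝[>] 0) (𝓝 x₀) := by
      refine (hlim.comp Real.tendsto_log_nhdsGT_zero).congr' ?_
      filter_upwards [self_mem_nhdsWithin] with r hr using (extendLog_of_pos x₀ x hr).symm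
    have h2 : ContinuousWithinAt (extendLog x₀ x) (Ici 0) 0 := by
      rw [← Ioi_insert, continuousWithinAt_insert_self, ContinuousWithinAt, extendLog_zero]
      exact h1
    exact h2.mono Icc_subset_Ici_self
  · refine ContinuousAt.continuousWithinAt ?_
    refine ContinuousAt.congr ?_ (extendLog_eventuallyEq x₀ x h0).symm
    exact (hx _ (log_le_of_mem h0 hτ.2)).comp (Real.continuousAt_log h0.ne')

lemma hasDerivWithinAt_extendLog {E : Type*} [NormedAddCommGroup E] [NormedSpace ℝ E] {x₀ : E}
    {x x' : ℝ → E} {σ : ℝ}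
    (hx : ∀ s ≤ σ, HasDerivAt x (x' s) s)
    (hO : (fun s => x s - x₀) =O[atBot] fun s => Real.exp (2 * s)) {τ : ℝ}
    (hτ : τ ∈ Icc 0 (Real.exp σ)) :
    HasDerivWithinAt (extendLog x₀ x) (extendLog 0 (fun s => Real.exp (-s) • x' s) τ)
      (Icc 0 (Real.exp σ)) τ := by
  rcases hτ.1.eq_or_lt with rfl | h0
  · obtain ⟨C, hC⟩ := hO.bound
    obtain ⟨s₁, hs₁⟩ := eventually_atBot.1 hC
    have h1 : (fun τ => extendLog x₀ x τ - x₀) =O[𝓝[Icc 0 (Real.exp σ)] 0]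
        fun τ => ‖τ - 0‖ ^ 2 := by
      refine IsBigO.of_bound C ?_
      filter_upwards [self_mem_nhdsWithin, mem_nhdsWithin_of_mem_nhds
        (gt_mem_nhds (Real.exp_pos s₁))] with r hr hr1
      rcases hr.1.eq_or_lt with rfl | hr0
      · simp [extendLog_zero]
      · have := hs₁ (Real.log r) (log_le_of_mem hr0 hr1.le)
        rw [mul_comm 2, Real.exp_mul, Real.exp_log hr0] at this
        rw [extendLog_of_pos _ _ hr0]
        simpa using this
    have h2 := (h1.hasFDerivWithinAt (𝕜 := ℝ) hτ one_lt_two).hasDerivWithinAt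
    rw [extendLog_zero]
    simpa using h2
  · refine HasDerivAt.hasDerivWithinAt ?_
    refine HasDerivAt.congr_of_eventuallyEq ?_ (extendLog_eventuallyEq x₀ x h0)
    rw [extendLog_of_pos _ _ h0, Real.exp_neg, Real.exp_log h0]
    exact HasDerivAt.scomp τ (hx _ (log_le_of_mem h0 hτ.2)) (Real.hasDerivAt_log h0.ne')

lemma HasStrictDeriv.continuousAt {E F : Type*} [NormedAddCommGroup E] [NormedSpace ℝ E]
    [NormedAddCommGroup F] [NormedSpace ℝ F] {f f' : E → F} {a : E} (hf : HasStrictDeriv f f' a) :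
    ContinuousAt f a := by
  obtain ⟨L, hL, -⟩ := hf
  exact hL.continuousAt

lemma continuousAt_field {f : Mom → ℝ} (hf : AdmissibleWeight f) (h : Fin 3 → ℝ) {w₀ : State}
    (ha : (w₀.1 : Mat).PosDef) : ContinuousAt (field f h) w₀ := by
  have d1 : HasStrictDeriv (fun w : State => (w.1 : Mat)) (fun w => (w.1 : Mat)) w₀ :=
    hasStrictDeriv_clm (symMat.subtypeL ∘L ContinuousLinearMap.fst ℝ symMat symMat) w₀
  have d2 : HasStrictDeriv (fun w : State => (w.2 : Mat)) (fun w => (w.2 : Mat)) w₀ :=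
    hasStrictDeriv_clm (symMat.subtypeL ∘L ContinuousLinearMap.snd ℝ symMat symMat) w₀
  have d3 : HasStrictDeriv (fun w : State => (w.1 : Mat)⁻¹) _ w₀ :=
    HasStrictDeriv.comp (g := fun a : Mat => a⁻¹) (f := fun w : State => (w.1 : Mat))
      (hasStrictDeriv_inv (isUnit_det ha)) d1
  have d4 : HasStrictDeriv (fun w : State => source f h (w.1 : Mat)) _ w₀ :=
    HasStrictDeriv.comp (g := source f h) (f := fun w : State => (w.1 : Mat))
      (hasStrictDeriv_source hf h ha) d1
  have d5 := (d3.mul d2).clm_comp traceCLM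
  have d6 := ((((d2.neg).sub (d5.smul d1)).sub ((d1.sub d4).const_smul 2)).sub
    ((d5.const_smul (1 / 2)).smul d2)).add ((d2.mul d3).mul d2)
  exact continuousAt_snd.prodMk (d6.clm_comp symPart).continuousAt

lemma exp_four_mul_logTime {t : ℝ} (ht : 0 < t) : Real.exp (4 * logTime t) = 4 * t ^ 2 := by
  have e : Real.exp (4 * logTime t) = Real.exp (2 * logTime t) ^ 2 := by
    rw [← Real.exp_nat_mul]
    congr 1
    push_cast
    ring
  rw [e, exp_two_mul_logTime ht]
  ring

lemma isBigO_comp_logTime {x : ℝ → ℝ} (hx : x =O[atBot] fun s => Real.exp (4 * s)) :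
    (fun t => x (logTime t)) =O[𝓝[>] 0] fun t => t ^ 2 := by
  refine (hx.comp_tendsto tendsto_logTime).trans (IsBigO.of_bound 4 ?_)
  filter_upwards [self_mem_nhdsWithin] with t ht
  simp only [Function.comp, exp_four_mul_logTime (mem_Ioi.1 ht), norm_mul]
  norm_num

lemma isBigO_pow_rpow (n : ℕ) {r : ℝ} (hr : r ≤ n) :
    (fun t : ℝ => t ^ n) =O[𝓝[>] 0] fun t => t ^ r := by
  refine IsBigO.of_bound 1 ?_
  filter_upwards [Ioc_mem_nhdsGT one_pos] with t ht
  rw [one_mul, Real.norm_of_nonneg (pow_nonneg ht.1.le n),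
    Real.norm_of_nonneg (Real.rpow_nonneg ht.1.le r), ← Real.rpow_natCast]
  exact Real.rpow_le_rpow_of_exponent_ge ht.1 ht.2 hr

section rescaled

variable {f : Mom → ℝ} {h : Fin 3 → ℝ} {Λ σ : ℝ} {w : ℝ → State} {a₀ : Mat}

lemma isBigO_metric (ha : a₀.PosDef)
    (hO : (fun s => w s - (⟨a₀, transpose_eq_of_posDef ha⟩, 0)) =O[atBot] fun s => Real.exp (4 * s)) :
    (fun s => ((w s).1 : Mat) - a₀) =O[atBot] fun s => Real.exp (4 * s) := by
  have := ((symMat.subtypeL ∘L ContinuousLinearMap.fst ℝ symMat symMat).isBigO_comp _ _).trans hO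
  simpa using this

lemma isBigO_velocity (ha : a₀.PosDef)
    (hO : (fun s => w s - (⟨a₀, transpose_eq_of_posDef ha⟩, 0)) =O[atBot] fun s => Real.exp (4 * s)) :
    (fun s => ((w s).2 : Mat)) =O[atBot] fun s => Real.exp (4 * s) := by
  have := ((symMat.subtypeL ∘L ContinuousLinearMap.snd ℝ symMat symMat).isBigO_comp _ _).trans hO
  simpa using this

lemma tendsto_exp_mul_atBot {c : ℝ} (hc : 0 < c) : Tendsto (fun s => Real.exp (c * s)) atBot (𝓝 0) :=
  Real.tendsto_exp_atBot.comp (tendsto_id.const_mul_atBot hc)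

lemma tendsto_state (ha : a₀.PosDef)
    (hO : (fun s => w s - (⟨a₀, transpose_eq_of_posDef ha⟩, 0)) =O[atBot] fun s => Real.exp (4 * s)) :
    Tendsto w atBot (𝓝 (⟨a₀, transpose_eq_of_posDef ha⟩, 0)) :=
  tendsto_sub_nhds_zero_iff.1 (hO.trans_tendsto (tendsto_exp_mul_atBot four_pos))

lemma field_eq_zero (ha : a₀.PosDef) (hfix : source f h a₀ = a₀) :
    field f h (⟨a₀, transpose_eq_of_posDef ha⟩, 0) = 0 := by
  simp [field, accel, hfix]

lemma isBigO_rhs (hf : AdmissibleData f) (ha : a₀.PosDef) (hfix : source f h a₀ = a₀)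
    (hO : (fun s => w s - (⟨a₀, transpose_eq_of_posDef ha⟩, 0)) =O[atBot] fun s => Real.exp (4 * s)) :
    (fun s => field f h (w s) + Real.exp (4 * s) • forcing Λ (w s)) =O[atBot]
      fun s => Real.exp (4 * s) := by
  have hlim := tendsto_state ha hO
  obtain ⟨L, -, -, hL, -⟩ := hf.exists_dissipative ha hfix
  have h1 := hL.hasFDerivAt.isBigO_sub.comp_tendsto hlim
  simp only [Function.comp_def, field_eq_zero ha hfix, sub_zero] at h1
  refine (h1.trans hO).add ?_
  have h2 : (fun s => forcing Λ (w s)) =O[atBot] fun _ => (1 : ℝ) :=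
    (((forcing Λ).continuous.tendsto _).comp hlim).isBigO_one ℝ
  simpa using (isBigO_refl (fun s => Real.exp (4 * s)) atBot).smul h2

lemma isBigO_exp_smul {E : Type*} [NormedAddCommGroup E] [NormedSpace ℝ E] {x : ℝ → E} {b c : ℝ}
    (hx : x =O[atBot] fun s => Real.exp (b * s)) (hbc : c + 1 = b) :
    (fun s => Real.exp (-s) • x s) =O[atBot] fun s => Real.exp (c * s) := by
  refine ((isBigO_refl (fun s => Real.exp (-s)) atBot).smul hx).congr_right fun s => ?_
  rw [smul_eq_mul, ← Real.exp_add, ← hbc]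
  congr 1
  ring

lemma IsRescaledSolution.continuousAt_rhs (hf : AdmissibleWeight f)
    (hw : IsRescaledSolution f h Λ σ w) {s : ℝ} (hs : s ≤ σ) :
    ContinuousAt (fun s => field f h (w s) + Real.exp (4 * s) • forcing Λ (w s)) s := by
  have h1 := (hw.hasDerivAt s hs).continuousAt
  have h2 : ContinuousAt (fun s => field f h (w s)) s :=
    ContinuousAt.comp (continuousAt_field hf h (hw.posDef s hs)) h1
  have h3 : ContinuousAt (fun s => forcing Λ (w s)) s := (forcing Λ).continuous.continuousAt.comp h1
  exact h2.add ((by fun_prop : ContinuousAt (fun s : ℝ => Real.exp (4 * s)) s).smul h3)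

lemma IsRescaledSolution.hasDerivAt_snd_rhs (hw : IsRescaledSolution f h Λ σ w) {s : ℝ}
    (hs : s ≤ σ) : HasDerivAt (fun s => ((w s).2 : Mat))
      (((field f h (w s) + Real.exp (4 * s) • forcing Λ (w s)).2 : symMat) : Mat) s :=
  (symMat.subtypeL ∘L ContinuousLinearMap.snd ℝ symMat symMat).hasFDerivAt.comp_hasDerivAt s
    (hw.hasDerivAt s hs)

lemma IsRescaledSolution.contDiffOn_physicalVelocity (hf : AdmissibleWeight f)
    (hw : IsRescaledSolution f h Λ σ w) (i j : Fin 3) :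
    ContDiffOn ℝ 1 (fun t => physicalVelocity w t i j) (Ioc 0 (Real.exp (2 * σ) / 2)) := by
  set k₁ : ℝ → Mat := fun t => (2 * t)⁻¹ • ((2 : ℝ) • ((w (logTime t)).2 : Mat) +
      (((fun s => field f h (w s) + Real.exp (4 * s) • forcing Λ (w s)) (logTime t)).2 : Mat))
      with hk₁
  refine contDiffOn_one_of_hasDerivWithinAt (u' := fun t => k₁ t i j) (uniqueDiffOn_Ioc 0 _)
    (fun t ht => ?_) fun t ht => ?_
  · have hs : logTime t ≤ σ := logTime_le ht.1 (by linarith [ht.2])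
    have h1 := HasDerivAt.scomp t (((hw.hasDerivAt_fst hs).fun_const_smul (2 : ℝ)).fun_add
      (hw.hasDerivAt_snd_rhs hs)) (hasDerivAt_logTime ht.1)
    exact hasDerivWithinAt_mat.1 h1.hasDerivWithinAt i j
  · have hs : logTime t ≤ σ := logTime_le ht.1 (by linarith [ht.2])
    have ht2 : 2 * t ≠ 0 := by have := ht.1; positivity
    have hlog := (hasDerivAt_logTime ht.1).continuousAt
    have c1 : ContinuousAt (fun t => ((w (logTime t)).2 : Mat)) t :=
      (hw.hasDerivAt_snd hs).continuousAt.comp hlog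
    have c2 : ContinuousAt (fun t => (((fun s => field f h (w s) +
        Real.exp (4 * s) • forcing Λ (w s)) (logTime t)).2 : Mat)) t :=
      (continuous_subtype_val.comp continuous_snd).continuousAt.comp
        ((hw.continuousAt_rhs hf hs).comp hlog)
    have c3 : ContinuousAt k₁ t :=
      ((by fun_prop : ContinuousAt (fun t : ℝ => 2 * t) t).inv₀ ht2).smul ((c1.fun_const_smul (2 : ℝ)).fun_add c2)
    exact ((entryCLM i j).continuous.continuousAt.comp c3).continuousWithinAt

lemma IsRescaledSolution.contDiffOn_physicalMetric (hf : AdmissibleWeight f)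
    (hw : IsRescaledSolution f h Λ σ w) (i j : Fin 3) :
    ContDiffOn ℝ 1 (fun t => physicalMetric w t i j) (Ioc 0 (Real.exp (2 * σ) / 2)) :=
  contDiffOn_one_of_hasDerivWithinAt (uniqueDiffOn_Ioc 0 _)
    (fun _ ht => hasDerivWithinAt_mat.1 (hw.hasDerivAt_physicalMetric ht).hasDerivWithinAt i j)
    (hw.contDiffOn_physicalVelocity hf i j).continuousOn

theorem IsRescaledSolution.hasConformalGaugeSingularity (hf : AdmissibleData f)
    (hw : IsRescaledSolution f h Λ σ w) (ha : a₀.PosDef) (hfix : source f h a₀ = a₀)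
    (hO : (fun s => w s - (⟨a₀, transpose_eq_of_posDef ha⟩, 0)) =O[atBot] fun s => Real.exp (4 * s)) :
    HasConformalGaugeSingularity 1 (Real.exp (2 * σ) / 2) (physicalMetric w) := by
  have hT : Real.sqrt (2 * (Real.exp (2 * σ) / 2)) = Real.exp σ := by
    rw [mul_div_cancel₀ _ two_ne_zero, mul_comm, Real.exp_mul, Real.rpow_two,
      Real.sqrt_sq (Real.exp_pos _).le]
  set α : ℝ → Mat := fun s => ((w s).1 : Mat) with hα
  set m : ℝ → Mat := fun s => ((w s).2 : Mat) with hm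
  set m' : ℝ → Mat :=
    fun s => ((field f h (w s) + Real.exp (4 * s) • forcing Λ (w s)).2 : Mat) with hm'
  set y : ℝ → Mat := fun s => Real.exp (-s) • m s with hy
  set y' : ℝ → Mat := fun s => Real.exp (-s) • (m' s - m s) with hy'
  have oα : (fun s => α s - a₀) =O[atBot] fun s => Real.exp (2 * s) :=
    (isBigO_metric ha hO).trans <| IsBigO.of_bound 1 <| (eventually_le_atBot 0).mono fun s hs => by
      rw [one_mul, Real.norm_of_nonneg (Real.exp_pos _).le, Real.norm_of_nonneg (Real.exp_pos _).le]
      exact Real.exp_le_exp.2 (by linarith)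
  have om := isBigO_velocity ha hO
  have om' : m' =O[atBot] fun s => Real.exp (4 * s) :=
    ((symMat.subtypeL ∘L ContinuousLinearMap.snd ℝ symMat symMat).isBigO_comp _ _).trans
      (isBigO_rhs hf ha hfix hO)
  have oy3 : y =O[atBot] fun s => Real.exp (3 * s) := isBigO_exp_smul om (by norm_num)
  have oy : (fun s => y s - 0) =O[atBot] fun s => Real.exp (2 * s) := by
    simp only [sub_zero]
    exact oy3.trans <| IsBigO.of_bound 1 <| (eventually_le_atBot 0).mono fun s hs => by
      rw [one_mul, Real.norm_of_nonneg (Real.exp_pos _).le, Real.norm_of_nonneg (Real.exp_pos _).le]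
      exact Real.exp_le_exp.2 (by linarith)
  have oy' : (fun s => Real.exp (-s) • y' s) =O[atBot] fun s => Real.exp (2 * s) :=
    isBigO_exp_smul (isBigO_exp_smul (om'.sub om) (c := 3) (by norm_num)) (by norm_num)
  have dα : ∀ s ≤ σ, HasDerivAt α (m s) s := fun s hs => hw.hasDerivAt_fst hs
  have dm : ∀ s ≤ σ, HasDerivAt m (m' s) s := fun s hs => hw.hasDerivAt_snd_rhs hs
  have dy : ∀ s ≤ σ, HasDerivAt y (y' s) s := fun s hs => by
    refine (((hasDerivAt_id s).neg.exp).smul (dm s hs)).congr_deriv ?_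
    simp only [hy', smul_sub]
    simp only [Pi.neg_apply, id, mul_neg, mul_one, neg_smul]
    abel
  have cm' : ∀ s ≤ σ, ContinuousAt m' s := fun s hs =>
    (continuous_subtype_val.comp continuous_snd).continuousAt.comp
      (hw.continuousAt_rhs hf.toAdmissibleWeight hs)
  have cy' : ∀ s ≤ σ, ContinuousAt (fun s => Real.exp (-s) • y' s) s := fun s hs => by
    have c1 : ContinuousAt (fun s : ℝ => Real.exp (-s)) s := by fun_prop
    exact c1.smul (c1.smul ((cm' s hs).sub (dm s hs).continuousAt))
  have dA := fun τ hτ => hasDerivWithinAt_extendLog dα oα (τ := τ) hτ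
  have dK := fun τ hτ => hasDerivWithinAt_extendLog dy oy (τ := τ) hτ
  have cK' := continuousOn_extendLog cy' (oy'.trans_tendsto (tendsto_exp_mul_atBot two_pos))
  have hu := uniqueDiffOn_Icc (Real.exp_pos σ)
  have kK : ∀ i j, ContDiffOn ℝ 1 (fun τ => extendLog 0 y τ i j) (Icc 0 (Real.exp σ)) := fun i j =>
    contDiffOn_one_of_hasDerivWithinAt hu (fun τ hτ => hasDerivWithinAt_mat.1 (dK τ hτ) i j)
      ((entryCLM i j).continuous.comp_continuousOn cK')
  refine ⟨extendLog a₀ α, extendLog 0 y, fun τ hτ => ?_, ?_, ?_, ?_, ?_⟩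
  · have hτ2 : (0 : ℝ) < τ ^ 2 / 2 := by have := hτ.1; positivity
    have e : logTime (τ ^ 2 / 2) = Real.log τ := by
      rw [logTime, mul_div_cancel₀ _ two_ne_zero, Real.log_pow]
      push_cast
      ring
    rw [extendLog_of_pos _ _ hτ.1, physicalMetric, e, smul_smul, mul_div_cancel₀ _ two_ne_zero,
      inv_mul_cancel₀ (pow_ne_zero 2 hτ.1.ne'), one_smul]
  · rwa [extendLog_zero]
  · rw [hT]
    exact fun τ hτ => hasDerivWithinAt_mat.1 (dA τ hτ)
  · rw [hT]
    exact fun i j => contDiffOn_one_of_hasDerivWithinAt hu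
      (fun τ hτ => hasDerivWithinAt_mat.1 (dA τ hτ) i j) (kK i j).continuousOn
  · rw [hT]
    exact kK

lemma isLittleO_physicalMetric (ha : a₀.PosDef)
    (hO : (fun s => w s - (⟨a₀, transpose_eq_of_posDef ha⟩, 0)) =O[atBot] fun s => Real.exp (4 * s))
    (i j : Fin 3) :
    (fun t => physicalMetric w t i j - 2 * t * a₀ i j) =o[𝓝[>] 0] fun t => t ^ 2 := by
  have h1 := isBigO_comp_logTime (((entryCLM i j).isBigO_comp _ _).trans (isBigO_metric ha hO))
  have h2 : (fun t : ℝ => 2 * t * entryCLM i j (((w (logTime t)).1 : Mat) - a₀)) =O[𝓝[>] 0]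
      fun t => t ^ 3 := by
    refine (((isBigO_refl (fun t : ℝ => t) (𝓝[>] 0)).const_mul_left 2).mul h1).congr_right
      fun t => by ring
  have h3 : (fun t : ℝ => t ^ 3) =o[𝓝[>] 0] fun t => t ^ 2 :=
    (isLittleO_pow_pow (by norm_num)).mono nhdsWithin_le_nhds
  refine (h2.trans_isLittleO h3).congr_left fun t => ?_
  simp only [entryCLM_apply, physicalMetric, Matrix.sub_apply, Matrix.smul_apply, smul_eq_mul]
  ring

lemma isLittleO_physicalVelocity (ha : a₀.PosDef)
    (hO : (fun s => w s - (⟨a₀, transpose_eq_of_posDef ha⟩, 0)) =O[atBot] fun s => Real.exp (4 * s))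
    (i j : Fin 3) :
    (fun t => physicalVelocity w t i j - 2 * a₀ i j) =o[𝓝[>] 0] fun t => t := by
  have h1 := isBigO_comp_logTime (((entryCLM i j).isBigO_comp _ _).trans (isBigO_metric ha hO))
  have h2 := isBigO_comp_logTime (((entryCLM i j).isBigO_comp _ _).trans (isBigO_velocity ha hO))
  have h3 : (fun t : ℝ => t ^ 2) =o[𝓝[>] 0] fun t => t ^ 1 :=
    (isLittleO_pow_pow (by norm_num)).mono nhdsWithin_le_nhds
  simp only [pow_one] at h3
  refine (((h1.const_mul_left 2).add h2).trans_isLittleO h3).congr_left fun t => ?_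
  simp only [entryCLM_apply, physicalVelocity, Matrix.sub_apply, Matrix.add_apply,
    Matrix.smul_apply, smul_eq_mul]
  ring

end rescaled

lemma eq_zero_of_tendsto_deriv {E : Type*} [NormedAddCommGroup E] [NormedSpace ℝ E] {x x' : ℝ → E}
    {c : E} {σ : ℝ} (hx : ∀ s ≤ σ, HasDerivWithinAt x (x' s) (Iic σ) s)
    (h0 : Tendsto x atBot (𝓝 0)) (hc : Tendsto x' atBot (𝓝 c)) : c = 0 := by
  have h1 : Tendsto (fun s : ℝ => x s - x (s - 1)) atBot (𝓝 (0 - 0)) :=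
    h0.sub (h0.comp (tendsto_atBot_add_const_right atBot (-1) tendsto_id))
  rw [sub_zero] at h1
  refine tendsto_nhds_unique ?_ h1
  refine Metric.tendsto_nhds.2 fun ε hε => ?_
  obtain ⟨s₁, hs₁⟩ := eventually_atBot.1 (Metric.tendsto_nhds.1 hc (ε / 2) (by positivity))
  refine eventually_atBot.2 ⟨min s₁ σ, fun s hs => ?_⟩
  have hσ : s ≤ σ := hs.trans (min_le_right _ _)
  have h2 := (convex_Icc (s - 1) s).norm_image_sub_le_of_norm_hasDerivWithin_le
    (f := fun r => x r - r • c) (f' := fun r => x' r - c) (C := ε / 2)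
    (fun r hr => ?_) (fun r hr => ?_) (x := s - 1) (y := s) (by simp) (by simp)
  · have e : x s - s • c - (x (s - 1) - (s - 1) • c) = x s - x (s - 1) - c := by
      rw [sub_smul, one_smul]; abel
    simp only [e, sub_sub_cancel, norm_one, mul_one] at h2
    rw [dist_eq_norm]
    linarith
  · refine HasDerivWithinAt.sub ((hx r (hr.2.trans hσ)).mono fun q hq => hq.2.trans hσ) ?_
    simpa using ((hasDerivAt_id r).smul_const c).hasDerivWithinAt
  · rw [← dist_eq_norm]
    exact (hs₁ r (hr.2.trans (hs.trans (min_le_left _ _)))).le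

lemma isBigO_mat {x : ℝ → Mat} {g : ℝ → ℝ} {l : Filter ℝ} (hx : ∀ i j, (fun s => x s i j) =O[l] g) :
    x =O[l] g := by
  have h : (fun s => ∑ i, ∑ j, x s i j • Matrix.single i j (1 : ℝ)) =O[l] g :=
    IsBigO.fun_sum fun i _ => IsBigO.fun_sum fun j _ => by
      have := (hx i j).smul (isBigO_refl (fun _ : ℝ => Matrix.single i j (1 : ℝ)) l)
      refine this.trans ?_
      refine IsBigO.of_bound ‖Matrix.single i j (1 : ℝ)‖ (Eventually.of_forall fun s => ?_)
      rw [norm_smul, mul_comm]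
  refine h.congr_left fun s => ?_
  conv_rhs => rw [Matrix.matrix_eq_sum_single (x s)]
  simp

section uniqueness

variable {Λ : ℝ} {h : Fin 3 → ℝ} {f₀ : Mom → ℝ} {T : ℝ} {a k : ℝ → Mat}
  {f : ℝ → Lp ℝ 1 (volume : Measure Mom)}

/-- The rescaled metric and velocity as a curve in the space of states. -/
noncomputable def rescaledState (a k : ℝ → Mat) (s : ℝ) : State :=
  (symPart (rescaledMetric a s), symPart (rescaledVelocity a k s))

lemma IsSolution.coe_rescaledState (hs : IsSolution Λ h f₀ T a k f) (hf₀ : Continuous f₀) {σ : ℝ}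
    (hσ : Real.exp (2 * σ) = 2 * T) {s : ℝ} (hsσ : s ≤ σ) :
    ((rescaledState a k s).1 : Mat) = rescaledMetric a s ∧
      ((rescaledState a k s).2 : Mat) = rescaledVelocity a k s := by
  obtain ⟨h1, h2, -, -⟩ := hs.rescaled hf₀ hσ hsσ
  exact ⟨coe_symPart_of_transpose_eq (transpose_eq_of_posDef h1), coe_symPart_of_transpose_eq h2⟩

lemma IsSolution.hasDerivWithinAt_rescaledState (hs : IsSolution Λ h f₀ T a k f)
    (hf₀ : Continuous f₀) {σ : ℝ} (hσ : Real.exp (2 * σ) = 2 * T) {s : ℝ} (hsσ : s ≤ σ) :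
    HasDerivWithinAt (rescaledState a k) (field f₀ h (rescaledState a k s) +
      Real.exp (4 * s) • forcing Λ (rescaledState a k s)) (Iic σ) s := by
  obtain ⟨h1, h2, h3, h4⟩ := hs.rescaled hf₀ hσ hsσ
  obtain ⟨e1, e2⟩ := hs.coe_rescaledState hf₀ hσ hsσ
  refine ((symPart.hasFDerivAt.comp_hasDerivWithinAt s h3).prodMk
    (symPart.hasFDerivAt.comp_hasDerivWithinAt s h4)).congr_deriv ?_
  have e : Real.exp (4 * s) = Real.exp (2 * s) ^ 2 := by
    rw [← Real.exp_nat_mul]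
    congr 1
    push_cast
    ring
  refine Prod.ext ?_ ?_
  · simp [field, forcing_apply, rescaledState]
  · simp only [field, forcing_apply, e1, e2, Prod.snd_add, Prod.smul_snd, map_add, map_smul, e,
      smul_smul]
    rw [mul_comm (2 * Λ)]
    rfl

/-- At an initial conformal gauge singularity the rescaled metric has a limit, which it approaches
at the rate `exp s`. -/
lemma IsSolution.exists_limit (hs : IsSolution Λ h f₀ T a k f) (hf₀ : Continuous f₀)
    (hc : HasConformalGaugeSingularity 0 T a) {σ : ℝ} (hσ : Real.exp (2 * σ) = 2 * T) :
    ∃ (b : Mat) (hb : b.PosDef), (fun s => rescaledState a k s - (⟨b, transpose_eq_of_posDef hb⟩, 0))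
      =O[atBot] fun s => Real.exp s := by
  have hT : Real.sqrt (2 * T) = Real.exp σ := by
    rw [← hσ, mul_comm, Real.exp_mul, Real.rpow_two, Real.sqrt_sq (Real.exp_pos _).le]
  obtain ⟨A, K, hA, hA0, hdA, -, hK⟩ := hc
  rw [hT] at hA hdA hK
  have hmem : ∀ s ≤ σ, Real.exp s ∈ Icc 0 (Real.exp σ) := fun s hs =>
    ⟨(Real.exp_pos s).le, Real.exp_le_exp.2 hs⟩
  have hmetric : ∀ s ≤ σ, rescaledMetric a s = A (Real.exp s) := fun s hs => by
    rw [hA _ ⟨Real.exp_pos s, Real.exp_le_exp.2 hs⟩, rescaledMetric, ← Real.exp_nat_mul]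
    norm_num
  have hvel : ∀ s ≤ σ, rescaledVelocity a k s = Real.exp s • K (Real.exp s) := fun s hsσ => by
    obtain ⟨-, -, h3, -⟩ := hs.rescaled hf₀ hσ hsσ
    have h4 : HasDerivWithinAt (fun s => A (Real.exp s)) (Real.exp s • K (Real.exp s)) (Iic σ) s :=
      HasDerivWithinAt.scomp s (hasDerivWithinAt_mat.2 (hdA _ (hmem s hsσ)))
        (Real.hasDerivAt_exp s).hasDerivWithinAt fun r hr => hmem r hr
    exact (uniqueDiffOn_Iic σ s hsσ).eq_deriv _ h3
      (h4.congr (fun r hr => hmetric r hr) (hmetric s hsσ))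
  have h00 : (0 : ℝ) ∈ Icc 0 (Real.exp σ) := ⟨le_rfl, (Real.exp_pos σ).le⟩
  have hlim : Tendsto Real.exp atBot (𝓝[Icc 0 (Real.exp σ)] 0) :=
    tendsto_nhdsWithin_iff.2 ⟨Real.tendsto_exp_atBot, (eventually_le_atBot σ).mono hmem⟩
  have o1 : (fun s => rescaledMetric a s - A 0) =O[atBot] fun s => Real.exp s := by
    have h1 : (fun τ => A τ - A 0) =O[𝓝[Icc 0 (Real.exp σ)] 0] fun τ => τ - 0 :=
      isBigO_mat fun i j => (hdA 0 h00 i j).hasFDerivWithinAt.isBigO_sub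
    refine (h1.comp_tendsto hlim).congr' ?_ (Eventually.of_forall fun s => by simp)
    filter_upwards [eventually_le_atBot σ] with s hs
    rw [hmetric s hs]
    rfl
  have o2 : rescaledVelocity a k =O[atBot] fun s => Real.exp s := by
    have h1 : K =O[𝓝[Icc 0 (Real.exp σ)] 0] fun _ => (1 : ℝ) := isBigO_mat fun i j =>
      ((hK i j).continuousOn 0 h00).tendsto.isBigO_one ℝ
    refine ((isBigO_refl (fun s => Real.exp s) atBot).smul (h1.comp_tendsto hlim)).congr' ?_
      (Eventually.of_forall fun s => by simp)
    filter_upwards [eventually_le_atBot σ] with s hs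
    rw [hvel s hs]
    rfl
  refine ⟨A 0, hA0, ?_⟩
  have h2 := ((symPart.isBigO_comp _ atBot).trans o1).prod_left ((symPart.isBigO_comp _ atBot).trans o2)
  refine h2.congr_left fun s => Prod.ext ?_ ?_
  · have e : symPart (A 0) = ⟨A 0, transpose_eq_of_posDef hA0⟩ :=
      Subtype.ext (coe_symPart_of_transpose_eq (transpose_eq_of_posDef hA0))
    change symPart (rescaledMetric a s - A 0) = symPart (rescaledMetric a s) - _
    rw [map_sub, e]
  · exact (sub_zero _).symm

lemma IsSolution.limit_fixed_point (hf₀ : AdmissibleData f₀) (hs : IsSolution Λ h f₀ T a k f) {σ : ℝ}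
    (hσ : Real.exp (2 * σ) = 2 * T) {b : Mat} (hb : b.PosDef)
    (hO : (fun s => rescaledState a k s - (⟨b, transpose_eq_of_posDef hb⟩, 0)) =O[atBot]
      fun s => Real.exp s) : source f₀ h b = b := by
  have hlim : Tendsto (rescaledState a k) atBot (𝓝 (⟨b, transpose_eq_of_posDef hb⟩, 0)) :=
    tendsto_sub_nhds_zero_iff.1 (hO.trans_tendsto Real.tendsto_exp_atBot)
  have h1 : Tendsto (fun s => field f₀ h (rescaledState a k s) +
      Real.exp (4 * s) • forcing Λ (rescaledState a k s)) atBot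
      (𝓝 (field f₀ h (⟨b, transpose_eq_of_posDef hb⟩, 0) +
        (0 : ℝ) • forcing Λ (⟨b, transpose_eq_of_posDef hb⟩, 0))) :=
    ((continuousAt_field hf₀.toAdmissibleWeight h hb).tendsto.comp hlim).add
      ((tendsto_exp_mul_atBot four_pos).smul (((forcing Λ).continuous.tendsto _).comp hlim))
  rw [zero_smul, add_zero] at h1
  have h2 := eq_zero_of_tendsto_deriv
    (fun s hsσ => (ContinuousLinearMap.snd ℝ symMat symMat).hasFDerivAt.comp_hasDerivWithinAt s
      (hs.hasDerivWithinAt_rescaledState hf₀.continuous hσ hsσ))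
    ((continuous_snd.tendsto _).comp hlim) ((continuous_snd.tendsto _).comp h1)
  have h3 : accel f₀ h b 0 = 0 := by
    have h4 : (symPart (accel f₀ h b 0) : Mat) = 0 := congrArg Subtype.val h2
    rwa [coe_symPart_of_transpose_eq
      (transpose_accel f₀ h (transpose_eq_of_posDef hb) Matrix.transpose_zero)] at h4
  have h5 : b - source f₀ h b = 0 := by simpa [accel] using h3
  exact (sub_eq_zero.1 h5).symm

lemma IsSolution.eq_of_rescaledState_eq (hs : IsSolution Λ h f₀ T a k f) (hf₀ : Continuous f₀)
    {w : ℝ → State} {t : ℝ} (ht : t ∈ Ioc 0 T) (he : rescaledState a k (logTime t) = w (logTime t)) :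
    a t = physicalMetric w t ∧ k t = physicalVelocity w t := by
  have hT : 0 < T := ht.1.trans_le ht.2
  have hle : logTime t ≤ logTime T :=
    logTime_le ht.1 (by rw [exp_two_mul_logTime hT]; linarith [ht.2])
  obtain ⟨e1, e2⟩ := hs.coe_rescaledState hf₀ (exp_two_mul_logTime hT) hle
  have h2 : 2 * t ≠ 0 := by have := ht.1; positivity
  have e3 : Real.exp (2 * logTime t) / 2 = t := by
    rw [exp_two_mul_logTime ht.1, mul_div_cancel_left₀ _ two_ne_zero]
  rw [he] at e1 e2
  have e4 : k t = (2 : ℝ) • rescaledMetric a (logTime t) + rescaledVelocity a k (logTime t) := by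
    rw [rescaledVelocity, e3, add_sub_cancel]
  refine ⟨?_, ?_⟩
  · rw [physicalMetric, e1, rescaledMetric, e3, exp_two_mul_logTime ht.1, smul_smul,
      mul_inv_cancel₀ h2, one_smul]
  · rw [physicalVelocity, e1, e2, e4]

end uniqueness

lemma isBigO_exp_four {E : Type*} [NormedAddCommGroup E] {x : ℝ → E} {D s₀ : ℝ}
    (hx : ∀ s ≤ s₀, ‖x s‖ ≤ D * Real.exp (4 * s)) : x =O[atBot] fun s => Real.exp (4 * s) :=
  IsBigO.of_bound D <| (eventually_le_atBot s₀).mono fun s hs => by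
    rw [Real.norm_of_nonneg (Real.exp_pos _).le]
    exact hx s hs

lemma eventually_posDef_and_trace {w : ℝ → State} {a₀ : Mat} (ha : a₀.PosDef)
    (hlim : Tendsto w atBot (𝓝 (⟨a₀, transpose_eq_of_posDef ha⟩, 0))) :
    ∀ᶠ s in atBot, ((w s).1 : Mat).PosDef ∧
      -2 ≤ (((w s).1 : Mat)⁻¹ * ((w s).2 : Mat)).trace := by
  have h1 : Tendsto (fun s => ((w s).1 : Mat)) atBot (𝓝 a₀) :=
    (continuous_subtype_val.tendsto _).comp ((continuous_fst.tendsto _).comp hlim)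
  have h2 : Tendsto (fun s => ((w s).2 : Mat)) atBot (𝓝 0) :=
    (continuous_subtype_val.tendsto _).comp ((continuous_snd.tendsto _).comp hlim)
  have h3 : Tendsto (fun s => ((w s).1 : Mat)⁻¹) atBot (𝓝 a₀⁻¹) :=
    (continuousAt_inv (isUnit_det ha)).tendsto.comp h1
  have h4 : Tendsto (fun s => ((w s).1 : Mat)⁻¹ * ((w s).2 : Mat)) atBot (𝓝 (a₀⁻¹ * 0)) :=
    ((continuous_fst.matrix_mul continuous_snd).tendsto (a₀⁻¹, (0 : Mat))).comp (h3.prodMk_nhds h2)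
  have h5 : Tendsto (fun s => (((w s).1 : Mat)⁻¹ * ((w s).2 : Mat)).trace) atBot (𝓝 0) := by
    have := (traceCLM.continuous.tendsto _).comp h4
    simpa [Function.comp_def] using this
  obtain ⟨ε, hε, hball⟩ := exists_ball_posDef ha
  filter_upwards [h1.eventually (Metric.ball_mem_nhds a₀ hε), h5.eventually (lt_mem_nhds
    (by norm_num : (-2 : ℝ) < 0))] with s hs1 hs2
  exact ⟨hball _ hs1 (symMat.transpose_coe _), hs2.le⟩

/-- The unique solution of the Einstein–Vlasov–Maxwell equations with an initial conformal gauge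
singularity, in rescaled variables. -/
theorem AdmissibleData.exists_rescaledSolution {f : Mom → ℝ} (hf : AdmissibleData f)
    {h : Fin 3 → ℝ} {a₀ : Mat} (ha : a₀.PosDef) (hfix : source f h a₀ = a₀) (Λ : ℝ) :
    ∃ (w : ℝ → State) (σ : ℝ), IsRescaledSolution f h Λ σ w ∧
      (fun s => w s - (⟨a₀, transpose_eq_of_posDef ha⟩, 0)) =O[atBot] (fun s => Real.exp (4 * s)) ∧
      ∀ (T' : ℝ) (a' k' : ℝ → Mat) (f' : ℝ → Lp ℝ 1 (volume : Measure Mom)), 0 < T' →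
        IsSolution Λ h f T' a' k' f' → HasConformalGaugeSingularity 0 T' a' →
        ∀ t ∈ Ioc 0 (min (Real.exp (2 * σ) / 2) T'),
          a' t = physicalMetric w t ∧ k' t = physicalVelocity w t := by
  obtain ⟨L, B, β, hL, hsymm, hβ, hB, hBL⟩ := hf.exists_dissipative ha hfix
  obtain ⟨w, s₀, D, hw⟩ := DissipativeODE.exists_solution hL (field_eq_zero ha hfix) (forcing Λ) B
    hsymm hβ hB hBL
  obtain ⟨δ, hδ, s₁, huniq⟩ := DissipativeODE.unique_solution hL (forcing Λ) B hsymm hβ hB hBL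
  have hO := isBigO_exp_four fun s hs => (hw s hs).1
  have hlim := tendsto_state ha hO
  obtain ⟨s₂, hs₂⟩ := eventually_atBot.1 (eventually_posDef_and_trace ha hlim)
  obtain ⟨s₃, hs₃⟩ := eventually_atBot.1 (Metric.tendsto_nhds.1 hlim δ hδ)
  obtain ⟨σ, hσ0, hσ1, hσ2, hσ3⟩ : ∃ σ, σ ≤ s₀ ∧ σ ≤ s₁ ∧ σ ≤ s₂ ∧ σ ≤ s₃ :=
    ⟨min (min s₀ s₁) (min s₂ s₃), by simp, by simp, by simp, by simp⟩
  refine ⟨w, σ, ⟨fun s hs => (hw s (hs.trans hσ0)).2, fun s hs => (hs₂ s (hs.trans hσ2)).1,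
    fun s hs => (hs₂ s (hs.trans hσ2)).2⟩, hO, fun T' a' k' f' hT' hs hc t ht => ?_⟩
  obtain ⟨b, hb, hOb⟩ := hs.exists_limit hf.continuous hc (exp_two_mul_logTime hT')
  obtain rfl : b = a₀ := fixed_point_unique hf hb ha
    (hs.limit_fixed_point hf (exp_two_mul_logTime hT') hb hOb) hfix
  have hlim' := tendsto_sub_nhds_zero_iff.1 (hOb.trans_tendsto Real.tendsto_exp_atBot)
  refine hs.eq_of_rescaledState_eq hf.continuous ⟨ht.1, ht.2.trans (min_le_right _ _)⟩ ?_
  have hsub : Iic (min σ (logTime T')) ⊆ Iic (logTime T') := Iic_subset_Iic.2 (min_le_right _ _)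
  refine (huniq (min σ (logTime T')) ((min_le_left _ _).trans hσ1) w (rescaledState a' k')
    (fun s hsσ => (hw s (hsσ.trans ((min_le_left _ _).trans hσ0))).2.hasDerivWithinAt)
    (fun s hsσ => (hs.hasDerivWithinAt_rescaledState hf.continuous (exp_two_mul_logTime hT')
      (hsσ.trans (min_le_right _ _))).mono hsub)
    (fun s hsσ => ?_) ?_ ?_ (logTime t) (le_min ?_ ?_)).symm
  · rw [← dist_eq_norm]
    exact hs₃ s (hsσ.trans ((min_le_left _ _).trans hσ3))
  · obtain ⟨s₄, hs₄⟩ := eventually_atBot.1 (Metric.tendsto_nhds.1 hlim' δ hδ)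
    exact ⟨s₄, fun s hs => by rw [← dist_eq_norm]; exact hs₄ s hs⟩
  · have hO1 : (fun s => w s - (⟨b, transpose_eq_of_posDef ha⟩, 0)) =O[atBot]
        fun s => Real.exp s :=
      hO.trans <| IsBigO.of_bound 1 <| (eventually_le_atBot 0).mono fun s hs => by
        rw [one_mul, Real.norm_of_nonneg (Real.exp_pos _).le,
          Real.norm_of_nonneg (Real.exp_pos _).le]
        exact Real.exp_le_exp.2 (by linarith)
    obtain ⟨C, hC⟩ := (hO1.sub hOb).bound
    obtain ⟨s₄, hs₄⟩ := eventually_atBot.1 hC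
    refine ⟨C, s₄, fun s hs => ?_⟩
    have := hs₄ s hs
    rwa [sub_sub_sub_cancel_right, Real.norm_of_nonneg (Real.exp_pos _).le] at this
  · exact logTime_le ht.1 (by linarith [ht.2.trans (min_le_left _ _)])
  · exact logTime_le ht.1 (by
      rw [exp_two_mul_logTime hT']
      linarith [ht.2.trans (min_le_right _ _)])

lemma HasConformalGaugeSingularity.of_le {m n : ℕ} {T : ℝ} {a : ℝ → Mat}
    (ha : HasConformalGaugeSingularity n T a) (hmn : m ≤ n) : HasConformalGaugeSingularity m T a := by
  obtain ⟨A, K, h1, h2, h3, h4, h5⟩ := ha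
  exact ⟨A, K, h1, h2, h3, fun i j => (h4 i j).of_le (by exact_mod_cast hmn),
    fun i j => (h5 i j).of_le (by exact_mod_cast hmn)⟩

end BianchiI

theorem theorem1 (f₀ : BianchiI.Mom → ℝ) (h : Fin 3 → ℝ)
    (hf_smooth : ContDiff ℝ ∞ f₀) (hf_supp : HasCompactSupport f₀)
    (hf_zero : (0 : BianchiI.Mom) ∉ tsupport f₀)
    (hf_nonneg : ∀ p, 0 ≤ f₀ p) (hf_ne : ∃ p, f₀ p ≠ 0)
    (hf_momentum : ∀ i : Fin 3, ∫ p : BianchiI.Mom, f₀ p * p i = 0) :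
    ∃ a₀ : Matrix (Fin 3) (Fin 3) ℝ, a₀.PosDef ∧
      ∀ Λ : ℝ, ∃ T : ℝ, 0 < T ∧
        ∃ (a k : ℝ → Matrix (Fin 3) (Fin 3) ℝ) (f : ℝ → Lp ℝ 1 (volume : Measure BianchiI.Mom)),
          -- existence
          BianchiI.IsSolution Λ h f₀ T a k f ∧
          BianchiI.HasConformalGaugeSingularity 0 T a ∧
          -- uniqueness
          (∀ (T' : ℝ) (a' k' : ℝ → Matrix (Fin 3) (Fin 3) ℝ)
              (f' : ℝ → Lp ℝ 1 (volume : Measure BianchiI.Mom)),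
            0 < T' → BianchiI.IsSolution Λ h f₀ T' a' k' f' →
            BianchiI.HasConformalGaugeSingularity 0 T' a' →
            ∀ t ∈ Ioc 0 (min T T'), a' t = a t ∧ k' t = k t ∧ f' t = f t) ∧
          -- asymptotics
          (∀ i j, (fun t => a t i j - 2 * t * a₀ i j) =o[𝓝[>] 0] fun t => t ^ (3 / 2 : ℝ)) ∧
          (∀ i j, (fun t => k t i j - 2 * a₀ i j) =o[𝓝[>] 0] fun t => t ^ (1 / 2 : ℝ)) ∧
          -- small magnetic field
          ((h ⬝ᵥ (a₀ *ᵥ h) < 1 / 6 ∨ h ⬝ᵥ (a₀ *ᵥ h) < a₀.det / 6) →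
            (∀ i j, ContDiffOn ℝ 1 (fun t => a t i j) (Ioc 0 T)) ∧
            (∀ i j, ContDiffOn ℝ 1 (fun t => k t i j) (Ioc 0 T)) ∧
            BianchiI.HasConformalGaugeSingularity 1 T a ∧
            (∀ i j, (fun t => a t i j - 2 * t * a₀ i j) =o[𝓝[>] 0] fun t => t ^ 2) ∧
            (∀ i j, (fun t => k t i j - 2 * a₀ i j) =o[𝓝[>] 0] fun t => t)) := by
  have hf : BianchiI.AdmissibleData f₀ := ⟨⟨hf_smooth.continuous, hf_supp, hf_zero⟩, hf_nonneg, hf_ne⟩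
  have hmom : ∀ i : Fin 3, ∫ p : BianchiI.Mom, f₀ p * p i = 0 := hf_momentum
  obtain ⟨a₀, ha₀, hfix⟩ := hf.exists_fixed_point h
  refine ⟨a₀, ha₀, fun Λ => ?_⟩
  obtain ⟨w, σ, hw, hO, huniq⟩ := hf.exists_rescaledSolution ha₀ hfix Λ
  have hL1 : MemLp f₀ 1 (volume : Measure BianchiI.Mom) := memLp_one_iff_integrable.2 hf.integrable
  have hF : hL1.toLp f₀ =ᵐ[volume] f₀ := hL1.coeFn_toLp
  have hsol := hw.isSolution hf hmom ha₀ hfix (BianchiI.tendsto_state ha₀ hO) hF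
  have hsing := hw.hasConformalGaugeSingularity hf ha₀ hfix hO
  have hmetric := BianchiI.isLittleO_physicalMetric ha₀ hO
  have hvelocity := BianchiI.isLittleO_physicalVelocity ha₀ hO
  refine ⟨Real.exp (2 * σ) / 2, by positivity, BianchiI.physicalMetric w,
    BianchiI.physicalVelocity w, fun _ => hL1.toLp f₀, hsol, hsing.of_le zero_le_one,
    fun T' a' k' f' hT' hs' hc' t ht => ?_, fun i j => ?_, fun i j => ?_, fun _ =>
    ⟨hw.contDiffOn_physicalMetric hf.toAdmissibleWeight,
      hw.contDiffOn_physicalVelocity hf.toAdmissibleWeight, hsing, hmetric, hvelocity⟩⟩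
  · obtain ⟨e1, e2⟩ := huniq T' a' k' f' hT' hs' hc' t ht
    refine ⟨e1, e2, Lp.ext ?_⟩
    exact (hs'.ae_eq hf.continuous ⟨ht.1, ht.2.trans (min_le_right _ _)⟩).trans hF.symm
  · exact (hmetric i j).trans_isBigO (BianchiI.isBigO_pow_rpow 2 (by norm_num))
  · have := BianchiI.isBigO_pow_rpow 1 (r := 1 / 2) (by norm_num)
    simp only [pow_one] at this
    exact (hvelocity i j).trans_isBigO this
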